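/- \textbf{Setup.} Let $B$ be a scheme, let $W$ and $Y$ be smooth $B$-schemes, let $Z$ be a flat $B$-scheme locally of finite presentation with a closed immersion $i: Z\to W$ over $B$, let $\psi: X\to Z$ be a smooth surjective morphism, and let $f: X\to Y\times_B W$ be a closed immersion with $p_2\circ f=i\circ\psi$. Assume that $Z\subset W$ is an effective Cartier divisor. Then $D:=Y\times_B Z\subset Y\times_B W$ is an effective Cartier divisor and $f$ factors through a closed immersion $f': X\to Y\times_B Z$. Let $\mathscr J\subset\mathscr I$ be the ideal sheaves of $D$ and of $X$ in $Y\times_B W$, let $\mathscr J_X:=f^*\mathscr J$ (a line bundle on $X$), let $\mathscr C_{f'}:=\mathscr I/(\mathscr I^2+\mathscr J)$ be the conormal sheaf of $f'$ and $\mathscr N_{f'}$ its dual. The parameterized deformation space is the affine blow-up $b:\mathrm D(X,i,f)\to Y\times_B W$ of $Y\times_B W$ in $X$ along $D$, i.e. the relative spectrum of the degree-zero part of the localization of $\bigoplus_{n\ge0}\mathscr I^n$ at the local generators of $\mathscr J$ placed in degree one (equivalently, the complement of $V_+(\mathscr J)$ in $\mathrm{Proj}\bigoplus_{n\ge 0}\mathscr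 I^n$), and $\pi:=p_2\circ b:\mathrm D(X,i,f)\to W$. A closed immersion is called regular if its ideal is, locally around every point of the subscheme, generated by a regular sequence. \textbf{Proposition.} (1) The morphism $\pi^{-1}(W\setminus Z)\to W\setminus Z$ is isomorphic over $W\setminus Z$ to the projection $Y\times_B(W\setminus Z)\to W\setminus Z$, by an isomorphism compatible with $b$. (2) If $f'$ is regular, then $\mathscr C_{f'}$ is locally free of finite rank and the morphism $\pi^{-1}(Z)\to Z$ is a composite $\pi^{-1}(Z)\xrightarrow{p}X\xrightarrow{\psi}Z$, where $f\circ p$ is the restriction of $b$ and $p$ is a (Zariski-locally trivial) torsor under the vector bundle $\mathscr N_{f'}\otimes\mathscr J_X$. In particular, if $Z$ is defined in $W$ by a global function, then $p$ is a torsor under the normal bundle $\mathscr N_{f'}$. (3) If $i$ and $f'$ are regular, then $\pi$ is smooth; if moreover $Y$ is of finite presentation over $B$ (locally of finite presentation, quasi-compact and quasi-separated), then so is $\pi$. Moreover, if $f$ is regular then so is $f'$, so the hypothesis on $f'$ in (2) and (3) holds when $f$ is regular. -/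

import Mathlib

open CategoryTheory Limits AlgebraicGeometry TopologicalSpace
universe u
namespace ParamDeformation

/-- The closed subscheme with ideal sheaf `J` is an effective Cartier divisor: its ideal sheaf is
invertible, i.e. every point has an affine open neighbourhood on which `J` is generated by a
nonzerodivisor (a unit, away from the divisor). -/
def IsEffectiveCartier {P : Scheme.{u}} (J : P.IdealSheafData) : Prop :=
  ∀ x : P, ∃ U : P.affineOpens, x ∈ U.1 ∧
    ∃ g ∈ nonZeroDivisors Γ(P, U.1), J.ideal U = Ideal.span {g}

/-- An invertible ideal is finitely generated on every affine open. -/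
theorem IsEffectiveCartier.fg {P : Scheme.{u}} {J : P.IdealSheafData} (hJ : IsEffectiveCartier J)
    (U : P.affineOpens) : (J.ideal U).FG := by
  have : ∀ x : U.1, ∃ r : Γ(P, U.1), x.1 ∈ P.basicOpen r ∧ (J.ideal (P.affineBasicOpen r)).FG := by
    intro x
    obtain ⟨V, hxV, g, -, hg⟩ := hJ x.1
    obtain ⟨r, s, e, hr⟩ := exists_basicOpen_le_affine_inter U.2 V.2 x.1 ⟨x.2, hxV⟩
    refine ⟨r, hr, ?_⟩
    have hle : P.affineBasicOpen r ≤ V := (e.le.trans (P.basicOpen_le s) : P.basicOpen r ≤ V.1)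
    rw [← J.map_ideal hle]
    exact Ideal.FG.map ⟨{g}, by simp [hg]⟩ _
  choose r hr hfg using this
  have hspan : Ideal.span (Set.range r) = ⊤ := by
    rw [← U.2.self_le_iSup_basicOpen_iff]
    exact fun x hx ↦ TopologicalSpace.Opens.mem_iSup.mpr ⟨⟨_, _, rfl⟩, hr ⟨x, hx⟩⟩
  refine Ideal.fg_of_localizationSpan _ hspan ?_
  rintro ⟨_, x, rfl⟩
  have := U.2.isLocalization_basicOpen (r x)
  have h := hfg x
  rw [← J.map_ideal_basicOpen] at h
  let e := IsLocalization.algEquiv (Submonoid.powers (r x)) Γ(P, P.basicOpen (r x))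
    (Localization.Away (r x))
  have h2 : algebraMap Γ(P, U.1) (Localization.Away (r x)) = e.toRingEquiv.toRingHom.comp
      (algebraMap Γ(P, U.1) Γ(P, P.basicOpen (r x))) := by
    ext z
    exact (e.commutes z).symm
  rw [h2, ← Ideal.map_map]
  exact Ideal.FG.map h _

/-- The open complement `P ∖ D` of the closed subscheme `D` with ideal sheaf `J`. -/
def complement {P : Scheme.{u}} (J : P.IdealSheafData) : P.Opens := J.support.compl

theorem IsEffectiveCartier.isCompact_inf {P : Scheme.{u}} {J : P.IdealSheafData}
    (hJ : IsEffectiveCartier J) (U : P.affineOpens) :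
    IsCompact (X := P) ((U.1 ⊓ complement J : P.Opens) : Set P) := by
  obtain ⟨s, hs⟩ := hJ.fg U
  have : ((U.1 ⊓ complement J : P.Opens) : Set P) = ⋃ a ∈ s, (P.basicOpen (U := U.1) a : Set P) := by
    ext x
    simp only [complement, Opens.coe_inf, Set.mem_inter_iff, SetLike.mem_coe, Set.mem_iUnion,
      exists_prop]
    constructor
    · rintro ⟨hxU, hx⟩
      have hx' : x ∉ J.support := hx
      rw [J.mem_support_iff_of_mem hxU, ← hs, Scheme.mem_zeroLocus_iff] at hx'
      by_contra! hc
      apply hx'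
      intro a ha
      induction ha using Submodule.span_induction with
      | mem y hy => exact hc y hy
      | zero => simp
      | add y z _ _ h1 h2 =>
        intro h
        rcases (P.basicOpen_add_le y z h) with h | h
        exacts [h1 h, h2 h]
      | smul a y _ h =>
        intro h'
        rw [smul_eq_mul, Scheme.basicOpen_mul] at h'
        exact h h'.2
    · rintro ⟨a, ha, hxa⟩
      have hxU := P.basicOpen_le a hxa
      refine ⟨hxU, fun hx ↦ ?_⟩
      have hx' : x ∈ J.support := hx
      rw [J.mem_support_iff_of_mem hxU, Scheme.mem_zeroLocus_iff] at hx'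
      exact hx' a (hs ▸ Ideal.subset_span ha) hxa
  rw [this]
  exact s.isCompact_biUnion fun a _ ↦ (U.2.basicOpen a).isCompact

/-- The restriction `Γ(U, 𝒪) → Γ(U ∖ D, 𝒪)`. -/
noncomputable abbrev resCompl {P : Scheme.{u}} (J : P.IdealSheafData) (U : P.Opens) :
    Γ(P, U) →+* Γ(P, U ⊓ complement J) :=
  (P.presheaf.map (homOfLE (inf_le_left : U ⊓ complement J ≤ U)).op).hom

/-! ### Affine blow-ups

For an effective Cartier divisor `D` with ideal sheaf `J` and a closed subscheme `X ⊆ D` with ideal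
sheaf `I ⊇ J`, the affine blow-up of `P` in `X` along `D` is the relative spectrum of the affine
blow-up algebra, i.e. of the degree zero part of the localisation of the Rees algebra `⨁ I ^ n` at
the local generators of `J` placed in degree one; equivalently, it is the complement of `V₊(J)` in
the blow-up `Proj (⨁ I ^ n)`. As `J` is invertible, this algebra is the algebra `⋃ J ^ (-n) I ^ n` of
functions on `P ∖ D`; where `J = (g)`, its elements are the fractions `b / g ^ n` with `b ∈ I ^ n`
(see `mem_blowupAlgebra_iff`). -/

/-- The sections of the affine blow-up algebra over an affine open `U`: the functions `s` on
`U ∖ D` such that `J ^ n * s ⊆ I ^ n` for some `n`. -/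
def blowupAlgebra {P : Scheme.{u}} (I J : P.IdealSheafData) (hJI : J ≤ I) (U : P.affineOpens) :
    Subring Γ(P, U.1 ⊓ complement J) where
  carrier := {s | ∃ n : ℕ, ∀ a ∈ J.ideal U ^ n, ∃ b ∈ I.ideal U ^ n, resCompl J U.1 a * s = resCompl J U.1 b}
  one_mem' := ⟨0, fun a ha ↦ ⟨a, by simp, by simp⟩⟩
  zero_mem' := ⟨0, fun a ha ↦ ⟨0, by simp, by simp⟩⟩
  mul_mem' := by
    rintro s t ⟨n, hn⟩ ⟨m, hm⟩
    refine ⟨n + m, fun a ha ↦ ?_⟩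
    rw [pow_add] at ha ⊢
    induction ha using Submodule.mul_induction_on' with
    | mem_mul_mem a ha b hb =>
      obtain ⟨c, hc, h1⟩ := hn a ha
      obtain ⟨d, hd, h2⟩ := hm b hb
      refine ⟨c * d, Ideal.mul_mem_mul hc hd, ?_⟩
      rw [map_mul, map_mul, ← h1, ← h2]; ring
    | add x _ y _ hx hy =>
      obtain ⟨c, hc, h1⟩ := hx
      obtain ⟨d, hd, h2⟩ := hy
      exact ⟨c + d, add_mem hc hd, by rw [map_add, map_add, add_mul, h1, h2]⟩
  add_mem' := by
    rintro s t ⟨n, hn⟩ ⟨m, hm⟩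
    refine ⟨n + m, fun a ha ↦ ?_⟩
    rw [pow_add] at ha ⊢
    induction ha using Submodule.mul_induction_on' with
    | mem_mul_mem a ha b hb =>
      obtain ⟨c, hc, h1⟩ := hn a ha
      obtain ⟨d, hd, h2⟩ := hm b hb
      refine ⟨c * b + a * d, add_mem
        (Ideal.mul_mem_mul hc (Ideal.pow_right_mono (hJI U) m hb))
        (Ideal.mul_mem_mul (Ideal.pow_right_mono (hJI U) n ha) hd), ?_⟩
      simp only [map_mul, map_add, ← h1, ← h2]; ring
    | add x _ y _ hx hy =>
      obtain ⟨c, hc, h1⟩ := hx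
      obtain ⟨d, hd, h2⟩ := hy
      exact ⟨c + d, add_mem hc hd, by rw [map_add, map_add, add_mul, h1, h2]⟩
  neg_mem' := by
    rintro s ⟨n, hn⟩
    refine ⟨n, fun a ha ↦ ?_⟩
    obtain ⟨c, hc, h1⟩ := hn a ha
    exact ⟨-c, neg_mem hc, by rw [map_neg, mul_neg, h1]⟩

/-- Where `J = (g)`, the affine blow-up algebra consists of the fractions `b / g ^ n`, `b ∈ I ^ n`. -/
theorem mem_blowupAlgebra_iff {P : Scheme.{u}} (I J : P.IdealSheafData) (hJI : J ≤ I)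
    (U : P.affineOpens) (g : Γ(P, U.1)) (hg : J.ideal U = Ideal.span {g})
    (s : Γ(P, U.1 ⊓ complement J)) :
    s ∈ blowupAlgebra I J hJI U ↔
      ∃ n : ℕ, ∃ b ∈ I.ideal U ^ n, resCompl J U.1 g ^ n * s = resCompl J U.1 b := by
  refine exists_congr fun n ↦ ⟨fun h ↦ ?_, ?_⟩
  · obtain ⟨b, hb, e⟩ := h (g ^ n) (Ideal.pow_mem_pow (hg ▸ Ideal.mem_span_singleton_self g) n)
    exact ⟨b, hb, by rw [← e, map_pow]⟩
  · rintro ⟨b, hb, e⟩ a ha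
    rw [hg, Ideal.span_singleton_pow, Ideal.mem_span_singleton'] at ha
    obtain ⟨c, rfl⟩ := ha
    exact ⟨c * b, Ideal.mul_mem_left _ _ hb, by rw [map_mul, map_mul, ← e, map_pow, mul_assoc]⟩

/-- Functions on `U` lie in the affine blow-up algebra. -/
theorem res_mem_blowupAlgebra {P : Scheme.{u}} (I J : P.IdealSheafData) (hJI : J ≤ I)
    (U : P.affineOpens) (a : Γ(P, U.1)) : resCompl J U.1 a ∈ blowupAlgebra I J hJI U :=
  ⟨0, fun c _ ↦ ⟨c * a, by simp, by simp⟩⟩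

/-- Restriction maps preserve the affine blow-up algebra. -/
theorem blowupAlgebra_restrict {P : Scheme.{u}} (I J : P.IdealSheafData) (hJI : J ≤ I)
    {U V : P.affineOpens} (h : V ≤ U) (s : Γ(P, U.1 ⊓ complement J)) (hs : s ∈ blowupAlgebra I J hJI U) :
    (P.presheaf.map (homOfLE (inf_le_inf_right (complement J) h)).op).hom s ∈
      blowupAlgebra I J hJI V := by
  obtain ⟨n, hn⟩ := hs
  refine ⟨n, fun a ha ↦ ?_⟩
  rw [← J.map_ideal h, ← Ideal.map_pow] at ha
  have key (x : Γ(P, U.1)) : (P.presheaf.map (homOfLE (inf_le_inf_right (complement J) h)).op).hom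
      (resCompl J U.1 x) = resCompl J V.1 ((P.presheaf.map (homOfLE h).op).hom x) := by
    simp only [resCompl, ← RingHom.comp_apply, ← CommRingCat.hom_comp, ← Functor.map_comp]
    rfl
  induction ha using Submodule.span_induction with
  | mem x hx =>
    obtain ⟨a, ha, rfl⟩ := hx
    obtain ⟨b, hb, e⟩ := hn a ha
    refine ⟨(P.presheaf.map (homOfLE h).op).hom b, ?_, ?_⟩
    · rw [← I.map_ideal h, ← Ideal.map_pow]
      exact Ideal.mem_map_of_mem _ hb
    · erw [← key, ← key, ← e, map_mul]
  | zero => exact ⟨0, zero_mem _, by simp⟩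
  | add x y _ _ hx hy =>
    obtain ⟨c, hc, h1⟩ := hx
    obtain ⟨d, hd, h2⟩ := hy
    exact ⟨c + d, add_mem hc hd, by rw [map_add, map_add, add_mul, h1, h2]⟩
  | smul c x _ hx =>
    obtain ⟨d, hd, h1⟩ := hx
    exact ⟨c * d, Ideal.mul_mem_left _ _ hd, by rw [smul_eq_mul, map_mul, map_mul, mul_assoc, h1]⟩

open Scheme.AffineZariskiSite in
/-- The affine blow-up algebra, on the small affine Zariski site. -/
noncomputable def blowupPresheaf {P : Scheme.{u}} (I J : P.IdealSheafData) (hJI : J ≤ I) :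
    P.AffineZariskiSiteᵒᵖ ⥤ CommRingCat.{u} where
  obj U := .of (blowupAlgebra I J hJI U.unop)
  map {U V} i := CommRingCat.ofHom
    ((P.presheaf.map (homOfLE (inf_le_inf_right (complement J)
      (toOpens_mono i.unop.le))).op).hom.restrict _ _
      (blowupAlgebra_restrict I J hJI (toOpens_mono i.unop.le)))
  map_id U := by
    ext x
    change (P.presheaf.map (𝟙 _)).hom x.1 = x.1
    simp
  map_comp {U V W} i j := by
    ext x
    change (P.presheaf.map _).hom x.1 = (P.presheaf.map _).hom ((P.presheaf.map _).hom x.1)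
    rw [← RingHom.comp_apply, ← CommRingCat.hom_comp, ← Functor.map_comp]
    rfl

open Scheme.AffineZariskiSite in
/-- The structure map from `𝒪` to the affine blow-up algebra. -/
noncomputable def blowupPresheafMap {P : Scheme.{u}} (I J : P.IdealSheafData) (hJI : J ≤ I) :
    (toOpensFunctor P).op ⋙ P.presheaf ⟶ blowupPresheaf I J hJI where
  app U := CommRingCat.ofHom ((resCompl J U.unop.1).codRestrict _
    (res_mem_blowupAlgebra I J hJI U.unop))
  naturality {U V} i := by
    ext x
    apply Subtype.ext
    change (P.presheaf.map _).hom ((P.presheaf.map _).hom x) =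
      (P.presheaf.map _).hom ((P.presheaf.map _).hom x)
    rw [← RingHom.comp_apply, ← CommRingCat.hom_comp, ← RingHom.comp_apply, ← CommRingCat.hom_comp]
    erw [← Functor.map_comp, ← Functor.map_comp]
    rfl

/-- The algebra behind the quasi-coherence of the affine blow-up algebra. -/
theorem exists_lift_of_localization {A A' K K' : Type u} [CommRing A] [CommRing A'] [CommRing K]
    [CommRing K'] (ρ : A →+* K) (ρ' : A' →+* K') (α : A →+* A') (κ : K →+* K') (r : A)
    (hcomm : ∀ a, κ (ρ a) = ρ' (α a))
    (hA : ∀ (L : Ideal A), ∀ b ∈ L.map α, ∃ m : ℕ, ∃ c ∈ L, α c = α r ^ m * b)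
    (hK : ∀ s : K', ∃ m : ℕ, ∃ t, κ t = κ (ρ r) ^ m * s)
    (hK0 : ∀ t : K, κ t = 0 → ∃ m : ℕ, ρ r ^ m * t = 0)
    (I J : Ideal A) (hJ : J.FG) (s : K') (n : ℕ)
    (hs : ∀ a ∈ (J.map α) ^ n, ∃ b ∈ (I.map α) ^ n, ρ' a * s = ρ' b) :
    ∃ m : ℕ, ∃ t, κ t = κ (ρ r) ^ m * s ∧ ∀ a ∈ J ^ n, ∃ b ∈ I ^ n, ρ a * t = ρ b := by
  obtain ⟨m, t, ht⟩ := hK s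
  have main : ∀ a ∈ J ^ n, ∃ k : ℕ, ∃ b ∈ I ^ n, ρ a * (ρ r ^ k * t) = ρ b := by
    intro a ha
    obtain ⟨b', hb', e⟩ := hs (α a) (by rw [← Ideal.map_pow]; exact Ideal.mem_map_of_mem _ ha)
    rw [← Ideal.map_pow] at hb'
    obtain ⟨k, c, hc, e'⟩ := hA _ b' hb'
    obtain ⟨l, hl⟩ := hK0 (ρ a * (ρ r ^ k * t) - ρ r ^ m * ρ c) (by
      simp only [map_sub, map_mul, map_pow, ht]
      simp only [hcomm, e', map_mul, map_pow, ← e]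
      ring)
    refine ⟨l + k, r ^ (l + m) * c, Ideal.mul_mem_left _ _ hc, ?_⟩
    simp only [map_mul, map_pow]
    linear_combination hl
  obtain ⟨S, hS⟩ := Ideal.FG.pow hJ (n := n)
  choose k hk using main
  have hSJ (a) (ha : a ∈ S) : a ∈ J ^ n := hS ▸ Ideal.subset_span ha
  let N := S.attach.sup fun a ↦ k a.1 (hSJ a.1 a.2)
  refine ⟨N + m, ρ r ^ N * t, by simp only [map_mul, map_pow, ht]; ring, fun a ha ↦ ?_⟩
  rw [← hS] at ha
  induction ha using Submodule.span_induction with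
  | mem x hx =>
    obtain ⟨b, hb, e⟩ := hk x (hSJ x hx)
    have hle : k x (hSJ x hx) ≤ N :=
      Finset.le_sup (f := fun a : S ↦ k a.1 (hSJ a.1 a.2)) (S.mem_attach ⟨x, hx⟩)
    obtain ⟨d, hd⟩ := Nat.exists_eq_add_of_le hle
    refine ⟨r ^ d * b, Ideal.mul_mem_left _ _ hb, ?_⟩
    rw [hd, map_mul, map_pow, ← e]; ring
  | zero => exact ⟨0, zero_mem _, by simp⟩
  | add x y _ _ hx hy =>
    obtain ⟨c, hc, h1⟩ := hx
    obtain ⟨d, hd, h2⟩ := hy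
    exact ⟨c + d, add_mem hc hd, by rw [map_add, map_add, add_mul, h1, h2]⟩
  | smul c x _ hx =>
    obtain ⟨d, hd, h1⟩ := hx
    exact ⟨c * d, Ideal.mul_mem_left _ _ hd, by rw [smul_eq_mul, map_mul, map_mul, mul_assoc, h1]⟩

/-- The affine blow-up algebra is quasi-coherent: its sections over `D(r) ⊆ U` are the localisation
at `r` of its sections over `U`. -/
theorem coequifibered_blowupPresheafMap {P : Scheme.{u}} (I J : P.IdealSheafData) (hJI : J ≤ I)
    (hJ : IsEffectiveCartier J) : (blowupPresheafMap I J hJI).Coequifibered := by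
  refine Scheme.AffineZariskiSite.coequifibered_iff_forall_isLocalizationAway.mpr fun U r ↦ ?_
  have hloc := U.2.isLocalization_basicOpen r
  have hc : IsCompact (X := P) ((U.1 ⊓ complement J : P.Opens) : Set P) := hJ.isCompact_inf U
  have hq : IsQuasiSeparated (α := P) ((U.1 ⊓ complement J : P.Opens) : Set P) :=
    U.2.isQuasiSeparated.of_subset inf_le_left
  have hb : P.basicOpen (resCompl J U.1 r) = P.basicOpen r ⊓ complement J := by
    rw [resCompl, Scheme.basicOpen_res]
    apply le_antisymm
    · exact le_inf inf_le_right (inf_le_left.trans inf_le_right)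
    · exact le_inf (le_inf (inf_le_left.trans (P.basicOpen_le r)) inf_le_right) inf_le_left
  let κ : Γ(P, U.1 ⊓ complement J) →+* Γ(P, P.basicOpen r ⊓ complement J) :=
    (P.presheaf.map (homOfLE (inf_le_inf_right (complement J) (P.basicOpen_le r))).op).hom
  let α : Γ(P, U.1) →+* Γ(P, P.basicOpen r) := (P.presheaf.map (homOfLE (P.basicOpen_le r)).op).hom
  have hcomm (a) : κ (resCompl J U.1 a) = resCompl J (P.basicOpen r) (α a) := by
    simp only [κ, α, resCompl, ← RingHom.comp_apply, ← CommRingCat.hom_comp, ← Functor.map_comp]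
    rfl
  have hKloc : (∀ s, ∃ m : ℕ, ∃ t, κ t = κ (resCompl J U.1 r) ^ m * s) ∧
      (∀ t, κ t = 0 → ∃ m : ℕ, resCompl J U.1 r ^ m * t = 0) := by
    have h := isLocalization_basicOpen_of_qcqs hc hq (resCompl J U.1 r)
    have h1 : ∀ W, ∀ (hW : W = P.basicOpen (resCompl J U.1 r)) (hle : W ≤ U.1 ⊓ complement J),
        (∀ s, ∃ m : ℕ, ∃ t, (P.presheaf.map (homOfLE hle).op).hom t =
          (P.presheaf.map (homOfLE hle).op).hom (resCompl J U.1 r) ^ m * s) ∧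
      (∀ t, (P.presheaf.map (homOfLE hle).op).hom t = 0 →
        ∃ m : ℕ, resCompl J U.1 r ^ m * t = 0) := by
      rintro W rfl hle
      refine ⟨fun s ↦ ?_, fun t ht ↦ ?_⟩
      · obtain ⟨⟨t, _, m, rfl⟩, e⟩ := IsLocalization.surj (Submonoid.powers (resCompl J U.1 r)) s
        refine ⟨m, t, e.symm.trans ?_⟩
        rw [mul_comm, map_pow]
        rfl
      · obtain ⟨⟨_, m, rfl⟩, e⟩ := (IsLocalization.map_eq_zero_iff
          (Submonoid.powers (resCompl J U.1 r)) _ t).mp ht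
        exact ⟨m, e⟩
    exact h1 _ hb.symm _
  have hAloc (L : Ideal Γ(P, U.1)) : ∀ b ∈ L.map α, ∃ m : ℕ, ∃ c ∈ L, α c = α r ^ m * b := by
    intro b hb
    obtain ⟨⟨c, ⟨_, m, rfl⟩⟩, e⟩ :=
      (IsLocalization.mem_map_algebraMap_iff (.powers r) Γ(P, P.basicOpen r)).mp hb
    refine ⟨m, c, c.2, e.symm.trans ?_⟩
    rw [mul_comm, map_pow]
    rfl
  let := ((blowupPresheaf I J hJI).map (homOfLE (U.basicOpen_le r)).op).hom.toAlgebra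
  refine (isLocalization_iff _ _).mpr ⟨?_, ?_, ?_⟩
  · rintro ⟨_, m, rfl⟩
    rw [map_pow]
    refine IsUnit.pow _ ?_
    obtain ⟨v, hv⟩ : ∃ v : Γ(P, P.basicOpen r), α r * v = 1 :=
      (P.toRingedSpace.isUnit_res_basicOpen r).exists_right_inv
    refine .of_mul_eq_one ⟨_, res_mem_blowupAlgebra I J hJI (P.affineBasicOpen (U := U) r) v⟩ ?_
    apply Subtype.ext
    change κ (resCompl J U.1 r) * resCompl J (P.basicOpen r) v = 1
    rw [hcomm]
    exact (map_mul _ _ _).symm.trans ((congrArg _ hv).trans (map_one _))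
  · rintro ⟨(s : Γ(P, P.basicOpen r ⊓ complement J)), n, hs⟩
    have hs' : ∀ a ∈ ((J.ideal U).map α) ^ n, ∃ b ∈ ((I.ideal U).map α) ^ n,
        resCompl J (P.basicOpen r) a * s = resCompl J (P.basicOpen r) b := by
      rw [J.map_ideal_basicOpen U r, I.map_ideal_basicOpen U r]
      exact hs
    obtain ⟨m, t, ht, h⟩ := exists_lift_of_localization (resCompl J U.1)
      (resCompl J (P.basicOpen r)) α κ r hcomm hAloc hKloc.1 hKloc.2 _ _ (hJ.fg U) s n hs'
    refine ⟨⟨⟨t, n, h⟩, ⟨_, m, rfl⟩⟩, ?_⟩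
    refine (mul_comm _ _).trans ?_
    rw [map_pow]
    exact Subtype.ext ht.symm
  · rintro x y hxy
    have h0 : κ (x.1 - y.1) = 0 := by
      rw [map_sub, sub_eq_zero]
      exact congrArg Subtype.val hxy
    obtain ⟨m, hm⟩ := hKloc.2 _ h0
    refine ⟨⟨_, m, rfl⟩, Subtype.ext ?_⟩
    rw [mul_sub, sub_eq_zero] at hm
    exact hm

/-- The affine blow-up of `P` in the closed subscheme with ideal sheaf `I`, along the effective
Cartier divisor with ideal sheaf `J`: the relative spectrum over `P` of the affine blow-up algebra. -/
noncomputable def affineBlowup {P : Scheme.{u}} (I J : P.IdealSheafData) (hJI : J ≤ I)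
    (hJ : IsEffectiveCartier J) : Scheme.{u} :=
  (Scheme.AffineZariskiSite.relativeGluingData
    (coequifibered_blowupPresheafMap I J hJI hJ)).glued

/-- The structure morphism (blow-down) from the affine blow-up to `P`. -/
noncomputable def affineBlowupMap {P : Scheme.{u}} (I J : P.IdealSheafData) (hJI : J ≤ I)
    (hJ : IsEffectiveCartier J) : affineBlowup I J hJI hJ ⟶ P :=
  (Scheme.AffineZariskiSite.relativeGluingData
    (coequifibered_blowupPresheafMap I J hJI hJ)).toBase


/-! ### Flat pullback of effective Cartier divisors -/

theorem comap_ideal_top {V U : Scheme.{u}} [IsAffine V] [IsAffine U] (f : V ⟶ U)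
    (I : U.IdealSheafData) :
    (I.comap f).ideal ⟨⊤, isAffineOpen_top V⟩ =
      (I.ideal ⟨⊤, isAffineOpen_top U⟩).map f.appTop.hom := by
  apply le_antisymm
  · have : I.comap f ≤ Scheme.IdealSheafData.ofIdealTop
        ((I.ideal ⟨⊤, isAffineOpen_top U⟩).map f.appTop.hom) := by
      rw [← Scheme.IdealSheafData.le_map_iff_comap_le]
      apply Scheme.IdealSheafData.le_of_isAffine
      rw [Scheme.IdealSheafData.ideal_map _ f ⟨⊤, isAffineOpen_top U⟩ (isAffineOpen_top V)]
      rw [← Ideal.map_le_iff_le_comap]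
      simp
      exact fun x hx ↦ hx
    refine (this _).trans ?_
    simp
  · have := (Scheme.IdealSheafData.le_map_comap I f) ⟨⊤, isAffineOpen_top U⟩
    rw [Scheme.IdealSheafData.ideal_map _ f ⟨⊤, isAffineOpen_top U⟩ (isAffineOpen_top V)] at this
    exact Ideal.map_le_iff_le_comap.mpr this

theorem comap_ι_ideal_top {P : Scheme.{u}} (I : P.IdealSheafData) (V : P.affineOpens) [IsAffine V.1] :
    (I.comap V.1.ι).ideal ⟨⊤, isAffineOpen_top _⟩ =
      (I.ideal V).map V.1.topIso.inv.hom := by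
  rw [Scheme.IdealSheafData.ideal_comap_of_isOpenImmersion]
  have h : V.1.ι ''ᵁ ⊤ ≤ V.1 := by simp
  have e := I.map_ideal
    (U := ⟨V.1.ι ''ᵁ ⊤, (isAffineOpen_top V.1.toScheme).image_of_isOpenImmersion V.1.ι⟩) (V := V) h
  refine Eq.trans ?_ e.symm
  erw [Scheme.Opens.ι_appIso]
  exact Ideal.comap_id _

theorem comap_ideal_eq_map {P W : Scheme.{u}} (f : P ⟶ W) (I : W.IdealSheafData)
    (U : W.affineOpens) (V : P.affineOpens) (h : V.1 ≤ f ⁻¹ᵁ U.1) :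
    (I.comap f).ideal V = (I.ideal U).map (f.appLE U.1 V.1 h).hom := by
  have : IsAffine U.1 := U.2
  have : IsAffine V.1 := V.2
  have h1 := comap_ideal_top (f.resLE U.1 V.1 h) (I.comap U.1.ι)
  rw [← Scheme.IdealSheafData.comap_comp, Scheme.Hom.resLE_comp_ι,
    Scheme.IdealSheafData.comap_comp, comap_ι_ideal_top, comap_ι_ideal_top, Ideal.map_map,
    ← CommRingCat.hom_comp, Scheme.Hom.appTop, Scheme.Hom.resLE_app_top] at h1
  have h2 := congrArg (Ideal.map V.1.topIso.hom.hom) h1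
  rw [Ideal.map_map, Ideal.map_map, ← CommRingCat.hom_comp, ← CommRingCat.hom_comp] at h2
  simp only [Category.assoc, Iso.inv_hom_id, Iso.inv_hom_id_assoc, Category.comp_id,
    CommRingCat.hom_id, Ideal.map_id] at h2
  exact h2

theorem IsEffectiveCartier.comap {P W : Scheme.{u}} {I : W.IdealSheafData}
    (hI : IsEffectiveCartier I) (f : P ⟶ W) [Flat f] : IsEffectiveCartier (I.comap f) := by
  intro x
  obtain ⟨U, hxU, g, hg, hgI⟩ := hI (f x)
  obtain ⟨_, ⟨V, hV, rfl⟩, hxV, hVU⟩ :=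
    P.isBasis_affineOpens.exists_subset_of_mem_open (a := x) (u := f ⁻¹ᵁ U.1) hxU (f ⁻¹ᵁ U.1).2
  refine ⟨⟨V, hV⟩, hxV, (f.appLE U.1 V hVU).hom g, ?_, ?_⟩
  · have hflat := f.flat_appLE U.2 hV hVU
    algebraize [(f.appLE U.1 V hVU).hom]
    have h1 : IsSMulRegular Γ(P, V) g := Module.Flat.isSMulRegular_of_nonZeroDivisors hg
    rw [mem_nonZeroDivisors_iff_right]
    intro z hz
    refine h1 ?_
    change g • z = g • 0
    rw [smul_zero, Algebra.smul_def, mul_comm]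
    exact hz
  · rw [comap_ideal_eq_map f I U ⟨V, hV⟩ hVU, hgI, Ideal.map_span, Set.image_singleton]


/-! ### Regular immersions -/

/-- A closed immersion is regular if, locally around every point of the subscheme, its ideal is
generated by a regular sequence. -/
def IsRegularImmersion {Z W : Scheme.{u}} (i : Z ⟶ W) : Prop :=
  IsClosedImmersion i ∧ ∀ z : Z, ∃ U : W.affineOpens, i z ∈ U.1 ∧
    ∃ rs : List Γ(W, U.1), RingTheory.Sequence.IsRegular Γ(W, U.1) rs ∧
      i.ker.ideal U = Ideal.ofList rs

/-! ### Modules on affine opens, and torsors under vector bundles -/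

/-- A presheaf of modules on the affine opens of a scheme (this is how quasi-coherent modules are
presented here). -/
structure AffineModule (P : Scheme.{u}) where
  /-- The module of sections over an affine open. -/
  obj : P.affineOpens → Type u
  [addCommGroup : ∀ U, AddCommGroup (obj U)]
  [module : ∀ U : P.affineOpens, Module Γ(P, U.1) (obj U)]
  /-- The restriction maps. -/
  res : ∀ {U V : P.affineOpens} (h : V.1 ≤ U.1),
    obj U →ₛₗ[(P.presheaf.map (homOfLE h).op).hom] obj V
  res_self : ∀ (U : P.affineOpens) (x : obj U), res le_rfl x = x
  res_res : ∀ {U V V' : P.affineOpens} (h : V.1 ≤ U.1) (h' : V'.1 ≤ V.1) (x : obj U),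
    res h' (res h x) = res (h'.trans h) x

attribute [instance] AffineModule.addCommGroup AffineModule.module

/-- Restriction of functions, as a semilinear map. -/
noncomputable def resₛₗ (P : Scheme.{u}) {U V : P.affineOpens} (h : V.1 ≤ U.1) :
    Γ(P, U.1) →ₛₗ[(P.presheaf.map (homOfLE h).op).hom] Γ(P, V.1) where
  toFun a := (P.presheaf.map (homOfLE h).op).hom a
  map_add' a b := map_add _ a b
  map_smul' a b := map_mul _ a b

theorem resₛₗ_self (P : Scheme.{u}) (U : P.affineOpens) (x : Γ(P, U.1)) :
    resₛₗ P (le_refl U.1) x = x := by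
  change (P.presheaf.map (𝟙 _)).hom x = x
  simp

theorem resₛₗ_resₛₗ (P : Scheme.{u}) {U V V' : P.affineOpens} (h : V.1 ≤ U.1) (h' : V'.1 ≤ V.1)
    (x : Γ(P, U.1)) : resₛₗ P h' (resₛₗ P h x) = resₛₗ P (h'.trans h) x := by
  change (P.presheaf.map _).hom ((P.presheaf.map _).hom x) = (P.presheaf.map _).hom x
  rw [← RingHom.comp_apply, ← CommRingCat.hom_comp, ← Functor.map_comp]
  rfl

/-- The structure sheaf `𝒪`. -/
noncomputable def structureModule (P : Scheme.{u}) : AffineModule P where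
  obj U := Γ(P, U.1)
  res h := resₛₗ P h
  res_self U x := resₛₗ_self P U x
  res_res h h' x := resₛₗ_resₛₗ P h h' x

/-- An ideal sheaf, as a module. -/
noncomputable def idealModule {P : Scheme.{u}} (J : P.IdealSheafData) : AffineModule P where
  obj U := J.ideal U
  res {_ _} h := (resₛₗ P h).restrict fun _ hx ↦ J.ideal_le_comap_ideal h hx
  res_self U x := Subtype.ext (resₛₗ_self P U x.1)
  res_res h h' x := Subtype.ext (resₛₗ_resₛₗ P h h' x.1)

/-- The module `I / (I² + J)`. If `J ⊆ I` are the ideal sheaves of closed subschemes `X ⊆ D`, this is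
the conormal sheaf of `X` in `D`. -/
noncomputable def conormalModule {P : Scheme.{u}} (I J : P.IdealSheafData) : AffineModule P where
  obj U := I.ideal U ⧸ Submodule.comap (Submodule.subtype (I.ideal U)) (I.ideal U ^ 2 ⊔ J.ideal U)
  res {U V} h := Submodule.mapQ _ _
    ((resₛₗ P h).restrict fun _ hx ↦ I.ideal_le_comap_ideal h hx) (by
      intro x hx
      have h1 : I.ideal U ^ 2 ⊔ J.ideal U ≤
          (I.ideal V ^ 2 ⊔ J.ideal V).comap (P.presheaf.map (homOfLE h).op).hom := by
        have e1 : (I.ideal U).map (P.presheaf.map (homOfLE h).op).hom = I.ideal V := I.map_ideal h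
        have e2 : (J.ideal U).map (P.presheaf.map (homOfLE h).op).hom = J.ideal V := J.map_ideal h
        rw [← Ideal.map_le_iff_le_comap, Ideal.map_sup, Ideal.map_pow, e1, e2]
      exact h1 hx)
  res_self U x := by
    obtain ⟨x, rfl⟩ := Submodule.Quotient.mk_surjective _ x
    exact congrArg _ (Subtype.ext (resₛₗ_self P U x.1))
  res_res h h' x := by
    obtain ⟨x, rfl⟩ := Submodule.Quotient.mk_surjective _ x
    exact congrArg _ (Subtype.ext (resₛₗ_resₛₗ P h h' x.1))

/-- For a closed immersion `f : X ⟶ P`, the module `C` (killed by the ideal of `X`) is the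
pushforward of a locally free `𝒪_X`-module of finite rank. -/
def AffineModule.IsLocallyFree {X P : Scheme.{u}} (f : X ⟶ P) (C : AffineModule P) : Prop :=
  ∀ x : X, ∃ U : P.affineOpens, f x ∈ U.1 ∧
    ∃ n : ℕ, Nonempty (C.obj U ≃ₗ[Γ(P, U.1)] (Fin n → Γ(P, U.1) ⧸ f.ker.ideal U))

/-- The ring `Γ(T, 𝒪_T)`, regarded as an algebra over `Γ(U, 𝒪_P)`, for a morphism `q : T ⟶ P` that
factors through the affine open `U`. -/
def SectionsOver {P T : Scheme.{u}} (q : T ⟶ P) (U : P.affineOpens) (_h : ⊤ ≤ q ⁻¹ᵁ U.1) :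
    Type u := Γ(T, ⊤)

noncomputable instance {P T : Scheme.{u}} (q : T ⟶ P) (U : P.affineOpens) (h : ⊤ ≤ q ⁻¹ᵁ U.1) :
    CommRing (SectionsOver q U h) := inferInstanceAs (CommRing Γ(T, ⊤))

noncomputable instance {P T : Scheme.{u}} (q : T ⟶ P) (U : P.affineOpens) (h : ⊤ ≤ q ⁻¹ᵁ U.1) :
    Algebra Γ(P, U.1) (SectionsOver q U h) := (q.appLE U.1 ⊤ h).hom.toAlgebra

/-- Pullback of functions along `k : T' ⟶ T`, as a semilinear map. -/
noncomputable def SectionsOver.map {P T T' : Scheme.{u}} {q : T ⟶ P} {q' : T' ⟶ P} (k : T' ⟶ T)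
    (hk : k ≫ q = q') {U V : P.affineOpens} (hVU : V.1 ≤ U.1)
    (h : ⊤ ≤ q ⁻¹ᵁ U.1) (h' : ⊤ ≤ q' ⁻¹ᵁ V.1) :
    SectionsOver q U h →ₛₗ[(P.presheaf.map (homOfLE hVU).op).hom] SectionsOver q' V h' where
  toFun a := k.appTop.hom a
  map_add' a b := map_add k.appTop.hom a b
  map_smul' a b := by
    have e : (q.appLE U.1 ⊤ h) ≫ k.appTop =
        P.presheaf.map (homOfLE hVU).op ≫ q'.appLE V.1 ⊤ h' := by
      subst hk
      rw [Scheme.Hom.map_appLE, Scheme.Hom.appTop, ← Scheme.Hom.appLE_eq_app]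
      exact Scheme.Hom.appLE_comp_appLE ..
    exact (map_mul k.appTop.hom ((q.appLE U.1 ⊤ h).hom a) b).trans
      (congrArg (fun z ↦ z * k.appTop.hom b) (congrArg (fun z ↦ z.hom a) e))

open scoped TensorProduct in
/-- For `T` affine and `q : T ⟶ P` factoring through the affine open `U`, the group
`Hom (C(U), Γ(T, 𝒪_T) ⊗ L(U))`, i.e. the group of morphisms `q^* C ⟶ q^* L` of `𝒪_T`-modules.
If `q` factors through a closed subscheme `X` to which `C` restricts as a vector bundle `C_X`, this
is the group of `T`-points of the vector bundle `C_X^∨ ⊗ L_X` over `X`. -/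
abbrev HomPoints {P T : Scheme.{u}} (C L : AffineModule P) (q : T ⟶ P) (U : P.affineOpens)
    (h : ⊤ ≤ q ⁻¹ᵁ U.1) : Type u :=
  C.obj U →ₗ[Γ(P, U.1)] (SectionsOver q U h ⊗[Γ(P, U.1)] L.obj U)

/-- The homomorphism `δ'` (over `T'` and `V`) is the base change of `δ` (over `T` and `U`) along
`k : T' ⟶ T` and `V ⊆ U`. -/
def HomPoints.IsRestriction {P T T' : Scheme.{u}} {C L : AffineModule P} {q : T ⟶ P} {q' : T' ⟶ P}
    (k : T' ⟶ T) (hk : k ≫ q = q') {U V : P.affineOpens} (hVU : V.1 ≤ U.1)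
    {h : ⊤ ≤ q ⁻¹ᵁ U.1} {h' : ⊤ ≤ q' ⁻¹ᵁ V.1}
    (δ : HomPoints C L q U h) (δ' : HomPoints C L q' V h') : Prop :=
  ∀ x : C.obj U, δ' (C.res hVU x) =
    TensorProduct.map (SectionsOver.map k hk hVU h h') (L.res hVU) (δ x)

/-- The `T`-points of the `X`-scheme `p : V ⟶ X` over `t : T ⟶ X`. -/
abbrev LiftsOf {X V T : Scheme.{u}} (p : V ⟶ X) (t : T ⟶ X) : Type u := {v : T ⟶ V // v ≫ p = t}

/-- For a closed immersion `f : X ⟶ P` and modules `C`, `L`, where `C` restricts to a vector bundle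
`C_X` on `X`, the structure on `p : V ⟶ X` of a torsor under the vector bundle `C_X^∨ ⊗ L_X`:
an action of the vector bundle on `V` over `X` (given on points with values in affine `X`-schemes
`T` whose structure morphism factors through an affine open `U` of `P`, compatibly with base change),
which is simply transitive on points, such that `p` has sections locally on `X`. -/
structure HomTorsor {X P V : Scheme.{u}} (f : X ⟶ P) (C L : AffineModule P) (p : V ⟶ X) where
  /-- The action. -/
  act : ∀ {T : Scheme.{u}} [IsAffine T] (t : T ⟶ X) (U : P.affineOpens)
    (h : ⊤ ≤ (t ≫ f) ⁻¹ᵁ U.1), HomPoints C L (t ≫ f) U h → LiftsOf p t → LiftsOf p t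
  zero_act : ∀ {T : Scheme.{u}} [IsAffine T] (t : T ⟶ X) (U : P.affineOpens)
    (h : ⊤ ≤ (t ≫ f) ⁻¹ᵁ U.1) (v : LiftsOf p t), act t U h 0 v = v
  add_act : ∀ {T : Scheme.{u}} [IsAffine T] (t : T ⟶ X) (U : P.affineOpens)
    (h : ⊤ ≤ (t ≫ f) ⁻¹ᵁ U.1) (δ ε : HomPoints C L (t ≫ f) U h) (v : LiftsOf p t),
    act t U h (δ + ε) v = act t U h δ (act t U h ε v)
  existsUnique_act : ∀ {T : Scheme.{u}} [IsAffine T] (t : T ⟶ X) (U : P.affineOpens)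
    (h : ⊤ ≤ (t ≫ f) ⁻¹ᵁ U.1) (v v' : LiftsOf p t), ∃! δ, act t U h δ v = v'
  act_restrict : ∀ {T T' : Scheme.{u}} [IsAffine T] [IsAffine T'] (t : T ⟶ X) (k : T' ⟶ T)
    (U V : P.affineOpens) (hVU : V.1 ≤ U.1) (h : ⊤ ≤ (t ≫ f) ⁻¹ᵁ U.1)
    (h' : ⊤ ≤ ((k ≫ t) ≫ f) ⁻¹ᵁ V.1)
    (δ : HomPoints C L (t ≫ f) U h) (δ' : HomPoints C L ((k ≫ t) ≫ f) V h'),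
    δ.IsRestriction k (Category.assoc k t f).symm hVU δ' → ∀ v : LiftsOf p t,
      (act (k ≫ t) V h' δ' ⟨k ≫ v.1, by rw [Category.assoc, v.2]⟩).1 = k ≫ (act t U h δ v).1
  exists_section : ∀ x : X, ∃ U : X.Opens, x ∈ U ∧ ∃ s : U.toScheme ⟶ V, s ≫ p = U.ι

/-! ### Parameterized deformation spaces -/

/-- The input of the construction: smooth `B`-schemes `W` and `Y`, a flat `B`-scheme `Z` locally of
finite presentation with a closed immersion `i : Z ⟶ W` over `B`, a smooth surjective morphism
`ψ : X ⟶ Z`, and a closed immersion `f : X ⟶ Y ×_B W` such that `p₂ ∘ f = i ∘ ψ`. (The `B`-scheme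
structures of `Z` and `X` are the ones induced by `i` and `ψ`.) -/
structure DeformationDatum (B : Scheme.{u}) where
  W : Scheme.{u}
  Z : Scheme.{u}
  Y : Scheme.{u}
  X : Scheme.{u}
  w : W ⟶ B
  y : Y ⟶ B
  i : Z ⟶ W
  ψ : X ⟶ Z
  f : X ⟶ pullback y w
  smooth_w : Smooth w
  smooth_y : Smooth y
  isClosedImmersion_i : IsClosedImmersion i
  locallyOfFinitePresentation_Z : LocallyOfFinitePresentation (i ≫ w)
  flat_Z : Flat (i ≫ w)
  smooth_ψ : Smooth ψ
  surjective_ψ : Surjective ψ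
  isClosedImmersion_f : IsClosedImmersion f
  comm : f ≫ pullback.snd y w = ψ ≫ i

attribute [instance] DeformationDatum.smooth_w DeformationDatum.smooth_y
  DeformationDatum.isClosedImmersion_i DeformationDatum.locallyOfFinitePresentation_Z
  DeformationDatum.flat_Z DeformationDatum.smooth_ψ DeformationDatum.surjective_ψ
  DeformationDatum.isClosedImmersion_f

namespace DeformationDatum

variable {B : Scheme.{u}} (S : DeformationDatum B)

/-- The ideal sheaf `I` of `X` in `Y ×_B W`. -/
noncomputable def centerIdeal : (pullback S.y S.w).IdealSheafData := S.f.ker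

/-- The closed immersion `Y ×_B Z ⟶ Y ×_B W`. -/
noncomputable def divisorι : pullback S.y (S.i ≫ S.w) ⟶ pullback S.y S.w :=
  pullback.lift (pullback.fst _ _) (pullback.snd _ _ ≫ S.i)
    (by rw [pullback.condition, Category.assoc])

theorem divisorι_fst : S.divisorι ≫ pullback.fst S.y S.w = pullback.fst S.y (S.i ≫ S.w) :=
  pullback.lift_fst _ _ _

theorem divisorι_snd :
    S.divisorι ≫ pullback.snd S.y S.w = pullback.snd S.y (S.i ≫ S.w) ≫ S.i :=
  pullback.lift_snd _ _ _

/-- The ideal sheaf `J` of the divisor `D = Y ×_B Z` in `Y ×_B W`. -/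
noncomputable def divisorIdeal : (pullback S.y S.w).IdealSheafData := S.divisorι.ker

theorem isPullback_divisorι :
    IsPullback S.divisorι (pullback.snd S.y (S.i ≫ S.w)) (pullback.snd S.y S.w) S.i := by
  refine IsPullback.of_right (h₁₂ := pullback.fst S.y S.w) (v₁₃ := S.y) (h₂₂ := S.w) ?_ ?_
    (IsPullback.of_hasPullback S.y S.w)
  · rw [divisorι_fst]
    exact IsPullback.of_hasPullback S.y (S.i ≫ S.w)
  · exact S.divisorι_snd

theorem divisorIdeal_eq : S.divisorIdeal = S.i.ker.comap (pullback.snd S.y S.w) := by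
  rw [← Scheme.IdealSheafData.ker_fst_of_isClosedImmersion, divisorIdeal,
    ← S.isPullback_divisorι.isoPullback_hom_fst, Scheme.Hom.ker_comp_of_isIso]

/-- The closed immersion `X ⟶ Y ×_B Z` induced by `f`. -/
noncomputable def toDivisor : S.X ⟶ pullback S.y (S.i ≫ S.w) :=
  pullback.lift (S.f ≫ pullback.fst S.y S.w) S.ψ (by
    rw [Category.assoc, pullback.condition, ← Category.assoc, S.comm, Category.assoc])

theorem toDivisor_divisorι : S.toDivisor ≫ S.divisorι = S.f := by
  apply pullback.hom_ext
  · rw [Category.assoc, divisorι_fst, toDivisor, pullback.lift_fst]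
  · rw [Category.assoc, divisorι_snd, toDivisor, ← Category.assoc, pullback.lift_snd, S.comm]

theorem divisorIdeal_le : S.divisorIdeal ≤ S.centerIdeal := by
  rw [centerIdeal, ← S.toDivisor_divisorι]
  exact Scheme.Hom.le_ker_comp _ _

variable {S} in
theorem isEffectiveCartier_divisorIdeal (hZ : IsEffectiveCartier S.i.ker) :
    IsEffectiveCartier S.divisorIdeal := by
  rw [divisorIdeal_eq]
  exact hZ.comap _

/-- The parameterized deformation space, for `Z ⊂ W` an effective Cartier divisor: the affine blow-up
of `Y ×_B W` in `X` along the divisor `D = Y ×_B Z`. -/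
noncomputable def space (hZ : IsEffectiveCartier S.i.ker) : Scheme.{u} :=
  affineBlowup S.centerIdeal S.divisorIdeal S.divisorIdeal_le (isEffectiveCartier_divisorIdeal hZ)

/-- The blow-down morphism to `Y ×_B W`. -/
noncomputable def blowdown (hZ : IsEffectiveCartier S.i.ker) : S.space hZ ⟶ pullback S.y S.w :=
  affineBlowupMap S.centerIdeal S.divisorIdeal S.divisorIdeal_le
    (isEffectiveCartier_divisorIdeal hZ)

/-- The parameterized deformation `π`, i.e. the blow-down followed by the projection to `W`. -/
noncomputable def π (hZ : IsEffectiveCartier S.i.ker) : S.space hZ ⟶ S.W :=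
  S.blowdown hZ ≫ pullback.snd S.y S.w

/-- The conormal sheaf `I / (I² + J)` of the closed immersion `X ⟶ Y ×_B Z`. -/
noncomputable def conormal : AffineModule (pullback S.y S.w) :=
  conormalModule S.centerIdeal S.divisorIdeal

/-- The open complement `W ∖ Z`. -/
def offZ : S.W.Opens := ⟨(Set.range S.i)ᶜ, S.i.isClosedEmbedding.isClosed_range.isOpen_compl⟩

end DeformationDatum

/-- Morphisms of finite presentation: locally of finite presentation, quasi-compact and
quasi-separated. -/
def IsFinitelyPresented {X Y : Scheme.{u}} (f : X ⟶ Y) : Prop :=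
  LocallyOfFinitePresentation f ∧ QuasiCompact f ∧ QuasiSeparated f

end ParamDeformation

open ParamDeformation

/-!
The closed subscheme `X` of `Y ×_B W` lies in the divisor `D = Y ×_B Z`, and both `X` and `D` are
smooth over `Z`. Let `I` and `J` be their ideals, with local equation `g` of `Z`, so that `J = (g)`.
The whole proof rests on the fact that, near a point of `X`, the smooth `W`-scheme `Y ×_B W` has
coordinates `x, y` relative to `W` (functions whose differentials form a basis) with `I = (g, x)`:
`exists_adaptedCoordinates`. As `X` is smooth over `Z`, there is a derivation that extends the class
map of `I` to `I / (I ^ 2 + J)`, so that `dx` may be part of a basis of differentials for generators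
`x` of the conormal module. In particular, `X` is always regularly immersed in `D`, and the conormal
module is free on `x`.

The coordinates make `Y ×_B W` étale over the affine space with coordinates `X, Y` over `W`, so the
affine blow-up is locally the base change of the dilatation `C[X, Y] → C[T, Y]`, `X_i ↦ g T_i`, of
polynomial rings: the base change is flat over `C`, so that `g` is a nonzerodivisor in it and it
embeds into `A[1/g]`, where its image is the affine blow-up algebra
(`AdaptedCoordinates.smooth_and_exists_lift`). Hence the deformation is smooth over `W` along `Z`.
Off `Z`, the blow-down is an isomorphism and the deformation is a base change of `Y`; this gives
smoothness (`DeformationDatum.smooth_π`), and finite presentation because the blow-down is affine.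

On the affine blow-up, `I` and `J` generate the same ideal, so the fibre over `Z` is the fibre of
the blow-down over `X` (`DeformationDatum.isPullback_fiberMap`). Over an affine open, its points
over a point of `X` are the algebra maps from the affine blow-up algebra to an algebra `O` killed
by `I` (`evalHom_injective`, `evalHom_surjective`). The difference of two such maps `φ` and `φ'` is
the homomorphism `I / (I ^ 2 + J) → O ⊗ J`, `x ↦ (φ' - φ) (x / a) ⊗ a`, for a local generator `a`
of `J` (`IsDifference`). It is defined without a choice of `a`, by elements `j k` of `J` and `s k`
of `J⁻¹` with `∑ k, j k * s k = 1` (`BlowupPresentation`). Two points determine their difference,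
and a point and a difference determine the other point, since the affine blow-up algebra is
generated by the elements `x * s k`. That every homomorphism is a difference may be checked
locally, where it follows from the freedom to prescribe the values of the `T_i`
(`exists_isDifference_evalHom`). This is the torsor structure `homTorsorOfIsPullback`. A global
equation of `Z` trivializes `J`, and the torsor is transported along this isomorphism by
`HomTorsor.congr`. -/

/-! ### Coordinates adapted to a smooth subscheme of a divisor -/

namespace ParamDeformation

section Coordinates

open KaehlerDifferential
open scoped TensorProduct

/-- A smooth algebra is étale over the polynomial ring on elements whose differentials form a basis
of the module of differentials. -/
theorem etale_aeval_of_basis {C A : Type u} [CommRing C] [CommRing A] [Algebra C A]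
    [Algebra.Smooth C A] {n : Type} [Finite n] (z : n → A) (b : Module.Basis n A Ω[A⁄C])
    (hb : ∀ i, b i = D C A (z i)) :
    letI := (MvPolynomial.aeval (R := C) z).toRingHom.toAlgebra
    Algebra.Etale (MvPolynomial n C) A := by
  let := (MvPolynomial.aeval (R := C) z).toRingHom.toAlgebra
  have : IsScalarTower C (MvPolynomial n C) A := .of_algebraMap_eq fun x ↦ by
    simp [RingHom.algebraMap_toAlgebra]
  have hbij : Function.Bijective (mapBaseChange C (MvPolynomial n C) A) := by
    let b' := (mvPolynomialBasis C n).baseChange A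
    have : (mapBaseChange C (MvPolynomial n C) A) = (b'.equiv b (Equiv.refl _)).toLinearMap := by
      apply b'.ext
      intro i
      trans b i
      · simp [b', hb, RingHom.algebraMap_toAlgebra]
      · exact (b'.equiv_apply i b (Equiv.refl _)).symm
    rw [this]
    exact (b'.equiv b _).bijective
  have h1 : Subsingleton (Algebra.H1Cotangent (MvPolynomial n C) A) := by
    refine ⟨fun a b ↦ ?_⟩
    suffices h : ∀ x : Algebra.H1Cotangent (MvPolynomial n C) A, x = 0 by rw [h a, h b]
    intro x
    have hx : Algebra.H1Cotangent.δ C (MvPolynomial n C) A x = 0 := by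
      apply hbij.1
      rw [map_zero]
      exact (Algebra.H1Cotangent.exact_δ_mapBaseChange C (MvPolynomial n C) A).apply_apply_eq_zero x
    obtain ⟨y, rfl⟩ := (Algebra.H1Cotangent.exact_map_δ C (MvPolynomial n C) A x).mp hx
    rw [Subsingleton.elim y 0, map_zero]
  have h2 : Subsingleton (Ω[A⁄MvPolynomial n C]) := by
    refine ⟨fun a b ↦ ?_⟩
    suffices h : ∀ x : Ω[A⁄MvPolynomial n C], x = 0 by rw [h a, h b]
    intro x
    obtain ⟨y, rfl⟩ := map_surjective C (MvPolynomial n C) A x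
    obtain ⟨t, rfl⟩ := hbij.2 y
    exact (exact_mapBaseChange_map C (MvPolynomial n C) A).apply_apply_eq_zero t
  have : Algebra.FinitePresentation (MvPolynomial n C) A :=
    .of_restrict_scalars_finitePresentation C _ _
  exact { formallyEtale := ⟨h2, h1⟩ }

/-- If `A → E` is surjective with kernel `I`, where `E` is formally smooth over the quotient `C'` of
`C`, and `J` is the ideal of `A` generated by the kernel of `C → C'`, then the class map
`I → A / (I ^ 2 + J)` extends to a `C`-derivation of `A`: it is `a ↦ a - σ a` for a ring section `σ`
of the square-zero extension `A / (I ^ 2 + J) → E`. -/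
theorem exists_derivation_of_formallySmooth {C A C' E : Type u} [CommRing C] [CommRing A]
    [CommRing C'] [CommRing E] [Algebra C A] [Algebra C C'] [Algebra A E] [Algebra C' E]
    [Algebra C E] [IsScalarTower C A E] [IsScalarTower C C' E] [Algebra.FormallySmooth C' E]
    (hC : Function.Surjective (algebraMap C C')) (hA : Function.Surjective (algebraMap A E))
    (I J : Ideal A) (hI : RingHom.ker (algebraMap A E) = I)
    (hJ : J = (RingHom.ker (algebraMap C C')).map (algebraMap C A)) :
    ∃ Δ : Derivation C A (A ⧸ (I ^ 2 ⊔ J)),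
      (∀ a, Δ a ∈ Submodule.map (Algebra.linearMap A (A ⧸ (I ^ 2 ⊔ J))) I) ∧
      ∀ a ∈ I, Δ a = Ideal.Quotient.mk _ a := by
  have hJI : J ≤ I := by
    rw [hJ, ← hI, Ideal.map_le_iff_le_comap]
    intro c hc
    rw [Ideal.mem_comap, RingHom.mem_ker, ← IsScalarTower.algebraMap_apply,
      IsScalarTower.algebraMap_apply C C' E, (RingHom.mem_ker).mp hc, map_zero]
  let B := A ⧸ (I ^ 2 ⊔ J)
  let f : C' →+* B := RingHom.liftOfSurjective (algebraMap C C') hC ⟨algebraMap C B, by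
    intro c hc
    rw [RingHom.mem_ker, IsScalarTower.algebraMap_apply C A B]
    exact Ideal.Quotient.eq_zero_iff_mem.mpr (Ideal.mem_sup_right
      (hJ ▸ Ideal.mem_map_of_mem _ hc))⟩
  have hf (c : C) : f (algebraMap C C' c) = algebraMap C B c :=
    RingHom.liftOfRightInverse_comp_apply _ _ _ _ _
  let g : B →+* E := Ideal.Quotient.lift _ (algebraMap A E) (by
    intro a ha
    have : I ^ 2 ⊔ J ≤ I := sup_le (Ideal.pow_le_self two_ne_zero) hJI
    have := this ha
    rwa [← hI] at this)
  let := f.toAlgebra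
  let gA : B →ₐ[C'] E := { g with
    commutes' := by
      intro c'
      obtain ⟨c, rfl⟩ := hC c'
      change g (f _) = _
      rw [hf, IsScalarTower.algebraMap_apply C A B, ← IsScalarTower.algebraMap_apply C C' E,
        IsScalarTower.algebraMap_apply C A E]
      rfl }
  have hg : Function.Surjective gA := fun e ↦ by
    obtain ⟨a, rfl⟩ := hA e
    exact ⟨Ideal.Quotient.mk _ a, rfl⟩
  have hker (b : B) : gA b = 0 ↔ b ∈ I.map (Ideal.Quotient.mk (I ^ 2 ⊔ J)) := by
    obtain ⟨a, rfl⟩ := Ideal.Quotient.mk_surjective b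
    rw [Ideal.mem_quotient_iff_mem (sup_le (Ideal.pow_le_self two_ne_zero) hJI)]
    exact (RingHom.mem_ker (f := algebraMap A E)).symm.trans (by rw [hI])
  have hsq : ∀ a b : B, gA a = 0 → gA b = 0 → a * b = 0 := by
    intro a b ha hb
    have h := Ideal.mul_mem_mul ((hker a).mp ha) ((hker b).mp hb)
    rw [← Ideal.map_mul, ← pow_two] at h
    have : (I ^ 2).map (Ideal.Quotient.mk (I ^ 2 ⊔ J)) = ⊥ := by
      rw [Ideal.map_eq_bot_iff_le_ker, Ideal.mk_ker]
      exact le_sup_left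
    rw [this] at h
    exact h
  have hnil : IsNilpotent (RingHom.ker gA) := by
    refine ⟨2, ?_⟩
    refine (pow_two (RingHom.ker gA)).trans (eq_bot_iff.mpr ?_)
    rw [Ideal.mul_le]
    exact fun a ha b hb ↦ hsq a b ha hb
  let σ : E →ₐ[C'] B := Algebra.FormallySmooth.liftOfSurjective (AlgHom.id C' E) gA hg hnil
  have hσ (e : E) : gA (σ e) = e :=
    Algebra.FormallySmooth.liftOfSurjective_apply (AlgHom.id C' E) gA hg hnil e
  have hσC (c : C) : σ (algebraMap C E c) = algebraMap C B c := by
    rw [IsScalarTower.algebraMap_apply C C' E, σ.commutes, ← hf]; rfl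
  have hz (a : A) : gA (Ideal.Quotient.mk _ a - σ (algebraMap A E a)) = 0 := by
    rw [map_sub, hσ]; exact sub_self _
  let δ : A →ₗ[C] B :=
    { toFun a := Ideal.Quotient.mk _ a - σ (algebraMap A E a)
      map_add' a b := by simp only [map_add]; ring
      map_smul' c a := by
        rw [Algebra.smul_def, map_mul, map_mul, map_mul, ← IsScalarTower.algebraMap_apply C A E,
          hσC, RingHom.id_apply, Algebra.smul_def, mul_sub]
        rfl }
  have hδ (a : A) : δ a = Ideal.Quotient.mk _ a - σ (algebraMap A E a) := rfl
  refine ⟨Derivation.mk' δ fun a b ↦ ?_, fun a ↦ ?_, fun a ha ↦ ?_⟩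
  · have := hsq _ _ (hz a) (hz b)
    rw [Algebra.smul_def, Algebra.smul_def, hδ, hδ, hδ, map_mul, map_mul, map_mul]
    change _ = Ideal.Quotient.mk _ a * _ + Ideal.Quotient.mk _ b * _
    linear_combination -this
  · have := (hker _).mp (hz a)
    obtain ⟨x, hx, e⟩ := (Ideal.mem_map_iff_of_surjective _ Ideal.Quotient.mk_surjective).mp this
    exact ⟨x, hx, e⟩
  · change Ideal.Quotient.mk _ a - σ (algebraMap A E a) = _
    rw [← hI] at ha
    rw [(RingHom.mem_ker).mp ha, map_zero, sub_zero]

/-- The localisation of the linear map defined by a family of vectors sends the basis vectors to the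
images of these vectors. -/
theorem mapExtendScalars_linearCombination_single {A A' N N' n : Type*} [CommRing A] [CommRing A']
    [Algebra A A'] (M : Submonoid A) [IsLocalization M A'] [AddCommGroup N] [AddCommGroup N']
    [Module A N] [Module A N'] [Module A' N'] [IsScalarTower A A' N'] (f : N →ₗ[A] N')
    [IsLocalizedModule M f] (v : n → N) (i : n) :
    IsLocalizedModule.mapExtendScalars M
      (Finsupp.mapRange.linearMap (Algebra.linearMap A A') : (n →₀ A) →ₗ[A] (n →₀ A')) f A'
      (Finsupp.linearCombination A v) (Finsupp.single i 1) = f (v i) := by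
  have h : Finsupp.single i (1 : A') =
      (Finsupp.mapRange.linearMap (Algebra.linearMap A A') : (n →₀ A) →ₗ[A] (n →₀ A'))
        (Finsupp.single i 1) := by simp
  rw [h]
  refine (IsLocalizedModule.map_apply M _ f _ _).trans ?_
  simp

/-- Clearing denominators: if finitely many elements of `A` lie in `Q`, up to factors outside `p`,
then a single factor outside `p` suffices for the ideal that they generate. -/
theorem exists_notMem_mul_mem {A : Type u} [CommRing A] (p : Ideal A) [p.IsPrime] (I Q : Ideal A)
    (T : Finset A) (hT : Ideal.span (T : Set A) = I) (h : ∀ a ∈ T, ∃ s ∉ p, s * a ∈ Q) :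
    ∃ r ∉ p, ∀ a ∈ I, r * a ∈ Q := by
  classical
  obtain ⟨r, hr, h⟩ : ∃ r ∉ p, ∀ a ∈ T, r * a ∈ Q := by
    clear hT
    induction T using Finset.induction_on with
    | empty => exact ⟨1, p.primeCompl.one_mem, by simp⟩
    | insert b T _ ih =>
      obtain ⟨r, hr, h1⟩ := ih fun a ha ↦ h a (Finset.mem_insert_of_mem ha)
      obtain ⟨s, hs, h2⟩ := h b (Finset.mem_insert_self _ _)
      refine ⟨r * s, p.primeCompl.mul_mem hr hs, fun a ha ↦ ?_⟩
      rcases Finset.mem_insert.mp ha with rfl | ha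
      · rw [mul_assoc]; exact Q.mul_mem_left _ h2
      · rw [mul_right_comm]; exact Q.mul_mem_right _ (h1 a ha)
  refine ⟨r, hr, fun a ha ↦ ?_⟩
  rw [← hT] at ha
  induction ha using Submodule.span_induction with
  | mem x hx => exact h x hx
  | zero => simp
  | add x y _ _ hx hy => rw [mul_add]; exact add_mem hx hy
  | smul c x _ hx => rw [smul_eq_mul, mul_left_comm]; exact Q.mul_mem_left _ hx

/-- A derivation `Δ` of `A` with values in the image of `I` in `A / L`, and equal to the class map
on `I`, detects generators: if the differentials of elements `u` of `I` span the differentials of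
elements of `I` in the fibre at `p`, then `u` generates `I` modulo `L` at `p`, by Nakayama's lemma.
-/
theorem exists_mul_mem_span_of_differentials {C A : Type u} [CommRing C] [CommRing A]
    [Algebra C A] (I L : Ideal A) (hI : I.FG) (p : Ideal A) [p.IsPrime]
    (Δ : Derivation C A (A ⧸ L))
    (hΔ : ∀ a, Δ a ∈ Submodule.map (Algebra.linearMap A (A ⧸ L)) I)
    (hΔI : ∀ a ∈ I, Δ a = Ideal.Quotient.mk L a) (u : Set A) (hu : u ⊆ I)
    (hspan : ∀ a ∈ I, (1 ⊗ₜ D C (Localization.AtPrime p) (algebraMap A _ a) :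
      IsLocalRing.ResidueField (Localization.AtPrime p) ⊗[Localization.AtPrime p]
        Ω[Localization.AtPrime p⁄C]) ∈
      Submodule.span (IsLocalRing.ResidueField (Localization.AtPrime p))
        ((fun a ↦ 1 ⊗ₜ D C (Localization.AtPrime p) (algebraMap A _ a)) '' u)) :
    ∃ r ∉ p, ∀ a ∈ I, r * a ∈ Ideal.span u ⊔ L := by
  classical
  let Ap := Localization.AtPrime p
  let k := IsLocalRing.ResidueField Ap
  obtain ⟨T, hT⟩ := hI
  let f : (A ⧸ L) →ₗ[A] LocalizedModule p.primeCompl (A ⧸ L) :=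
    LocalizedModule.mkLinearMap p.primeCompl (A ⧸ L)
  -- `l` is the linear map on differentials that corresponds to `Δ`, localised at `p`
  let l : Ω[Ap⁄C] →ₗ[Ap] LocalizedModule p.primeCompl (A ⧸ L) :=
    IsLocalizedModule.mapExtendScalars p.primeCompl (map C C A Ap) f Ap
      Δ.liftKaehlerDifferential
  have hl (a : A) : l (D C Ap (algebraMap A Ap a)) = f (Δ a) := by
    rw [← Δ.liftKaehlerDifferential_comp_D, ← map_D C C]
    exact IsLocalizedModule.map_apply p.primeCompl (map C C A Ap) f _ _
  let K := Submodule.span Ap ((fun a ↦ f (Ideal.Quotient.mk L a)) '' T)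
  let N := Submodule.span Ap ((fun a ↦ f (Ideal.Quotient.mk L a)) '' u)
  have hK (a : A) (ha : a ∈ I) : f (Ideal.Quotient.mk L a) ∈ K := by
    rw [← hT] at ha
    induction ha using Submodule.span_induction with
    | mem x hx => exact Submodule.subset_span ⟨x, hx, rfl⟩
    | zero => simp
    | add x y _ _ hx hy => rw [map_add, map_add]; exact add_mem hx hy
    | smul c x _ hx =>
      have : f (Ideal.Quotient.mk L (c • x)) = algebraMap A Ap c • f (Ideal.Quotient.mk L x) := by
        rw [algebraMap_smul, ← map_smul]; rfl
      rw [this]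
      exact K.smul_mem _ hx
  have hlK : LinearMap.range l ≤ K := by
    rw [LinearMap.range_eq_map, ← span_range_map_derivation_of_isLocalization C A Ap p.primeCompl,
      Submodule.map_span, Submodule.span_le]
    rintro _ ⟨_, ⟨a, rfl⟩, rfl⟩
    obtain ⟨b, hb, e⟩ := hΔ a
    rw [Function.comp_apply, map_D, SetLike.mem_coe, hl, ← e]
    exact hK b hb
  have hlift : ∀ z ∈ Submodule.span k ((fun a ↦ (1 ⊗ₜ D C Ap (algebraMap A _ a) :
      k ⊗[Ap] Ω[Ap⁄C])) '' u), ∃ w : Ω[Ap⁄C], z = 1 ⊗ₜ w ∧ l w ∈ N := by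
    intro z hz
    induction hz using Submodule.span_induction with
    | mem z hz =>
      obtain ⟨a, ha, rfl⟩ := hz
      exact ⟨_, rfl, by rw [hl, hΔI a (hu ha)]; exact Submodule.subset_span ⟨a, ha, rfl⟩⟩
    | zero => exact ⟨0, by simp, by simp⟩
    | add x y _ _ hx hy =>
      obtain ⟨a, rfl, ha⟩ := hx
      obtain ⟨b, rfl, hb⟩ := hy
      exact ⟨a + b, by rw [TensorProduct.tmul_add], by rw [map_add]; exact add_mem ha hb⟩
    | smul c x _ hx =>
      obtain ⟨a, rfl, ha⟩ := hx
      obtain ⟨c, rfl⟩ := IsLocalRing.residue_surjective c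
      refine ⟨c • a, ?_, by rw [map_smul]; exact N.smul_mem _ ha⟩
      rw [TensorProduct.tmul_smul, ← algebraMap_smul k c]
      rfl
  -- by Nakayama's lemma: `df` is a combination of the `du` modulo the maximal ideal, and `l` maps
  -- all differentials into `K`
  have hKN : K ≤ N := by
    refine Submodule.le_of_le_smul_of_le_jacobson_bot (I := IsLocalRing.maximalIdeal Ap)
      (Submodule.fg_span (T.finite_toSet.image _)) (IsLocalRing.maximalIdeal_le_jacobson _) ?_
    refine Submodule.span_le.mpr ?_
    rintro _ ⟨a, ha, rfl⟩
    have haI : a ∈ I := hT ▸ Ideal.subset_span ha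
    obtain ⟨w, hw, hwN⟩ := hlift _ (hspan a haI)
    have h0 : D C Ap (algebraMap A Ap a) - w ∈
        IsLocalRing.maximalIdeal Ap • (⊤ : Submodule Ap _) := by
      rw [← LinearMap.ker_tensorProductMk, LinearMap.mem_ker, map_sub, sub_eq_zero]
      exact hw
    have h1 : l (D C Ap (algebraMap A Ap a) - w) ∈ IsLocalRing.maximalIdeal Ap • K := by
      have := Submodule.mem_map_of_mem (f := l) h0
      rw [Submodule.map_smul''] at this
      exact Submodule.smul_mono le_rfl (by rw [← LinearMap.range_eq_map]; exact hlK) this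
    have h2 : f (Ideal.Quotient.mk L a) = l w + l (D C Ap (algebraMap A Ap a) - w) := by
      rw [map_sub, hl, hΔI a haI]; abel
    change f (Ideal.Quotient.mk L a) ∈ _
    rw [h2]
    exact Submodule.add_mem_sup hwN h1
  refine exists_notMem_mul_mem p I _ T hT fun a ha ↦ ?_
  have h1 : f (Ideal.Quotient.mk L a) ∈ N := hKN (Submodule.subset_span ⟨a, ha, rfl⟩)
  have h2 : N = Submodule.localized' Ap p.primeCompl f
      (Submodule.span A (Ideal.Quotient.mk L '' u)) := by
    rw [Submodule.localized'_span, ← Set.image_comp]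
    rfl
  rw [h2, Submodule.mem_localized'] at h1
  obtain ⟨m, hm, s, e⟩ := h1
  rw [IsLocalizedModule.mk'_eq_iff] at e
  replace e : f m = f ((s : A) • Ideal.Quotient.mk L a) := by rw [map_smul]; exact e
  obtain ⟨t, ht⟩ := (IsLocalizedModule.eq_iff_exists p.primeCompl f).mp e
  refine ⟨t * s, p.primeCompl.mul_mem t.2 s.2, ?_⟩
  have h3 : Ideal.Quotient.mk L (t * s * a) ∈ (Ideal.span u).map (Ideal.Quotient.mk L) := by
    have : Ideal.Quotient.mk L (t * s * a) = (t : A) • m := by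
      rw [mul_assoc, map_mul, map_mul]
      exact ht.symm
    rw [this, Ideal.map_span]
    have hm' := Submodule.smul_mem _ (t : A) hm
    rw [← Submodule.restrictScalars_mem A]
    exact Submodule.span_le_restrictScalars A _ _ hm'
  rw [← Ideal.mem_quotient_iff_mem_sup]
  exact h3

/-- Choose elements `x` of the ideal `I` whose differentials form a basis of the span of the
differentials of elements of `I` in the fibre of `Ω[A⁄C]` at `p`, and extend them by further
elements `y` of `A` to a basis of the fibre. Then the differentials of `x` and `y` form a basis of
`Ω[A⁄C]` after inverting an element outside `p`, because this module is flat and finitely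
presented. If the class map of `I` modulo `L` extends to a derivation, then `x` generates `I`
modulo `L` near `p`. -/
theorem exists_bijective_linearCombination_differentials {C A : Type u} [CommRing C] [CommRing A]
    [Algebra C A] [Algebra.Smooth C A] (I L : Ideal A) (hI : I.FG) (p : Ideal A) [p.IsPrime]
    (Δ : Derivation C A (A ⧸ L))
    (hΔ : ∀ a, Δ a ∈ Submodule.map (Algebra.linearMap A (A ⧸ L)) I)
    (hΔI : ∀ a ∈ I, Δ a = Ideal.Quotient.mk L a) :
    ∃ (c d : ℕ) (x : Fin c → A) (y : Fin d → A), (∀ i, x i ∈ I) ∧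
      (∃ r ∉ p, ∀ a ∈ I, r * a ∈ Ideal.span (Set.range x) ⊔ L) ∧
      ∃ r ∉ p, ∀ t, r ∣ t → Function.Bijective (LocalizedModule.map (.powers t)
        (Finsupp.linearCombination A (fun i ↦ D C A (Sum.elim x y i)))) := by
  classical
  let Ap := Localization.AtPrime p
  let k := IsLocalRing.ResidueField Ap
  let v : A → TensorProduct Ap k (Ω[Ap⁄C]) := fun a ↦ 1 ⊗ₜ D C Ap (algebraMap A Ap a)
  have hv : Submodule.span k (Set.range v) = ⊤ := by
    rw [eq_top_iff]
    rintro z -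
    obtain ⟨w, rfl⟩ := TensorProduct.mk_surjective Ap (Ω[Ap⁄C]) k IsLocalRing.residue_surjective z
    have hw : w ∈ (⊤ : Submodule Ap (Ω[Ap⁄C])) := trivial
    rw [← span_range_map_derivation_of_isLocalization C A Ap p.primeCompl] at hw
    induction hw using Submodule.span_induction with
    | mem w hw =>
      obtain ⟨a, rfl⟩ := hw
      exact Submodule.subset_span ⟨a, by simp [v]⟩
    | zero => simp
    | add x y _ _ hx hy => rw [map_add]; exact add_mem hx hy
    | smul c x _ hx =>
      rw [map_smul, ← algebraMap_smul k c]
      exact Submodule.smul_mem _ _ hx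
  obtain ⟨u₁, hu₁I, -, hspan₁, hli₁⟩ := exists_linearIndepOn_extension (K := k) (v := v)
    (linearIndepOn_empty k v) (Set.empty_subset (I : Set A))
  obtain ⟨u₂, -, hu₁₂, hspan₂, hli₂⟩ := exists_linearIndepOn_extension (K := k) (v := v)
    hli₁ (Set.subset_univ _)
  have hfin : Finite u₂ := hli₂.finite
  have hfin₁ : Finite u₁ := Finite.Set.subset u₂ hu₁₂
  have hfin₂ : Finite (u₂ \ u₁ : Set A) := Finite.Set.subset u₂ Set.sdiff_subset
  let e₁ := (Finite.equivFin u₁).symm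
  let e₂ := (Finite.equivFin (u₂ \ u₁ : Set A)).symm
  let e : Fin (Nat.card u₁) ⊕ Fin (Nat.card (u₂ \ u₁ : Set A)) ≃ u₂ :=
    (Equiv.sumCongr e₁ e₂).trans (Equiv.Set.sumDiffSubset hu₁₂)
  let x : Fin (Nat.card u₁) → A := fun i ↦ e₁ i
  let y : Fin (Nat.card (u₂ \ u₁ : Set A)) → A := fun i ↦ e₂ i
  have hxy (i) : Sum.elim x y i = e i := by
    rcases i with i | i <;> rfl
  refine ⟨_, _, x, y, fun i ↦ hu₁I (e₁ i).2, ?_, ?_⟩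
  · have : Set.range x = u₁ := by
      change Set.range ((↑) ∘ e₁) = u₁
      rw [e₁.surjective.range_comp, Subtype.range_coe]
    rw [this]
    exact exists_mul_mem_span_of_differentials I L hI p Δ hΔ hΔI u₁ hu₁I
      fun a ha ↦ hspan₁ ⟨a, ha, rfl⟩
  · let z : Fin (Nat.card u₁) ⊕ Fin (Nat.card (u₂ \ u₁ : Set A)) → A := Sum.elim x y
    have hbij : Function.Bijective (Finsupp.linearCombination k
        (TensorProduct.mk Ap k (Ω[Ap⁄C]) 1 ∘ fun i ↦ D C Ap (algebraMap A Ap (z i)))) := by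
      have : (TensorProduct.mk Ap k (Ω[Ap⁄C]) 1 ∘ fun i ↦ D C Ap (algebraMap A Ap (z i))) =
          (fun i : u₂ ↦ v i) ∘ e := by
        funext i
        exact congrArg v (hxy i)
      rw [this]
      refine ⟨hli₂.linearIndependent.comp _ e.injective, ?_⟩
      rw [← LinearMap.range_eq_top, Finsupp.range_linearCombination, e.surjective.range_comp,
        eq_top_iff, ← hv, Submodule.span_le]
      rintro _ ⟨a, rfl⟩
      have := hspan₂ ⟨a, trivial, rfl⟩
      rwa [Set.image_eq_range] at this
    have hbij' := Module.IsLocalRing.linearCombination_bijective_of_flat _ hbij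
    let e : (_ →₀ A) →ₗ[A] Ω[A⁄C] := Finsupp.linearCombination A fun i ↦ D C A (z i)
    let l₁ : (Fin (Nat.card u₁) ⊕ Fin (Nat.card (u₂ \ u₁ : Set A)) →₀ A) →ₗ[A] (_ →₀ Ap) :=
      Finsupp.mapRange.linearMap (Algebra.linearMap A Ap)
    let l₂ : Ω[A⁄C] →ₗ[A] Ω[Ap⁄C] := map C C A Ap
    let eₚ : (_ →₀ Ap) →ₗ[Ap] Ω[Ap⁄C] := IsLocalizedModule.mapExtendScalars p.primeCompl l₁ l₂ Ap e
    have : eₚ = Finsupp.linearCombination Ap fun i ↦ D C Ap (algebraMap A Ap (z i)) := by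
      refine Finsupp.lhom_ext' fun i ↦ LinearMap.ext_ring ?_
      refine (mapExtendScalars_linearCombination_single p.primeCompl l₂ _ i).trans ?_
      have h : Finsupp.linearCombination Ap (fun i ↦ D C Ap (algebraMap A Ap (z i)))
          (Finsupp.single i 1) = D C Ap (algebraMap A Ap (z i)) := by
        rw [Finsupp.linearCombination_single, one_smul]
      exact (map_D C C A Ap (z i)).trans h.symm
    rw [← this] at hbij'
    exact exists_bijective_map_powers p.primeCompl l₁ l₂ e hbij'

/-- Coordinates of a smooth `C`-algebra `A` adapted to an ideal `I` containing `g : C`: the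
differentials of `x` and `y` form a basis of the module of differentials, and `I` is generated by
`g` and `x`. -/
structure AdaptedCoordinates (C A : Type u) [CommRing C] [CommRing A] [Algebra C A] (I : Ideal A)
    (g : C) where
  /-- The number of coordinates in `I`. -/
  c : ℕ
  /-- The number of the other coordinates. -/
  d : ℕ
  /-- The coordinates in `I`. -/
  x : Fin c → A
  /-- The other coordinates. -/
  y : Fin d → A
  /-- The basis of differentials. -/
  basis : Module.Basis (Fin c ⊕ Fin d) A Ω[A⁄C]
  basis_apply : ∀ i, basis i = D C A (Sum.elim x y i)
  span_eq : I = Ideal.span {algebraMap C A g} ⊔ Ideal.span (Set.range x)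

/-- If `A` is smooth over `C` and the quotient `E = A / I` is smooth over `C' = C / g`, then adapted
coordinates exist locally at the points of the closed subscheme. -/
theorem exists_adaptedCoordinates {C A C' E : Type u} [CommRing C] [CommRing A]
    [CommRing C'] [CommRing E] [Algebra C A] [Algebra C C'] [Algebra A E] [Algebra C' E]
    [Algebra C E] [IsScalarTower C A E] [IsScalarTower C C' E] [Algebra.Smooth C A]
    [Algebra.Smooth C' E]
    (hC : Function.Surjective (algebraMap C C')) (hA : Function.Surjective (algebraMap A E))
    (I : Ideal A) (hI : RingHom.ker (algebraMap A E) = I) (g : C)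
    (hg : RingHom.ker (algebraMap C C') = Ideal.span {g}) (p : Ideal A) [p.IsPrime] (hIp : I ≤ p) :
    ∃ r ∉ p, ∀ (Ar : Type u) [CommRing Ar] [Algebra A Ar] [Algebra C Ar] [IsScalarTower C A Ar]
      [IsLocalization.Away r Ar],
      Nonempty (AdaptedCoordinates C Ar (I.map (algebraMap A Ar)) g) := by
  let J : Ideal A := Ideal.span {algebraMap C A g}
  have hJ : J = (RingHom.ker (algebraMap C C')).map (algebraMap C A) := by
    rw [hg, Ideal.map_span, Set.image_singleton]
  have hgI : algebraMap C A g ∈ I := by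
    have : g ∈ RingHom.ker (algebraMap C C') := hg ▸ Ideal.mem_span_singleton_self g
    rw [← hI, RingHom.mem_ker, ← IsScalarTower.algebraMap_apply,
      IsScalarTower.algebraMap_apply C C' E, (RingHom.mem_ker).mp this, map_zero]
  have hC'fp : Algebra.FinitePresentation C C' :=
    Algebra.FinitePresentation.of_surjective (f := Algebra.ofId C C') hC
      ⟨{g}, by simpa using hg.symm⟩
  have hEfp : Algebra.FinitePresentation C E := Algebra.FinitePresentation.trans C C' E
  have hIfg : I.FG := by
    have := Algebra.FinitePresentation.ker_fG_of_surjective (IsScalarTower.toAlgHom C A E) hA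
    rw [← hI]
    exact this
  obtain ⟨Δ, hΔ, hΔI⟩ := exists_derivation_of_formallySmooth hC hA I J hI hJ
  obtain ⟨c, d, x, y, hx, ⟨r₁, hr₁, hspan⟩, ⟨r₂, hr₂, hbij⟩⟩ :=
    exists_bijective_linearCombination_differentials I (I ^ 2 ⊔ J) hIfg p Δ hΔ hΔI
  -- by Nakayama's lemma, `I` is generated near `p` by `x` and `J`, as it is so modulo `I ^ 2 ≤ p I`
  obtain ⟨r₃, hr₃, hspan'⟩ : ∃ r ∉ p, ∀ a ∈ I, r * a ∈ J ⊔ Ideal.span (Set.range x) := by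
    let Ap := Localization.AtPrime p
    have hle : I.map (algebraMap A Ap) ≤ (J ⊔ Ideal.span (Set.range x)).map (algebraMap A Ap) := by
      refine Submodule.le_of_le_smul_of_le_jacobson_bot (I := IsLocalRing.maximalIdeal Ap)
        (Ideal.FG.map hIfg _) (IsLocalRing.maximalIdeal_le_jacobson _) ?_
      rw [Ideal.map_le_iff_le_comap]
      intro a ha
      have h1 := Ideal.mem_map_of_mem (algebraMap A Ap) (hspan a ha)
      have hu : IsUnit (algebraMap A Ap r₁) :=
        IsLocalization.map_units Ap (⟨r₁, hr₁⟩ : p.primeCompl)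
      rw [map_mul, Ideal.unit_mul_mem_iff_mem _ hu] at h1
      revert h1
      rw [Ideal.mem_comap]
      refine fun h1 ↦ (?_ : Ideal.map (algebraMap A Ap) (Ideal.span (Set.range x) ⊔ (I ^ 2 ⊔ J)) ≤
        _) h1
      rw [Ideal.map_sup, Ideal.map_sup, Ideal.map_sup, Ideal.map_pow, pow_two]
      refine sup_le ?_ (sup_le ?_ ?_)
      · exact le_sup_right.trans le_sup_left
      · refine le_sup_of_le_right (Ideal.mul_mono_left ?_)
        rw [← Localization.AtPrime.map_eq_maximalIdeal]
        exact Ideal.map_mono hIp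
      · exact le_sup_left.trans le_sup_left
    obtain ⟨T, hT⟩ := hIfg
    refine exists_notMem_mul_mem p I _ T hT fun a ha ↦ ?_
    have h1 := hle (Ideal.mem_map_of_mem (algebraMap A Ap) (hT ▸ Ideal.subset_span ha))
    obtain ⟨⟨b, s⟩, e⟩ := (IsLocalization.mem_map_algebraMap_iff p.primeCompl Ap).mp h1
    rw [← map_mul] at e
    obtain ⟨t, ht⟩ := (IsLocalization.eq_iff_exists p.primeCompl Ap).mp e
    refine ⟨t * s, p.primeCompl.mul_mem t.2 s.2, ?_⟩
    rw [mul_assoc, mul_comm (s : A), ht]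
    exact Ideal.mul_mem_left _ _ b.2
  refine ⟨r₂ * r₃, p.primeCompl.mul_mem hr₂ hr₃, ?_⟩
  intro Ar _ _ _ _ _
  have hu : IsUnit (algebraMap A Ar r₃) :=
    isUnit_of_dvd_unit (map_dvd _ (dvd_mul_left r₃ r₂)) (IsLocalization.Away.algebraMap_isUnit _)
  let z := Sum.elim x y
  let e : (_ →₀ A) →ₗ[A] Ω[A⁄C] := Finsupp.linearCombination A fun i ↦ D C A (z i)
  let l₁ : (Fin c ⊕ Fin d →₀ A) →ₗ[A] (_ →₀ Ar) :=
    Finsupp.mapRange.linearMap (Algebra.linearMap A Ar)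
  let l₂ : Ω[A⁄C] →ₗ[A] Ω[Ar⁄C] := map C C A Ar
  have h := hbij (r₂ * r₃) (dvd_mul_right _ _)
  rw [← IsLocalizedModule.map_bijective_iff_localizedModuleMap_bijective l₁ l₂] at h
  let e' : (_ →₀ Ar) →ₗ[Ar] Ω[Ar⁄C] :=
    IsLocalizedModule.mapExtendScalars (Submonoid.powers (r₂ * r₃)) l₁ l₂ Ar e
  refine ⟨⟨c, d, fun i ↦ algebraMap A Ar (x i), fun i ↦ algebraMap A Ar (y i),
    .ofRepr (LinearEquiv.ofBijective e' h).symm, fun i ↦ ?_, le_antisymm ?_ ?_⟩⟩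
  · have : Sum.elim (fun i ↦ algebraMap A Ar (x i)) (fun i ↦ algebraMap A Ar (y i)) i =
        algebraMap A Ar (z i) := by rcases i with i | i <;> rfl
    rw [this]
    refine (mapExtendScalars_linearCombination_single (.powers (r₂ * r₃)) l₂ _ i).trans ?_
    simp [l₂, z]
  · rw [Ideal.map_le_iff_le_comap]
    intro a ha
    rw [Ideal.mem_comap, ← Ideal.unit_mul_mem_iff_mem _ hu, ← map_mul]
    have := Ideal.mem_map_of_mem (algebraMap A Ar) (hspan' a ha)
    rw [Ideal.map_sup, Ideal.map_span, Ideal.map_span, Set.image_singleton, ← Set.range_comp,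
      ← IsScalarTower.algebraMap_apply C A Ar] at this
    exact this
  · rw [sup_le_iff, Ideal.span_le, Ideal.span_le, Set.singleton_subset_iff, Set.range_subset_iff,
      IsScalarTower.algebraMap_apply C A Ar]
    exact ⟨Ideal.mem_map_of_mem _ hgI, fun i ↦ Ideal.mem_map_of_mem _ (hx i)⟩

end Coordinates
end ParamDeformation

/-! ### Regularity, conormal module and affine blow-up in adapted coordinates -/

namespace ParamDeformation

theorem AdaptedCoordinates.x_mem {C A : Type u} [CommRing C] [CommRing A] [Algebra C A]
    {I : Ideal A} {g : C} (a : AdaptedCoordinates C A I g) (i : Fin a.c) : a.x i ∈ I :=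
  a.span_eq.ge (Ideal.mem_sup_right (Ideal.subset_span ⟨i, rfl⟩))

theorem AdaptedCoordinates.algebraMap_mem {C A : Type u} [CommRing C] [CommRing A] [Algebra C A]
    {I : Ideal A} {g : C} (a : AdaptedCoordinates C A I g) : algebraMap C A g ∈ I :=
  a.span_eq.ge (Ideal.mem_sup_left (Ideal.mem_span_singleton_self _))

section RegularSequences

open RingTheory.Sequence

/-- Weak regularity of a sequence in a ring, in terms of membership in ideals. -/
theorem isWeaklyRegular_self_iff {R : Type*} [CommRing R] (rs : List R) :
    IsWeaklyRegular R rs ↔ ∀ i (h : i < rs.length) (a : R),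
      rs[i] * a ∈ Ideal.ofList (rs.take i) → a ∈ Ideal.ofList (rs.take i) := by
  rw [isWeaklyRegular_iff]
  refine forall₂_congr fun i h ↦ ?_
  rw [isSMulRegular_quotient_iff_mem_of_smul_mem, smul_eq_mul, Ideal.mul_top]
  rfl

theorem mem_span_X_image_of_X_mul_mem {σ R : Type*} [CommRing R] (s : Set σ) (i : σ) (hi : i ∉ s)
    (p : MvPolynomial σ R) (h : .X i * p ∈ Ideal.span (MvPolynomial.X '' s)) :
    p ∈ Ideal.span (MvPolynomial.X (R := R) '' s) := by
  classical
  rw [MvPolynomial.mem_ideal_span_X_image] at h ⊢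
  intro m hm
  obtain ⟨j, hj, hne⟩ := h (Finsupp.single i 1 + m) (by
    rw [MvPolynomial.mem_support_iff, MvPolynomial.coeff_X_mul]
    exact MvPolynomial.mem_support_iff.mp hm)
  refine ⟨j, hj, ?_⟩
  have hij : i ≠ j := fun e ↦ hi (e ▸ hj)
  rwa [Finsupp.add_apply, Finsupp.single_apply, if_neg hij, zero_add] at hne

/-- A nonzerodivisor of the coefficient ring, followed by distinct variables, is a weakly regular
sequence in a polynomial ring. -/
theorem isWeaklyRegular_C_cons_X {σ R : Type*} [CommRing R] {g : R} (hg : g ∈ nonZeroDivisors R)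
    {c : ℕ} (v : Fin c → σ) (hv : Function.Injective v) :
    IsWeaklyRegular (MvPolynomial σ R)
      (.C g :: List.ofFn fun i ↦ (.X (v i) : MvPolynomial σ R)) := by
  rw [isWeaklyRegular_self_iff]
  rintro (_ | i) hi a h
  · simp only [List.getElem_cons_zero, List.take_zero, Ideal.ofList_nil, Ideal.mem_bot] at h ⊢
    ext m
    have := congrArg (MvPolynomial.coeff m) h
    rw [MvPolynomial.coeff_C_mul, MvPolynomial.coeff_zero] at this
    exact (mem_nonZeroDivisors_iff.mp hg).1 _ this
  · have hic : i < c := by simpa using hi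
    let s : Set σ := v '' {j | j.1 < i}
    have hL : Ideal.ofList ((MvPolynomial.C g :: List.ofFn fun i ↦
        (.X (v i) : MvPolynomial σ R)).take (i + 1)) =
        Ideal.span (MvPolynomial.X '' s) ⊔ Ideal.span {MvPolynomial.C g} := by
      have hset : {z | z ∈ (List.ofFn fun i ↦ (.X (v i) : MvPolynomial σ R)).take i} =
          MvPolynomial.X '' s := by
        ext z
        rw [Set.mem_ofPred_eq, List.mem_take_iff_getElem]
        simp only [List.getElem_ofFn, List.length_ofFn]
        constructor
        · rintro ⟨k, hk, rfl⟩
          exact ⟨_, ⟨⟨k, (lt_min_iff.mp hk).2⟩, (lt_min_iff.mp hk).1, rfl⟩, rfl⟩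
        · rintro ⟨_, ⟨k, hk, rfl⟩, rfl⟩
          exact ⟨k, lt_min_iff.mpr ⟨hk, k.2⟩, rfl⟩
      rw [List.take_succ_cons, Ideal.ofList_cons, sup_comm, Ideal.ofList, hset]
    let π := MvPolynomial.map (σ := σ) (Ideal.Quotient.mk (Ideal.span {g}))
    have hker : RingHom.ker π = Ideal.span {MvPolynomial.C g} := by
      rw [MvPolynomial.ker_map, Ideal.mk_ker, Ideal.map_span, Set.image_singleton]
    have hmem (p : MvPolynomial σ R) :
        p ∈ Ideal.span (MvPolynomial.X '' s) ⊔ Ideal.span {MvPolynomial.C g} ↔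
          π p ∈ Ideal.span (MvPolynomial.X '' s) := by
      have : Ideal.span (MvPolynomial.X '' s) =
          (Ideal.span (MvPolynomial.X (R := R) '' s)).map π := by
        rw [Ideal.map_span]
        exact congrArg Ideal.span ((Set.image_image π _ s).trans
          (Set.image_congr fun j _ ↦ MvPolynomial.map_X _ j)).symm
      rw [this, ← hker, ← Ideal.mem_comap, Ideal.comap_map_of_surjective' π
        (MvPolynomial.map_surjective _ Ideal.Quotient.mk_surjective)]
    rw [hL, hmem] at h ⊢
    simp only [List.getElem_cons_succ, List.getElem_ofFn, map_mul] at h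
    refine mem_span_X_image_of_X_mul_mem s (v ⟨i, hic⟩) ?_ _ (by simpa [π] using h)
    rintro ⟨j, hj, e⟩
    have := hv e
    subst this
    exact lt_irrefl i hj

/-- Reducing a weakly regular sequence modulo its first element. -/
theorem isWeaklyRegular_map_of_cons {A D : Type*} [CommRing A] [CommRing D] (π : A →+* D)
    (hπ : Function.Surjective π) (g : A) (rs : List A) (hker : RingHom.ker π = Ideal.span {g})
    (h : IsWeaklyRegular A (g :: rs)) : IsWeaklyRegular D (rs.map π) := by
  rw [isWeaklyRegular_self_iff] at h ⊢
  intro i hi d hd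
  obtain ⟨a, rfl⟩ := hπ d
  rw [List.length_map] at hi
  have hmem (b : A) : π b ∈ Ideal.ofList ((rs.map π).take i) ↔
      b ∈ Ideal.ofList ((g :: rs).take (i + 1)) := by
    rw [List.take_succ_cons, Ideal.ofList_cons, ← hker, ← List.map_take, ← Ideal.map_ofList,
      ← Ideal.mem_comap, Ideal.comap_map_of_surjective' _ hπ, sup_comm]
  rw [List.getElem_map, ← map_mul, hmem] at hd
  rw [hmem]
  exact h (i + 1) (by simpa using hi) a (by simpa using hd)

/-- The coordinates in the ideal form, after `g`, a weakly regular sequence: this holds for the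
variables of a polynomial ring, and the algebra is étale, hence flat, over a polynomial ring. -/
theorem AdaptedCoordinates.isWeaklyRegular {C A : Type u} [CommRing C] [CommRing A] [Algebra C A]
    [Algebra.Smooth C A] {I : Ideal A} {g : C} (hg : g ∈ nonZeroDivisors C)
    (a : AdaptedCoordinates C A I g) :
    IsWeaklyRegular A (algebraMap C A g :: List.ofFn a.x) := by
  let := (MvPolynomial.aeval (R := C) (Sum.elim a.x a.y)).toRingHom.toAlgebra
  have := etale_aeval_of_basis _ a.basis a.basis_apply
  have h := (isWeaklyRegular_C_cons_X hg (Sum.inl : Fin a.c → Fin a.c ⊕ Fin a.d)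
    Sum.inl_injective).of_flat (S := A)
  convert h using 1
  rw [List.map_cons, List.map_ofFn]
  congr 1
  · simp [RingHom.algebraMap_toAlgebra]
  · congr 1
    funext i
    simp [RingHom.algebraMap_toAlgebra]

end RegularSequences

section Conormal

open KaehlerDifferential

/-- Adapted coordinates are linearly independent modulo `I ^ 2 + (g)`: apply the dual derivations.
-/
theorem AdaptedCoordinates.mem_of_sum_mem {C A : Type u} [CommRing C] [CommRing A] [Algebra C A]
    {I : Ideal A} {g : C} (a : AdaptedCoordinates C A I g) (b : Fin a.c → A)
    (hb : ∑ i, b i * a.x i ∈ I ^ 2 ⊔ Ideal.span {algebraMap C A g}) (j : Fin a.c) : b j ∈ I := by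
  classical
  let der : Derivation C A A := (a.basis.coord (Sum.inl j)).compDer (D C A)
  have hx (i : Fin a.c) : der (a.x i) = if i = j then 1 else 0 := by
    have : D C A (a.x i) = a.basis (Sum.inl i) := (a.basis_apply (Sum.inl i)).symm
    change a.basis.coord (Sum.inl j) (D C A (a.x i)) = _
    rw [this, Module.Basis.coord_apply, a.basis.repr_self, Finsupp.single_apply]
    simp
  have hle : ∀ z ∈ I ^ 2 ⊔ Ideal.span {algebraMap C A g}, der z ∈ I := by
    intro z hz
    obtain ⟨p, hp, q, hq, rfl⟩ := Submodule.mem_sup.mp hz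
    rw [map_add]
    refine add_mem ?_ ?_
    · clear hz
      rw [pow_two] at hp
      induction hp using Submodule.mul_induction_on' with
      | mem_mul_mem m hm n hn =>
        rw [Derivation.leibniz]
        exact add_mem (I.mul_mem_right _ hm) (I.mul_mem_right _ hn)
      | add x _ y _ hx hy => rw [map_add]; exact add_mem hx hy
    · obtain ⟨r, rfl⟩ := Ideal.mem_span_singleton'.mp hq
      rw [Derivation.leibniz, Derivation.map_algebraMap, smul_zero, zero_add]
      exact I.mul_mem_right _ a.algebraMap_mem
  have h := hle _ hb
  rw [map_sum] at h
  simp only [Derivation.leibniz, hx, Finset.sum_add_distrib, smul_eq_mul, mul_ite, mul_one,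
    mul_zero, Finset.sum_ite_eq', Finset.mem_univ, if_true] at h
  exact (Submodule.add_mem_iff_left _ (sum_mem fun i _ ↦ I.mul_mem_right _ (a.x_mem i))).mp h

/-- The conormal module `I / (I ^ 2 + (g))` is free on adapted coordinates. -/
theorem AdaptedCoordinates.nonempty_linearEquiv_conormal {C A : Type u} [CommRing C] [CommRing A]
    [Algebra C A] {I : Ideal A} {g : C} (a : AdaptedCoordinates C A I g) (J : Ideal A)
    (hJ : J = Ideal.span {algebraMap C A g}) :
    Nonempty ((I ⧸ Submodule.comap (Submodule.subtype I) (I ^ 2 ⊔ J)) ≃ₗ[A] (Fin a.c → A ⧸ I)) := by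
  classical
  subst hJ
  let Q := Submodule.comap (Submodule.subtype I) (I ^ 2 ⊔ Ideal.span {algebraMap C A g})
  let l (i : Fin a.c) : (A ⧸ I) →ₗ[A] (I ⧸ Q) :=
    Submodule.liftQ I (LinearMap.toSpanSingleton A (I ⧸ Q) (Q.mkQ ⟨a.x i, a.x_mem i⟩)) (by
      intro z hz
      rw [LinearMap.mem_ker, LinearMap.toSpanSingleton_apply, ← map_smul]
      refine (Submodule.Quotient.mk_eq_zero Q).mpr (Ideal.mem_sup_left ?_)
      rw [pow_two]
      exact Ideal.mul_mem_mul hz (a.x_mem i))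
  let L : (Fin a.c → A ⧸ I) →ₗ[A] (I ⧸ Q) := ∑ i, l i ∘ₗ LinearMap.proj i
  have hL (b : Fin a.c → A) : L (fun i ↦ Ideal.Quotient.mk I (b i)) =
      Q.mkQ ⟨∑ i, b i * a.x i, sum_mem fun i _ ↦ I.mul_mem_left _ (a.x_mem i)⟩ := by
    have : (⟨∑ i, b i * a.x i, sum_mem fun i _ ↦ I.mul_mem_left _ (a.x_mem i)⟩ : I) =
        ∑ i, b i • ⟨a.x i, a.x_mem i⟩ := by
      apply Subtype.ext
      simp
    rw [this, map_sum, LinearMap.sum_apply]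
    exact Finset.sum_congr rfl fun i _ ↦ (map_smul Q.mkQ (b i) _).symm
  refine ⟨(LinearEquiv.ofBijective L ⟨?_, ?_⟩).symm⟩
  · rw [injective_iff_map_eq_zero]
    intro z hz
    obtain ⟨b, rfl⟩ : ∃ b : Fin a.c → A, (fun i ↦ Ideal.Quotient.mk I (b i)) = z :=
      ⟨fun i ↦ (z i).out, funext fun i ↦ Ideal.Quotient.mk_out _⟩
    rw [hL] at hz
    have := a.mem_of_sum_mem b ((Submodule.Quotient.mk_eq_zero Q).mp hz)
    exact funext fun i ↦ Ideal.Quotient.eq_zero_iff_mem.mpr (this i)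
  · intro z
    obtain ⟨⟨z, hz⟩, rfl⟩ := Submodule.mkQ_surjective Q z
    have hz' := hz
    rw [a.span_eq] at hz'
    obtain ⟨p, hp, q, hq, e⟩ := Submodule.mem_sup.mp hz'
    obtain ⟨b, hb⟩ := (Submodule.mem_span_range_iff_exists_fun A).mp hq
    refine ⟨_, (hL b).trans ?_⟩
    refine (Submodule.Quotient.eq Q).mpr ?_
    refine Ideal.mem_sup_right ?_
    have : (∑ i, b i * a.x i) - z = -p := by
      rw [← e, ← hb]; simp
    change (∑ i, b i * a.x i) - z ∈ _
    rw [this]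
    exact neg_mem hp

end Conormal

section Blowup

open scoped TensorProduct

/-- Let `R → R'` be universal for dividing the elements `x i` by `g`, with `R'` smooth over `C`,
and let `A` be étale over `R`. Then the base change of `A` to `R'` is the affine blow-up algebra of
`I = (g, x)`: it is smooth over `C`, hence `g` is a nonzerodivisor in it and it embeds into
`A[1/g]`; the image consists of the fractions `b / g ^ n` with `b ∈ I ^ n`. -/
theorem smooth_and_exists_lift_of_dilatation {C R R' A K Bl : Type u} {ι : Type*} [CommRing C]
    [CommRing R] [CommRing R'] [CommRing A] [CommRing K] [CommRing Bl] [Algebra C R] [Algebra C R']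
    [Algebra R R'] [Algebra R A] [Algebra C A] [IsScalarTower C R R'] [IsScalarTower C R A]
    [Algebra A K] [Algebra A Bl] [Algebra Bl K] [IsScalarTower A Bl K] [Algebra C Bl]
    [IsScalarTower C A Bl] [Algebra.Smooth C R'] [Algebra.Etale R A] (I : Ideal A) (g : C)
    (hg : g ∈ nonZeroDivisors C) (x : ι → R) (t : ι → R')
    (hx : ∀ i, algebraMap R R' (x i) = algebraMap C R' g * t i)
    (hadj : Algebra.adjoin R (Set.range t) = ⊤)
    (huniv : ∀ (O : Type u) [CommRing O] [Algebra R O] (o : ι → O),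
      (∀ i, algebraMap R O (x i) = algebraMap R O (algebraMap C R g) * o i) →
        ∃ ψ : R' →ₐ[R] O, ∀ i, ψ (t i) = o i)
    (hI : I = Ideal.span {algebraMap C A g} ⊔ Ideal.span (Set.range fun i ↦ algebraMap R A (x i)))
    [IsLocalization.Away (algebraMap C A g) K] (hinj : Function.Injective (algebraMap Bl K))
    (hrange : ∀ s : K, s ∈ Set.range (algebraMap Bl K) ↔
      ∃ n : ℕ, ∃ b ∈ I ^ n, algebraMap A K (algebraMap C A g) ^ n * s = algebraMap A K b) :
    Algebra.Smooth C Bl ∧ ∃ τ : ι → Bl,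
      (∀ i, algebraMap A Bl (algebraMap C A g) * τ i = algebraMap A Bl (algebraMap R A (x i))) ∧
      ∀ (O : Type u) [CommRing O] [Algebra A O], (∀ b ∈ I, algebraMap A O b = 0) →
        ∀ o : ι → O, ∃ φ : Bl →ₐ[A] O, ∀ i, φ (τ i) = o i := by
  let B := R' ⊗[R] A
  let iA : A →+* B := (Algebra.TensorProduct.includeRight : A →ₐ[R] B).toRingHom
  let iR : R' →+* B := algebraMap R' B
  have hiR (r : R) : iR (algebraMap R R' r) = iA (algebraMap R A r) :=
    (Algebra.TensorProduct.includeRight : A →ₐ[R] B).commutes r |>.symm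
  have hiC (r : C) : iR (algebraMap C R' r) = iA (algebraMap C A r) := by
    rw [IsScalarTower.algebraMap_apply C R R', IsScalarTower.algebraMap_apply C R A, hiR]
  -- the universal property of the base change
  have hlift (O : Type u) [CommRing O] [Algebra A O] (o : ι → O)
      (ho : ∀ i, algebraMap A O (algebraMap R A (x i)) =
        algebraMap A O (algebraMap C A g) * o i) :
      ∃ ψ : B →+* O, (∀ b, ψ (iA b) = algebraMap A O b) ∧ ∀ i, ψ (iR (t i)) = o i := by
    let : Algebra R O := ((algebraMap A O).comp (algebraMap R A)).toAlgebra
    have : IsScalarTower R A O := .of_algebraMap_eq fun _ ↦ rfl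
    obtain ⟨ψ, hψ⟩ := huniv O o fun i ↦ by
      rw [IsScalarTower.algebraMap_apply R A O, IsScalarTower.algebraMap_apply R A O, ho,
        ← IsScalarTower.algebraMap_apply C R A]
    refine ⟨(Algebra.TensorProduct.productMap ψ (IsScalarTower.toAlgHom R A O)).toRingHom,
      fun b ↦ ?_, fun i ↦ ?_⟩
    · exact Algebra.TensorProduct.productMap_right_apply _ _ b
    · exact (Algebra.TensorProduct.productMap_left_apply _ _ (t i)).trans (hψ i)
  let γ : B := iA (algebraMap C A g)
  have hτ (i : ι) : γ * iR (t i) = iA (algebraMap R A (x i)) := by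
    rw [← hiR, hx, map_mul, hiC]
  have hsmooth : (iR.comp (algebraMap C R')).Smooth := by
    refine RingHom.Smooth.comp ?_ ?_
    · exact RingHom.smooth_algebraMap.mpr inferInstance
    · have : Algebra.Smooth R' B := inferInstance
      exact RingHom.smooth_algebraMap.mpr this
  have hγ (z : B) (hz : γ * z = 0) : z = 0 := by
    let algCB : Algebra C B := (iR.comp (algebraMap C R')).toAlgebra
    have hflat : @Module.Flat C B _ _ algCB.toModule := hsmooth.flat
    have h := @Module.Flat.isSMulRegular_of_nonZeroDivisors C B _ _ algCB.toModule g hg hflat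
    refine h ?_
    change iR (algebraMap C R' g) * z = iR (algebraMap C R' g) * 0
    rw [mul_zero, hiC]
    exact hz
  have hγn (n : ℕ) (z : B) (hz : γ ^ n * z = 0) : z = 0 := by
    induction n with
    | zero => simpa using hz
    | succ n ih => exact ih (hγ _ (by rw [← hz]; ring))
  -- every element of the base change is a fraction of an element of `A` by a power of `g`
  have hfrac (z : B) : ∃ n : ℕ, ∃ b : A, γ ^ n * z = iA b := by
    let S : Subring B :=
      { carrier := {z | ∃ n : ℕ, ∃ b : A, γ ^ n * z = iA b}
        one_mem' := ⟨0, 1, by simp⟩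
        zero_mem' := ⟨0, 0, by simp⟩
        mul_mem' := by
          rintro z w ⟨n, b, hb⟩ ⟨m, c, hc⟩
          exact ⟨n + m, b * c, by rw [map_mul, ← hb, ← hc]; ring⟩
        add_mem' := by
          rintro z w ⟨n, b, hb⟩ ⟨m, c, hc⟩
          refine ⟨n + m, algebraMap C A g ^ m * b + algebraMap C A g ^ n * c, ?_⟩
          rw [map_add, map_mul, map_mul, map_pow, map_pow, ← hb, ← hc]
          ring
        neg_mem' := by
          rintro z ⟨n, b, hb⟩
          exact ⟨n, -b, by rw [map_neg, ← hb]; ring⟩ }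
    have hA (b : A) : iA b ∈ S := ⟨0, b, by simp⟩
    have hR (r : R') : iR r ∈ S := by
      have hr : r ∈ Algebra.adjoin R (Set.range t) := hadj ▸ Algebra.mem_top
      induction hr using Algebra.adjoin_induction with
      | mem r hr =>
        obtain ⟨i, rfl⟩ := hr
        exact ⟨1, algebraMap R A (x i), by rw [pow_one, hτ]⟩
      | algebraMap r => rw [hiR]; exact hA _
      | add r s _ _ hr hs => rw [map_add]; exact add_mem hr hs
      | mul r s _ _ hr hs => rw [map_mul]; exact mul_mem hr hs
    change z ∈ S
    induction z using TensorProduct.induction_on with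
    | zero => exact zero_mem _
    | tmul r b =>
      have : r ⊗ₜ[R] b = iR r * iA b := by
        change _ = (r ⊗ₜ[R] 1) * (1 ⊗ₜ[R] b)
        rw [Algebra.TensorProduct.tmul_mul_tmul, mul_one, one_mul]
      rw [this]
      exact mul_mem (hR r) (hA b)
    | add z w hz hw => exact add_mem hz hw
  have hu : IsUnit (algebraMap A K (algebraMap C A g)) := IsLocalization.Away.algebraMap_isUnit _
  obtain ⟨m, hmA, hmt⟩ := hlift K (fun i ↦ ↑hu.unit⁻¹ * algebraMap A K (algebraMap R A (x i)))
    fun i ↦ by rw [← mul_assoc, IsUnit.mul_val_inv, one_mul]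
  have hmγ : m γ = algebraMap A K (algebraMap C A g) := hmA _
  -- `z` is determined by some `g ^ n * z`, which comes from `A`
  have hminj : Function.Injective m := by
    rw [injective_iff_map_eq_zero]
    intro z hz
    obtain ⟨n, b, hb⟩ := hfrac z
    have h := congrArg m hb
    rw [map_mul, hz, mul_zero, hmA] at h
    obtain ⟨⟨_, k, rfl⟩, hk⟩ := (IsLocalization.map_eq_zero_iff
      (Submonoid.powers (algebraMap C A g)) K b).mp h.symm
    have hk' := congrArg iA hk
    rw [map_zero, map_mul, map_pow, ← hb] at hk'
    exact hγn (k + n) z (by rw [← hk']; ring)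
  have hmrange (s : K) : s ∈ Set.range m ↔ s ∈ Set.range (algebraMap Bl K) := by
    constructor
    · rintro ⟨z, rfl⟩
      have hA (b : A) : m (iA b) ∈ (algebraMap Bl K).range :=
        ⟨algebraMap A Bl b, by rw [hmA, ← IsScalarTower.algebraMap_apply]⟩
      have hR (r : R') : m (iR r) ∈ (algebraMap Bl K).range := by
        have hr : r ∈ Algebra.adjoin R (Set.range t) := hadj ▸ Algebra.mem_top
        induction hr using Algebra.adjoin_induction with
        | mem r hr =>
          obtain ⟨i, rfl⟩ := hr
          refine (hrange _).mpr ⟨1, algebraMap R A (x i), ?_, ?_⟩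
          · rw [pow_one, hI]
            exact Ideal.mem_sup_right (Ideal.subset_span ⟨i, rfl⟩)
          · rw [pow_one, hmt, ← mul_assoc, IsUnit.mul_val_inv, one_mul]
        | algebraMap r => rw [hiR]; exact hA _
        | add r s _ _ hr hs => rw [map_add, map_add]; exact add_mem hr hs
        | mul r s _ _ hr hs => rw [map_mul, map_mul]; exact mul_mem hr hs
      change m z ∈ (algebraMap Bl K).range
      induction z using TensorProduct.induction_on with
      | zero => rw [map_zero]; exact zero_mem _
      | tmul r b =>
        have : r ⊗ₜ[R] b = iR r * iA b := by
          change _ = (r ⊗ₜ[R] 1) * (1 ⊗ₜ[R] b)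
          rw [Algebra.TensorProduct.tmul_mul_tmul, mul_one, one_mul]
        rw [this, map_mul]
        exact mul_mem (hR r) (hA b)
      | add z w hz hw => rw [map_add]; exact add_mem hz hw
    · intro hs
      obtain ⟨n, b, hb, e⟩ := (hrange s).mp hs
      have hIγ : I.map iA ≤ Ideal.span {γ} := by
        rw [hI, Ideal.map_sup, Ideal.map_span, Ideal.map_span, Set.image_singleton]
        refine sup_le le_rfl (Ideal.span_le.mpr ?_)
        rintro _ ⟨_, ⟨i, rfl⟩, rfl⟩
        exact Ideal.mem_span_singleton'.mpr ⟨iR (t i), by rw [mul_comm, hτ]⟩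
      have hb' : iA b ∈ Ideal.span {γ ^ n} := by
        rw [← Ideal.span_singleton_pow]
        exact Ideal.pow_right_mono hIγ n (Ideal.map_pow iA I n ▸ Ideal.mem_map_of_mem iA hb)
      obtain ⟨z, hz⟩ := Ideal.mem_span_singleton'.mp hb'
      refine ⟨z, (hu.pow n).mul_left_cancel ?_⟩
      rw [e, ← hmA b, ← hz, map_mul, map_pow, hmγ, mul_comm]
  let eK : Bl ≃+* (algebraMap Bl K).range :=
    RingEquiv.ofBijective (algebraMap Bl K).rangeRestrict
      ⟨fun a b h ↦ hinj (congrArg Subtype.val h), (algebraMap Bl K).rangeRestrict_surjective⟩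
  have heK (s) : algebraMap Bl K (eK.symm s) = s := congrArg Subtype.val (eK.apply_symm_apply s)
  let e' : B →+* Bl := eK.symm.toRingHom.comp
    (m.codRestrict (algebraMap Bl K).range fun z ↦ (hmrange _).mp ⟨z, rfl⟩)
  have he' (z : B) : algebraMap Bl K (e' z) = m z := heK _
  let e : B ≃+* Bl := RingEquiv.ofBijective e' ⟨fun z w h ↦ hminj (by rw [← he', ← he', h]),
    fun s ↦ by
      obtain ⟨z, hz⟩ := (hmrange (algebraMap Bl K s)).mpr ⟨s, rfl⟩
      exact ⟨z, hinj ((he' z).trans hz)⟩⟩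
  have heA (b : A) : e (iA b) = algebraMap A Bl b :=
    hinj ((he' _).trans (by rw [hmA, IsScalarTower.algebraMap_apply A Bl K]))
  refine ⟨?_, fun i ↦ e (iR (t i)), fun i ↦ ?_, fun O _ _ hO o ↦ ?_⟩
  · rw [← RingHom.smooth_algebraMap]
    have : algebraMap C Bl = e.toRingHom.comp (iR.comp (algebraMap C R')) := by
      ext r
      refine (IsScalarTower.algebraMap_apply C A Bl r).trans ?_
      rw [← heA]
      exact congrArg e (hiC r).symm
    rw [this]
    exact RingHom.Smooth.respectsIso.1 _ e hsmooth
  · rw [← heA, ← heA, ← hτ, map_mul]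
  · obtain ⟨ψ, hψA, hψt⟩ := hlift O o fun i ↦ by
      have h1 : algebraMap R A (x i) ∈ I := by
        rw [hI]; exact Ideal.mem_sup_right (Ideal.subset_span ⟨i, rfl⟩)
      have h2 : algebraMap C A g ∈ I := by
        rw [hI]; exact Ideal.mem_sup_left (Ideal.mem_span_singleton_self _)
      rw [hO _ h1, hO _ h2, zero_mul]
    refine ⟨{ ψ.comp e.symm.toRingHom with
      commutes' := fun b ↦ ?_ }, fun i ↦ ?_⟩
    · change ψ (e.symm _) = _
      rw [← heA, e.symm_apply_apply, hψA]
    · change ψ (e.symm _) = _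
      rw [e.symm_apply_apply, hψt]

/-- The affine blow-up algebra in adapted coordinates is the base change of `A` along the
dilatation `C[X, Y] → C[T, Y]`, `X_i ↦ g T_i`. As `A` is étale over `C[X, Y]`, the base change is
étale over `C[T, Y]`. Hence it is smooth over `C`, `g` is a nonzerodivisor in it, and it embeds into
`A[1/g]`; also, algebra maps from it into algebras killed by `I` take arbitrary values on `T_i`. -/
theorem AdaptedCoordinates.smooth_and_exists_lift {C A : Type u} [CommRing C] [CommRing A]
    [Algebra C A] [Algebra.Smooth C A] {I : Ideal A} {g : C} (a : AdaptedCoordinates C A I g)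
    (hg : g ∈ nonZeroDivisors C) (K Bl : Type u) [CommRing K] [CommRing Bl] [Algebra A K]
    [Algebra A Bl] [Algebra Bl K] [IsScalarTower A Bl K] [Algebra C Bl] [IsScalarTower C A Bl]
    [IsLocalization.Away (algebraMap C A g) K] (hinj : Function.Injective (algebraMap Bl K))
    (hrange : ∀ s : K, s ∈ Set.range (algebraMap Bl K) ↔
      ∃ n : ℕ, ∃ b ∈ I ^ n, algebraMap A K (algebraMap C A g) ^ n * s = algebraMap A K b) :
    Algebra.Smooth C Bl ∧ ∃ t : Fin a.c → Bl,
      (∀ i, algebraMap A Bl (algebraMap C A g) * t i = algebraMap A Bl (a.x i)) ∧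
      ∀ (O : Type u) [CommRing O] [Algebra A O], (∀ b ∈ I, algebraMap A O b = 0) →
        ∀ o : Fin a.c → O, ∃ φ : Bl →ₐ[A] O, ∀ i, φ (t i) = o i := by
  let R := MvPolynomial (Fin a.c ⊕ Fin a.d) C
  -- the swapped index type keeps the algebra structure of `R'` over `R` apart from the identity
  let R' := MvPolynomial (Fin a.d ⊕ Fin a.c) C
  let algRA : Algebra R A := (MvPolynomial.aeval (R := C) (Sum.elim a.x a.y)).toRingHom.toAlgebra
  let dil : R →ₐ[C] R' := MvPolynomial.aeval (R := C) (Sum.elim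
    (fun i ↦ MvPolynomial.C g * MvPolynomial.X (Sum.inr i)) fun j ↦ MvPolynomial.X (Sum.inl j))
  let algRR' : Algebra R R' := dil.toRingHom.toAlgebra
  have : Algebra.Etale R A := etale_aeval_of_basis _ a.basis a.basis_apply
  have : IsScalarTower C R R' := .of_algebraMap_eq fun r ↦ (dil.commutes r).symm
  have : IsScalarTower C R A := .of_algebraMap_eq fun r ↦
    ((MvPolynomial.aeval (R := C) (Sum.elim a.x a.y)).commutes r).symm
  have hRA (i) : algebraMap R A (MvPolynomial.X (Sum.inl i)) = a.x i :=
    (MvPolynomial.aeval_X (R := C) (Sum.elim a.x a.y) (Sum.inl i))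
  have hX (i) : algebraMap R R' (MvPolynomial.X (Sum.inl i)) =
      algebraMap C R' g * MvPolynomial.X (Sum.inr i) :=
    (MvPolynomial.aeval_X (R := C) _ (Sum.inl i))
  have hY (j) : algebraMap R R' (MvPolynomial.X (Sum.inr j)) = MvPolynomial.X (Sum.inl j) :=
    (MvPolynomial.aeval_X (R := C) _ (Sum.inr j))
  have : Algebra.Smooth C R' := ⟨inferInstance, inferInstance⟩
  have key := smooth_and_exists_lift_of_dilatation (R := R) (R' := R') (Bl := Bl) (K := K) I g hg
    (fun i ↦ MvPolynomial.X (Sum.inl i)) (fun i ↦ MvPolynomial.X (Sum.inr i)) hX ?_ ?_ ?_ hinj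
    hrange
  · obtain ⟨h1, t, h2, h3⟩ := key
    exact ⟨h1, t, fun i ↦ by rw [← hRA]; exact h2 i, h3⟩
  · rw [eq_top_iff]
    rintro p -
    induction p using MvPolynomial.induction_on with
    | C r =>
      rw [← MvPolynomial.algebraMap_eq, IsScalarTower.algebraMap_apply C R R']
      exact Subalgebra.algebraMap_mem _ _
    | add p q hp hq => exact add_mem hp hq
    | mul_X p k hp =>
      refine mul_mem hp ?_
      rcases k with j | i
      · rw [← hY]; exact Subalgebra.algebraMap_mem _ _
      · exact Algebra.subset_adjoin ⟨i, rfl⟩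
  · intro O _ _ o ho
    let : Algebra C O := ((algebraMap R O).comp (algebraMap C R)).toAlgebra
    have : IsScalarTower C R O := .of_algebraMap_eq fun _ ↦ rfl
    let ψ : R' →ₐ[C] O := MvPolynomial.aeval (R := C)
      (Sum.elim (fun j ↦ algebraMap R O (MvPolynomial.X (Sum.inr j))) o)
    have hψ : ψ.comp (IsScalarTower.toAlgHom C R R') = IsScalarTower.toAlgHom C R O := by
      refine MvPolynomial.algHom_ext ?_
      rintro (i | j)
      · change ψ (algebraMap R R' _) = algebraMap R O _
        rw [hX, map_mul, ho i, ψ.commutes, ← IsScalarTower.algebraMap_apply C R O]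
        exact congrArg _ (MvPolynomial.aeval_X (R := C) _ (Sum.inr i))
      · change ψ (algebraMap R R' _) = algebraMap R O _
        rw [hY]
        exact MvPolynomial.aeval_X (R := C) _ (Sum.inl j)
    exact ⟨{ ψ with commutes' := fun r ↦ DFunLike.congr_fun hψ r },
      fun i ↦ MvPolynomial.aeval_X (R := C) _ (Sum.inr i)⟩
  · simp only [hRA]
    exact a.span_eq

end Blowup
end ParamDeformation

/-! ### Presentations of the affine blow-up algebra and differences of its points -/

namespace ParamDeformation

open scoped TensorProduct

section Difference

variable {A K Bl ι : Type*} [CommRing A] [CommRing K] [CommRing Bl] [Algebra A K] [Algebra A Bl]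
  [Algebra Bl K] [IsScalarTower A Bl K] [Fintype ι]

/-- A presentation of the affine blow-up algebra `Bl = ⋃ J ^ (-n) I ^ n ⊆ K` of `A`, for an
invertible ideal `J ⊆ I`: the elements `s k` of `J⁻¹ ⊆ K` and `j k ∈ J` satisfy `∑ k, s k * j k =
1`, `mulS k : J → A` is multiplication by `s k`, and `divS k : I → Bl` is multiplication by `s k`.
-/
structure BlowupPresentation (Bl : Type*) [CommRing Bl] [Algebra A Bl] [Algebra Bl K]
    [IsScalarTower A Bl K] (I J : Ideal A) (ι : Type*) [Fintype ι] where
  /-- Elements of `J`. -/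
  j : ι → J
  /-- Elements of `J⁻¹`. -/
  s : ι → K
  /-- Multiplication by `s k` on `J`. -/
  mulS : ι → J →ₗ[A] A
  algebraMap_mulS : ∀ k a, algebraMap A K (mulS k a) = algebraMap A K a * s k
  /-- Multiplication by `s k` on `I`. -/
  divS : ι → I →ₗ[A] Bl
  algebraMap_divS : ∀ k x, algebraMap Bl K (divS k x) = algebraMap A K x * s k
  sum_mulS : ∑ k, mulS k (j k) = 1
  injective : Function.Injective (algebraMap Bl K)
  injective' : Function.Injective (algebraMap A K)
  adjoin_eq_top : Algebra.adjoin A (Set.range fun p : ι × I ↦ divS p.1 p.2) = ⊤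

/-- Elements `j k` of `J` and `s k` of `J⁻¹` with `∑ k, j k * s k = 1` underlie a presentation of
the affine blow-up algebra. -/
theorem exists_blowupPresentation (I J : Ideal A)
    (hinj : Function.Injective (algebraMap Bl K)) (hinj' : Function.Injective (algebraMap A K))
    (hBl : ∀ s : K, s ∈ Set.range (algebraMap Bl K) ↔ ∃ n : ℕ, ∀ a ∈ J ^ n, ∃ b ∈ I ^ n,
      algebraMap A K a * s = algebraMap A K b)
    (j : ι → J) (s : ι → K) (hs : ∀ k, ∀ a ∈ J, ∃ b, algebraMap A K b = algebraMap A K a * s k)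
    (hsum : ∑ k, algebraMap A K (j k) * s k = 1) :
    ∃ p : BlowupPresentation Bl (K := K) I J ι, p.j = j ∧ p.s = s := by
  choose f hf using hs
  let m (k : ι) : J →ₗ[A] A :=
    { toFun := fun a ↦ f k a a.2
      map_add' := fun a b ↦ hinj' (by rw [map_add, hf, hf, hf]; simp [add_mul])
      map_smul' := fun a b ↦ hinj' (by simp [hf, mul_assoc]) }
  have hm (k) (a : J) : algebraMap A K (m k a) = algebraMap A K a * s k := hf k a a.2
  have hd (k : ι) (x : I) : ∃ z : Bl, algebraMap Bl K z = algebraMap A K x * s k := by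
    refine (hBl _).mpr ⟨1, fun a ha ↦ ?_⟩
    rw [pow_one] at ha ⊢
    exact ⟨x * m k ⟨a, ha⟩, I.mul_mem_right _ x.2, by rw [map_mul, hm]; ring⟩
  choose d hd using hd
  let D (k : ι) : I →ₗ[A] Bl :=
    { toFun := d k
      map_add' := fun a b ↦ hinj (by rw [map_add, hd, hd, hd]; simp [add_mul])
      map_smul' := fun a b ↦ hinj (by
        rw [hd, RingHom.id_apply, Algebra.smul_def, map_mul, hd,
          ← IsScalarTower.algebraMap_apply A Bl K]
        simp [mul_assoc]) }
  refine ⟨⟨j, s, m, hm, D, hd, hinj' (by simp only [map_sum, hm, hsum, map_one]), hinj, hinj', ?_⟩,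
    rfl, rfl⟩
  -- with `N = ∑ A s k`, an element `z` with `J ^ n z ⊆ I ^ n` lies in `J ^ n N ^ n z ⊆ (I N) ^ n`
  rw [eq_top_iff]
  rintro z -
  obtain ⟨n, hn⟩ := (hBl _).mp ⟨z, rfl⟩
  let N : Submodule A K := Submodule.span A (Set.range s)
  let J' : Submodule A K := Submodule.map (Algebra.linearMap A K) J
  let I' : Submodule A K := Submodule.map (Algebra.linearMap A K) I
  have h1 : (1 : K) ∈ J' * N := by
    rw [← hsum]
    exact sum_mem fun k _ ↦ Submodule.mul_mem_mul ⟨_, (j k).2, rfl⟩ (Submodule.subset_span ⟨k, rfl⟩)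
  have h1n : (1 : K) ∈ J' ^ n * N ^ n := by
    rw [← mul_pow]
    exact one_pow (M := K) n ▸ Submodule.pow_mem_pow _ h1 n
  have hJ' : J' ^ n = Submodule.map (Algebra.linearMap A K) (J ^ n) :=
    (Submodule.map_pow (A := A) J (Algebra.ofId A K) n).symm
  have hI' : I' ^ n = Submodule.map (Algebra.linearMap A K) (I ^ n) :=
    (Submodule.map_pow (A := A) I (Algebra.ofId A K) n).symm
  have h2 : ∀ w ∈ J' ^ n * N ^ n, w * algebraMap Bl K z ∈ I' ^ n * N ^ n := by
    intro w hw
    induction hw using Submodule.mul_induction_on' with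
    | mem_mul_mem a ha b hb =>
      rw [hJ'] at ha
      obtain ⟨a, ha, rfl⟩ := ha
      obtain ⟨c, hc, e⟩ := hn a ha
      have : Algebra.linearMap A K a * b * algebraMap Bl K z = algebraMap A K c * b := by
        rw [← e, Algebra.linearMap_apply]; ring
      rw [this]
      exact Submodule.mul_mem_mul (hI' ▸ ⟨c, hc, rfl⟩) hb
    | add x _ y _ hx hy => rw [add_mul]; exact add_mem hx hy
  have h3 := h2 1 h1n
  rw [one_mul, ← mul_pow] at h3
  let S := (Algebra.adjoin A (Set.range fun p : ι × I ↦ D p.1 p.2)).map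
    (IsScalarTower.toAlgHom A Bl K)
  have h4 : I' * N ≤ Subalgebra.toSubmodule S := by
    rw [Submodule.mul_le]
    rintro _ ⟨x, hx, rfl⟩ w hw
    induction hw using Submodule.span_induction with
    | mem w hw =>
      obtain ⟨k, rfl⟩ := hw
      exact ⟨D k ⟨x, hx⟩, Algebra.subset_adjoin ⟨(k, ⟨x, hx⟩), rfl⟩, hd k ⟨x, hx⟩⟩
    | zero => rw [mul_zero]; exact zero_mem _
    | add a b _ _ ha hb => rw [mul_add]; exact add_mem ha hb
    | smul a b _ hb => rw [mul_smul_comm]; exact Submodule.smul_mem _ _ hb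
  have h5 : (I' * N) ^ n ≤ Subalgebra.toSubmodule S := by
    refine (pow_le_pow_left' h4 n).trans ?_
    clear h1n hJ' hI' h2 h3 hn h4
    induction n with
    | zero =>
      rw [pow_zero, Submodule.one_eq_range]
      rintro _ ⟨a, rfl⟩
      exact S.algebraMap_mem a
    | succ n ih =>
      rw [pow_succ]
      exact (mul_le_mul_left ih _).trans (Submodule.mul_le.mpr fun _ ha _ hb ↦ S.mul_mem ha hb)
  obtain ⟨z', hz', e⟩ := h5 h3
  rw [← hinj e]
  exact hz'

/-- The submodule `I ∩ (I ^ 2 + J)` of `I`, so that the quotient of `I` by it is the conormal module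
`I / (I ^ 2 + J)`. -/
abbrev conormalKernel (I J : Ideal A) : Submodule A I :=
  Submodule.comap (Submodule.subtype I) (I ^ 2 ⊔ J)

variable {O : Type*} [CommRing O] [Algebra A O] {I J : Ideal A}

/-- The homomorphism `δ : I / (I ^ 2 + J) → O ⊗ J` is the difference of the algebra maps `φ` and
`φ'` from the affine blow-up algebra `⋃ J ^ (-n) I ^ n` to `O`: heuristically, `δ x = (φ' - φ) (x /
a) ⊗ a` for a generator `a` of `J`. -/
def IsDifference (φ φ' : Bl →ₐ[A] O) (δ : (I ⧸ conormalKernel I J) →ₗ[A] O ⊗[A] J) : Prop :=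
  ∀ (z : Bl) (a : J) (x : I), algebraMap A Bl a * z = algebraMap A Bl x →
    (φ' z - φ z) ⊗ₜ[A] a = δ (Submodule.Quotient.mk x)

theorem IsDifference.refl (φ : Bl →ₐ[A] O) :
    IsDifference (I := I) (J := J) φ φ 0 := fun z a x _ ↦ by
  rw [sub_self, TensorProduct.zero_tmul, LinearMap.zero_apply]

theorem IsDifference.add {φ φ' φ'' : Bl →ₐ[A] O}
    {δ ε : (I ⧸ conormalKernel I J) →ₗ[A] O ⊗[A] J} (h : IsDifference φ φ' δ)
    (h' : IsDifference φ' φ'' ε) : IsDifference φ φ'' (ε + δ) := fun z a x e ↦ by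
  rw [LinearMap.add_apply, ← h z a x e, ← h' z a x e, ← TensorProduct.add_tmul, sub_add_sub_cancel]

namespace BlowupPresentation

variable (P : BlowupPresentation Bl (K := K) I J ι)
include P

theorem mul_divS (k : ι) (a : J) (x : I) :
    algebraMap A Bl a * P.divS k x = algebraMap A Bl (P.mulS k a * x) := P.injective (by
  rw [map_mul, P.algebraMap_divS, ← IsScalarTower.algebraMap_apply A Bl K,
    ← IsScalarTower.algebraMap_apply A Bl K, map_mul, P.algebraMap_mulS]
  ring)

theorem divS_of_mem (k : ι) (x : I) (hx : (x : A) ∈ J) :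
    P.divS k x = algebraMap A Bl (P.mulS k ⟨x, hx⟩) := P.injective (by
  rw [P.algebraMap_divS, ← IsScalarTower.algebraMap_apply A Bl K, P.algebraMap_mulS])

theorem divS_eq_smul (k : ι) {z : Bl} {a : J} {x : I}
    (e : algebraMap A Bl a * z = algebraMap A Bl x) : P.divS k x = P.mulS k a • z := P.injective (by
  rw [P.algebraMap_divS, Algebra.smul_def, map_mul, IsScalarTower.algebraMap_apply A Bl K, ← e,
    map_mul, ← IsScalarTower.algebraMap_apply A Bl K, ← IsScalarTower.algebraMap_apply A Bl K,
    P.algebraMap_mulS]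
  ring)

theorem sum_smul_divS (k : ι) (x : I) : ∑ l, P.mulS k (P.j l) • P.divS l x = P.divS k x :=
    P.injective (by
  have h := congrArg (algebraMap A K) P.sum_mulS
  simp only [map_sum, map_one, P.algebraMap_mulS] at h
  rw [map_sum, ← mul_one (algebraMap Bl K (P.divS k x)), ← h, Finset.mul_sum]
  refine Finset.sum_congr rfl fun l _ ↦ ?_
  rw [Algebra.smul_def, map_mul, ← IsScalarTower.algebraMap_apply A Bl K, P.algebraMap_mulS,
    P.algebraMap_divS, P.algebraMap_divS]
  ring)

theorem sum_smul_mulS_smul {M : Type*} [AddCommMonoid M] [Module A M] (m : M) :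
    ∑ k, P.mulS k (P.j k) • m = m := by
  rw [← Finset.sum_smul, P.sum_mulS, one_smul]

theorem sum_tmul_mulS (w : O) (a : J) : ∑ k, (P.mulS k a • w) ⊗ₜ[A] P.j k = w ⊗ₜ[A] a := by
  simp only [TensorProduct.smul_tmul, ← TensorProduct.tmul_sum]
  refine congrArg _ (Subtype.ext (P.injective' ?_))
  simp only [AddSubmonoidClass.coe_finsetSum, map_sum, Submodule.coe_smul, smul_eq_mul, map_mul,
    P.algebraMap_mulS]
  have h := congrArg (algebraMap A K) P.sum_mulS
  simp only [map_sum, map_one, P.algebraMap_mulS] at h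
  conv_rhs => rw [← mul_one (algebraMap A K a), ← h, Finset.mul_sum]
  exact Finset.sum_congr rfl fun k _ ↦ by ring

/-- The difference of two algebra maps into an algebra killed by `I` exists. -/
theorem exists_isDifference (hO : ∀ x ∈ I, algebraMap A O x = 0) (hJI : J ≤ I)
    (φ φ' : Bl →ₐ[A] O) :
    ∃ δ : (I ⧸ conormalKernel I J) →ₗ[A] O ⊗[A] J, IsDifference φ φ' δ := by
  -- `δ x = ∑ (φ' - φ) (x * s k) ⊗ j k`, which vanishes on `J`, where `x * s k` lies in `A`, and on
  -- `I ^ 2`, because `I` acts by zero on `O`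
  let δ₀ : I →ₗ[A] O ⊗[A] J := ∑ k, (TensorProduct.mk A O J).flip (P.j k) ∘ₗ
    (φ'.toLinearMap - φ.toLinearMap) ∘ₗ P.divS k
  have hδ₀ (x : I) : δ₀ x = ∑ k, (φ' (P.divS k x) - φ (P.divS k x)) ⊗ₜ[A] P.j k := by
    simp [δ₀, LinearMap.sum_apply, TensorProduct.sub_tmul]
  have hJ (x : I) (hx : (x : A) ∈ J) : δ₀ x = 0 := by
    rw [hδ₀]
    refine Finset.sum_eq_zero fun k _ ↦ ?_
    rw [P.divS_of_mem k x hx, AlgHom.commutes, AlgHom.commutes, sub_self, TensorProduct.zero_tmul]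
  have hsmul (x y : I) : δ₀ ((x : A) • y) = 0 := by
    rw [map_smul, ← algebraMap_smul O (x : A), hO x x.2, zero_smul]
  have hker : conormalKernel I J ≤ LinearMap.ker δ₀ := by
    rintro ⟨x, hx⟩ hx'
    obtain ⟨a, ha, b, hb, rfl⟩ := Submodule.mem_sup.mp hx'
    have haI : a ∈ I := Ideal.pow_le_self two_ne_zero ha
    have : (⟨a + b, hx⟩ : I) = ⟨a, haI⟩ + ⟨b, hJI hb⟩ := rfl
    rw [LinearMap.mem_ker, this, map_add, hJ ⟨b, _⟩ hb, add_zero]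
    rw [pow_two] at ha
    suffices ∀ (c : A) (hc : c ∈ I * I), ∀ h : c ∈ I, δ₀ ⟨c, h⟩ = 0 from this a ha haI
    intro c hc
    induction hc using Submodule.mul_induction_on' with
    | mem_mul_mem p hp q hq => exact fun _ ↦ hsmul ⟨p, hp⟩ ⟨q, hq⟩
    | add p hp q hq h1 h2 =>
      intro h
      have e : (⟨p + q, h⟩ : I) = ⟨p, Ideal.mul_le_left hp⟩ + ⟨q, Ideal.mul_le_left hq⟩ := rfl
      rw [e, map_add, h1, h2, add_zero]
  refine ⟨Submodule.liftQ _ δ₀ hker, fun z a x e ↦ ?_⟩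
  rw [Submodule.liftQ_apply, hδ₀, ← P.sum_tmul_mulS]
  refine Finset.sum_congr rfl fun k _ ↦ ?_
  rw [P.divS_eq_smul k e, map_smul, map_smul, smul_sub]

/-- A difference is determined by the values of the two maps on the generators `divS k x`, because
`∑ k, mulS k (j k) = 1`. -/
theorem _root_.ParamDeformation.IsDifference.eq_sum {φ φ' : Bl →ₐ[A] O}
    {δ : (I ⧸ conormalKernel I J) →ₗ[A] O ⊗[A] J} (h : IsDifference φ φ' δ) (x : I) :
    δ (Submodule.Quotient.mk x) = ∑ k, (φ' (P.divS k x) - φ (P.divS k x)) ⊗ₜ[A] P.j k := by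
  have (k : ι) : (φ' (P.divS k x) - φ (P.divS k x)) ⊗ₜ[A] P.j k =
      P.mulS k (P.j k) • δ (Submodule.Quotient.mk x) := by
    rw [← map_smul]
    exact h _ _ (P.mulS k (P.j k) • x) (P.mul_divS k (P.j k) x)
  simp only [this, P.sum_smul_mulS_smul]

theorem isDifference_unique {φ φ' : Bl →ₐ[A] O}
    {δ δ' : (I ⧸ conormalKernel I J) →ₗ[A] O ⊗[A] J} (h : IsDifference φ φ' δ)
    (h' : IsDifference φ φ' δ') : δ = δ' := by
  ext x
  exact (h.eq_sum P x).trans (h'.eq_sum P x).symm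

/-- Contraction of `O ⊗ J` against the element `s k` of `J⁻¹`. -/
noncomputable def contract (O : Type*) [CommRing O] [Algebra A O] (k : ι) : O ⊗[A] J →ₗ[A] O :=
  (TensorProduct.rid A O).toLinearMap ∘ₗ (P.mulS k).lTensor O

omit P in
theorem contract_tmul (P : BlowupPresentation Bl (K := K) I J ι) (k : ι) (w : O) (a : J) :
    P.contract O k (w ⊗ₜ[A] a) = P.mulS k a • w := by
  simp [contract]

theorem sum_contract_tmul (w : O ⊗[A] J) : ∑ k, P.contract O k w ⊗ₜ[A] P.j k = w := by
  induction w using TensorProduct.induction_on with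
  | zero => simp
  | tmul w a => simp only [P.contract_tmul, P.sum_tmul_mulS]
  | add w w' h h' => simp only [map_add, TensorProduct.add_tmul, Finset.sum_add_distrib, h, h']

/-- To be a difference is a condition on the values of the two maps on the generators `divS k x`. -/
theorem isDifference_iff {φ φ' : Bl →ₐ[A] O}
    {δ : (I ⧸ conormalKernel I J) →ₗ[A] O ⊗[A] J} :
    IsDifference φ φ' δ ↔ ∀ k x, φ' (P.divS k x) =
      φ (P.divS k x) + P.contract O k (δ (Submodule.Quotient.mk x)) := by
  constructor
  · intro h k x
    rw [h.eq_sum P, map_sum]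
    have (l : ι) : P.contract O k ((φ' (P.divS l x) - φ (P.divS l x)) ⊗ₜ[A] P.j l) =
        (φ' - φ : Bl →ₗ[A] O) (P.mulS k (P.j l) • P.divS l x) := by
      rw [P.contract_tmul, map_smul]; rfl
    simp only [this]
    rw [← map_sum, P.sum_smul_divS]
    exact (add_sub_cancel _ _).symm
  · intro h z a x e
    rw [← P.sum_tmul_mulS, ← P.sum_contract_tmul (δ _)]
    refine Finset.sum_congr rfl fun k _ ↦ ?_
    rw [smul_sub, ← map_smul, ← map_smul, ← P.divS_eq_smul k e, h k x, add_sub_cancel_left]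

theorem eq_of_isDifference {φ φ' φ'' : Bl →ₐ[A] O}
    {δ : (I ⧸ conormalKernel I J) →ₗ[A] O ⊗[A] J} (h : IsDifference φ φ' δ)
    (h' : IsDifference φ φ'' δ) : φ' = φ'' := by
  refine AlgHom.ext_of_adjoin_eq_top P.adjoin_eq_top ?_
  rintro _ ⟨⟨k, x⟩, rfl⟩
  dsimp only
  rw [P.isDifference_iff.mp h, P.isDifference_iff.mp h']

end BlowupPresentation

end Difference
end ParamDeformation

/-! ### The affine blow-up algebra over an affine open -/

namespace ParamDeformation

section Sections

variable {P : Scheme.{u}}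

/-- The ring of functions on `U ∖ D`, regarded as an algebra over the functions on `U`. -/
def ComplSections (J : P.IdealSheafData) (U : P.affineOpens) : Type u :=
  Γ(P, U.1 ⊓ complement J)

noncomputable instance (J : P.IdealSheafData) (U : P.affineOpens) :
    CommRing (ComplSections J U) := inferInstanceAs (CommRing Γ(P, U.1 ⊓ complement J))

noncomputable instance (J : P.IdealSheafData) (U : P.affineOpens) :
    Algebra Γ(P, U.1) (ComplSections J U) := (resCompl J U.1).toAlgebra

/-- The affine blow-up algebra over `U`, regarded as an algebra over the functions on `U`. -/
def BlowupSections (I J : P.IdealSheafData) (hJI : J ≤ I) (U : P.affineOpens) : Type u :=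
  blowupAlgebra I J hJI U

noncomputable instance (I J : P.IdealSheafData) (hJI : J ≤ I) (U : P.affineOpens) :
    CommRing (BlowupSections I J hJI U) := inferInstanceAs (CommRing (blowupAlgebra I J hJI U))

/-- The map from the functions on `U` to the affine blow-up algebra. -/
noncomputable def toBlowupSections (I J : P.IdealSheafData) (hJI : J ≤ I) (U : P.affineOpens) :
    Γ(P, U.1) →+* BlowupSections I J hJI U :=
  (resCompl J U.1).codRestrict _ (res_mem_blowupAlgebra I J hJI U)

noncomputable instance (I J : P.IdealSheafData) (hJI : J ≤ I) (U : P.affineOpens) :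
    Algebra Γ(P, U.1) (BlowupSections I J hJI U) := (toBlowupSections I J hJI U).toAlgebra

noncomputable instance (I J : P.IdealSheafData) (hJI : J ≤ I) (U : P.affineOpens) :
    Algebra (BlowupSections I J hJI U) (ComplSections J U) :=
  (blowupAlgebra I J hJI U).subtype.toAlgebra

instance (I J : P.IdealSheafData) (hJI : J ≤ I) (U : P.affineOpens) :
    IsScalarTower Γ(P, U.1) (BlowupSections I J hJI U) (ComplSections J U) :=
  .of_algebraMap_eq fun _ ↦ rfl

theorem algebraMap_complSections_injective (I J : P.IdealSheafData) (hJI : J ≤ I)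
    (U : P.affineOpens) :
    Function.Injective (algebraMap (BlowupSections I J hJI U) (ComplSections J U)) :=
  Subtype.val_injective

/-- The definition of the affine blow-up algebra, as a subalgebra of the functions on `U ∖ D`. -/
theorem mem_range_algebraMap_complSections_iff (I J : P.IdealSheafData) (hJI : J ≤ I)
    (U : P.affineOpens) (s : ComplSections J U) :
    s ∈ Set.range (algebraMap (BlowupSections I J hJI U) (ComplSections J U)) ↔
      ∃ n : ℕ, ∀ a ∈ J.ideal U ^ n, ∃ b ∈ I.ideal U ^ n,
        algebraMap Γ(P, U.1) (ComplSections J U) a * s = algebraMap _ _ b :=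
  ⟨by rintro ⟨s, rfl⟩; exact s.2, fun h ↦ ⟨⟨s, h⟩, rfl⟩⟩

variable {J : P.IdealSheafData}

/-- An invertible ideal is principal on small basic opens of any given affine open. -/
theorem IsEffectiveCartier.exists_basicOpen (hJ : IsEffectiveCartier J) (U : P.affineOpens)
    (x : P) (hx : x ∈ U.1) : ∃ (r : Γ(P, U.1)) (V : P.affineOpens), V.1 = P.basicOpen r ∧ x ∈ V.1 ∧
      ∃ g ∈ nonZeroDivisors Γ(P, V.1), J.ideal V = Ideal.span {g} := by
  obtain ⟨V, hxV, g, hg, hgJ⟩ := hJ x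
  obtain ⟨r, s, e, hr⟩ := exists_basicOpen_le_affine_inter U.2 V.2 x ⟨hx, hxV⟩
  obtain ⟨V', hV'⟩ : ∃ V' : P.affineOpens, V'.1 = P.basicOpen r := ⟨P.affineBasicOpen r, rfl⟩
  have hle : V'.1 ≤ V.1 := (hV'.trans e).le.trans (P.basicOpen_le s)
  refine ⟨r, V', hV', hV' ▸ hr, (P.presheaf.map (homOfLE hle).op).hom g, ?_, ?_⟩
  · let := (P.presheaf.map (homOfLE hle).op).hom.toAlgebra
    have : IsLocalization.Away s Γ(P, V'.1) := V.2.isLocalization_of_eq_basicOpen s _ (hV'.trans e)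
    exact IsLocalization.map_nonZeroDivisors_le (.powers s) _ ⟨g, hg, rfl⟩
  · rw [← J.map_ideal (U := V') (V := V) hle, hgJ, Ideal.map_span, Set.image_singleton]
    rfl

theorem inf_complement_eq_basicOpen (U : P.affineOpens) (g : Γ(P, U.1))
    (hg : J.ideal U = Ideal.span {g}) : U.1 ⊓ complement J = P.basicOpen g := by
  ext x
  simp only [complement, Opens.coe_inf, Set.mem_inter_iff, SetLike.mem_coe]
  have (hxU : x ∈ U.1) : x ∈ J.support.compl ↔ x ∈ P.basicOpen g := by
    change ¬ x ∈ J.support ↔ _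
    rw [J.mem_support_iff_of_mem hxU, hg, Scheme.zeroLocus_span, Scheme.mem_zeroLocus_iff]
    simp
  exact ⟨fun h ↦ (this h.1).mp h.2, fun h ↦ ⟨P.basicOpen_le g h, (this (P.basicOpen_le g h)).mpr h⟩⟩

theorem isLocalization_complSections (U : P.affineOpens) (g : Γ(P, U.1))
    (hg : J.ideal U = Ideal.span {g}) : IsLocalization.Away g (ComplSections J U) :=
  U.2.isLocalization_of_eq_basicOpen g (homOfLE inf_le_left) (inf_complement_eq_basicOpen U g hg)

/-- A section over `U` that vanishes on basic opens around all points vanishes. -/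
theorem eq_zero_of_basicOpen (U : P.Opens) (a : Γ(P, U))
    (h : ∀ x ∈ U, ∃ (V : P.Opens) (hV : V ≤ U),
      x ∈ V ∧ (P.presheaf.map (homOfLE hV).op).hom a = 0) :
    a = 0 := by
  choose V hV hx h0 using fun x : U ↦ h x.1 x.2
  refine TopCat.Sheaf.eq_of_locally_eq' P.sheaf V U (fun x ↦ homOfLE (hV x))
    (fun x hx' ↦ Opens.mem_iSup.mpr ⟨⟨x, hx'⟩, hx _⟩) a 0 fun x ↦ ?_
  exact (h0 x).trans (map_zero _).symm

theorem resCompl_res {U V : P.Opens} (h : V ≤ U) (a : Γ(P, U)) :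
    resCompl J V ((P.presheaf.map (homOfLE h).op).hom a) =
      (P.presheaf.map (homOfLE (inf_le_inf_right (complement J) h)).op).hom (resCompl J U a) := by
  simp only [resCompl, ← RingHom.comp_apply, ← CommRingCat.hom_comp, ← Functor.map_comp]
  rfl

/-- Functions on `U` are determined by their restriction to the complement of an effective Cartier
divisor. -/
theorem resCompl_injective (hJ : IsEffectiveCartier J) (U : P.affineOpens) :
    Function.Injective (resCompl J U.1) := by
  rw [injective_iff_map_eq_zero]
  intro a ha
  refine eq_zero_of_basicOpen U.1 a fun x hx ↦ ?_
  obtain ⟨r, V, hV, hx, g, hg, hgJ⟩ := hJ.exists_basicOpen U x hx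
  have hle : V.1 ≤ U.1 := hV.le.trans (P.basicOpen_le r)
  refine ⟨V.1, hle, hx, ?_⟩
  have := isLocalization_complSections V g hgJ
  have hinj : Function.Injective (resCompl J V.1) :=
    IsLocalization.injective (M := .powers g) (ComplSections J V) (Submonoid.powers_le.mpr hg)
  refine hinj ?_
  rw [resCompl_res hle, ha, map_zero, map_zero]

theorem algebraMap_injective_complSections (hJ : IsEffectiveCartier J) (U : P.affineOpens) :
    Function.Injective (algebraMap Γ(P, U.1) (ComplSections J U)) := resCompl_injective hJ U

/-- Restriction of functions on `U` and on `U ∖ D` to a basic open `D(r) ⊆ U` is localisation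
at `r`. -/
theorem localization_of_eq_basicOpen (hJ : IsEffectiveCartier J) {U V : P.affineOpens}
    (r : Γ(P, U.1)) (hV : V.1 = P.basicOpen r) (hle : V.1 ≤ U.1) :
    (∀ (L : Ideal Γ(P, U.1)), ∀ b ∈ L.map (P.presheaf.map (homOfLE hle).op).hom, ∃ m : ℕ, ∃ c ∈ L,
      (P.presheaf.map (homOfLE hle).op).hom c = (P.presheaf.map (homOfLE hle).op).hom r ^ m * b) ∧
    (∀ s, ∃ m : ℕ, ∃ t, (P.presheaf.map (homOfLE (inf_le_inf_right (complement J) hle)).op).hom t =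
      resCompl J V.1 ((P.presheaf.map (homOfLE hle).op).hom r) ^ m * s) ∧
    (∀ t, (P.presheaf.map (homOfLE (inf_le_inf_right (complement J) hle)).op).hom t = 0 →
      ∃ m : ℕ, resCompl J U.1 r ^ m * t = 0) := by
  refine ⟨fun L b hb ↦ ?_, ?_⟩
  · let := (P.presheaf.map (homOfLE hle).op).hom.toAlgebra
    have : IsLocalization.Away r Γ(P, V.1) := U.2.isLocalization_of_eq_basicOpen r _ hV
    obtain ⟨⟨c, ⟨_, m, rfl⟩⟩, e⟩ :=
      (IsLocalization.mem_map_algebraMap_iff (.powers r) Γ(P, V.1)).mp hb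
    refine ⟨m, c, c.2, e.symm.trans ?_⟩
    rw [mul_comm, map_pow]
    rfl
  · have hc : IsCompact (X := P) ((U.1 ⊓ complement J : P.Opens) : Set P) := hJ.isCompact_inf U
    have hq : IsQuasiSeparated (α := P) ((U.1 ⊓ complement J : P.Opens) : Set P) :=
      U.2.isQuasiSeparated.of_subset inf_le_left
    have hb : P.basicOpen (resCompl J U.1 r) = V.1 ⊓ complement J := by
      rw [hV, resCompl, Scheme.basicOpen_res]
      exact le_antisymm (le_inf inf_le_right (inf_le_left.trans inf_le_right))
        (le_inf (le_inf (inf_le_left.trans (P.basicOpen_le r)) inf_le_right) inf_le_left)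
    have h := isLocalization_basicOpen_of_qcqs hc hq (resCompl J U.1 r)
    have h1 : ∀ W, ∀ (hW : W = P.basicOpen (resCompl J U.1 r)) (hle : W ≤ U.1 ⊓ complement J),
        (∀ s, ∃ m : ℕ, ∃ t, (P.presheaf.map (homOfLE hle).op).hom t =
          (P.presheaf.map (homOfLE hle).op).hom (resCompl J U.1 r) ^ m * s) ∧
      (∀ t, (P.presheaf.map (homOfLE hle).op).hom t = 0 →
        ∃ m : ℕ, resCompl J U.1 r ^ m * t = 0) := by
      rintro W rfl hle
      refine ⟨fun s ↦ ?_, fun t ht ↦ ?_⟩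
      · obtain ⟨⟨t, ⟨_, m, rfl⟩⟩, e⟩ :=
          IsLocalization.surj (Submonoid.powers (resCompl J U.1 r)) s
        refine ⟨m, t, e.symm.trans ?_⟩
        rw [mul_comm, map_pow]
        rfl
      · obtain ⟨⟨_, m, rfl⟩, e⟩ := (IsLocalization.map_eq_zero_iff
          (Submonoid.powers (resCompl J U.1 r)) _ t).mp ht
        exact ⟨m, e⟩
    rw [resCompl_res hle]
    exact h1 _ hb.symm _

/-- An invertible ideal `J` of the functions on an affine open `U` has an inverse: there are
`j k ∈ J` and functions `s k` on `U ∖ D` with `s k J ⊆ Γ(U)` and `∑ k, j k * s k = 1`. -/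
theorem IsEffectiveCartier.exists_inverse (hJ : IsEffectiveCartier J) (U : P.affineOpens) :
    ∃ (ι : Type) (_ : Fintype ι) (j : ι → J.ideal U) (s : ι → ComplSections J U),
      (∀ k, ∀ a ∈ J.ideal U, ∃ b, algebraMap Γ(P, U.1) _ b = algebraMap Γ(P, U.1) _ a * s k) ∧
      ∑ k, algebraMap Γ(P, U.1) _ (j k).1 * s k = 1 := by
  let A := Γ(P, U.1)
  let K := ComplSections J U
  let N : Submodule A K :=
    { carrier := {s | ∀ a ∈ J.ideal U, ∃ b, algebraMap A K b = algebraMap A K a * s}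
      zero_mem' := fun a _ ↦ ⟨0, by simp⟩
      add_mem' := by
        intro s t hs ht a ha
        obtain ⟨b, hb⟩ := hs a ha
        obtain ⟨c, hc⟩ := ht a ha
        exact ⟨b + c, by rw [map_add, hb, hc, mul_add]⟩
      smul_mem' := by
        intro r s hs a ha
        obtain ⟨b, hb⟩ := hs a ha
        exact ⟨r * b, by rw [map_mul, hb, Algebra.smul_def]; ring⟩ }
  let J' : Submodule A K := Submodule.map (Algebra.linearMap A K) (J.ideal U)
  suffices h : (1 : K) ∈ J' * N by
    have key : ∀ w ∈ J' * N, ∃ (ι : Type) (_ : Fintype ι) (j : ι → J.ideal U) (s : ι → K),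
        (∀ k, s k ∈ N) ∧ ∑ k, algebraMap A K (j k).1 * s k = w := by
      intro w hw
      induction hw using Submodule.mul_induction_on' with
      | mem_mul_mem a ha b hb =>
        obtain ⟨a, ha, rfl⟩ := ha
        exact ⟨Unit, inferInstance, fun _ ↦ ⟨a, ha⟩, fun _ ↦ b, fun _ ↦ hb, by simp⟩
      | add x _ y _ hx hy =>
        obtain ⟨ι, _, j, s, hs, e⟩ := hx
        obtain ⟨ι', _, j', s', hs', e'⟩ := hy
        refine ⟨ι ⊕ ι', inferInstance, Sum.elim j j', Sum.elim s s', ?_, ?_⟩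
        · rintro (k | k)
          exacts [hs k, hs' k]
        · rw [Fintype.sum_sum_type, ← e, ← e']
          rfl
    exact key 1 h
  -- the functions in `J * J⁻¹` form an ideal, which contains a power of `r` for basic opens `D(r)`
  -- around all points of `U` on which `J` is principal; hence it is the unit ideal
  let 𝔞 : Ideal A := Submodule.comap (Algebra.linearMap A K) (J' * N)
  suffices h : 𝔞 = ⊤ by
    have h1 : (1 : A) ∈ 𝔞 := h ▸ Submodule.mem_top
    have h2 : Algebra.linearMap A K 1 ∈ J' * N := h1
    rwa [Algebra.linearMap_apply, map_one] at h2
  have key : ∀ x : U.1, ∃ r : A, x.1 ∈ P.basicOpen r ∧ ∃ m : ℕ, r ^ m ∈ 𝔞 := by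
    rintro ⟨x, hx⟩
    obtain ⟨r, V, hV, hr, g, hg, hgJ⟩ := hJ.exists_basicOpen U x hx
    have hle : V.1 ≤ U.1 := hV.le.trans (P.basicOpen_le r)
    refine ⟨r, hV ▸ hr, ?_⟩
    obtain ⟨hA, hK, hK0⟩ := localization_of_eq_basicOpen hJ r hV hle
    have hcomm := resCompl_res (J := J) hle
    have hα : (J.ideal U).map (P.presheaf.map (homOfLE hle).op).hom = Ideal.span {g} :=
      (J.map_ideal (U := V) (V := U) hle).trans hgJ
    generalize (P.presheaf.map (homOfLE hle).op).hom = α at hA hK hK0 hcomm hα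
    generalize (P.presheaf.map (homOfLE (inf_le_inf_right (complement J) hle)).op).hom = κ
      at hK hK0 hcomm
    have := isLocalization_complSections V g hgJ
    have hu : IsUnit (resCompl J V.1 g) :=
      IsLocalization.Away.algebraMap_isUnit (S := ComplSections J V) g
    obtain ⟨m, t, ht, h⟩ := exists_lift_of_localization (resCompl J U.1) (resCompl J V.1) α κ r
      (fun a ↦ (hcomm a).symm) hA (fun s ↦ by rw [← hcomm]; exact hK s) hK0 ⊤ (J.ideal U) (hJ.fg U)
      (↑hu.unit⁻¹) 1 (fun a ha ↦ by
        rw [pow_one, hα, Ideal.mem_span_singleton'] at ha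
        obtain ⟨c, rfl⟩ := ha
        refine ⟨c, by rw [Ideal.map_top, pow_one]; trivial, ?_⟩
        rw [map_mul, mul_assoc, hu.mul_val_inv, mul_one])
    obtain ⟨n, c, hc, e⟩ := hA (J.ideal U) g (hα ▸ Ideal.mem_span_singleton_self g)
    obtain ⟨l, hl⟩ := hK0 (resCompl J U.1 c * t - resCompl J U.1 r ^ (m + n)) (by
      rw [map_sub, map_mul, ht, map_pow, ← hcomm, ← hcomm, e, map_mul, map_pow, pow_add]
      linear_combination (resCompl J V.1 (α r)) ^ (m + n) * hu.mul_val_inv)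
    refine ⟨l + (m + n), ?_⟩
    have h3 : Algebra.linearMap A K (r ^ (l + (m + n))) =
        Algebra.linearMap A K (r ^ l * c) * (show K from t) := by
      change resCompl J U.1 _ = resCompl J U.1 _ * t
      rw [map_pow, map_mul, map_pow, pow_add]
      linear_combination -hl
    change Algebra.linearMap A K (r ^ (l + (m + n))) ∈ J' * N
    rw [h3]
    refine Submodule.mul_mem_mul ⟨_, Ideal.mul_mem_left _ _ hc, rfl⟩ fun a ha ↦ ?_
    obtain ⟨b, -, hb⟩ := h a (by rwa [pow_one])
    exact ⟨b, hb.symm⟩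
  choose r hr m hm using key
  have hspan : Ideal.span (Set.range r) = ⊤ := by
    rw [← U.2.self_le_iSup_basicOpen_iff]
    exact fun x hx ↦ Opens.mem_iSup.mpr ⟨⟨_, ⟨x, hx⟩, rfl⟩, hr ⟨x, hx⟩⟩
  by_contra h
  obtain ⟨M, hM, hle⟩ := Ideal.exists_le_maximal 𝔞 h
  refine hM.ne_top (top_le_iff.mp (hspan ▸ Ideal.span_le.mpr ?_))
  rintro _ ⟨x, rfl⟩
  exact hM.isPrime.mem_of_pow_mem _ (hle (hm x))

/-- The affine blow-up algebra along an effective Cartier divisor has a presentation over every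
affine open. -/
theorem IsEffectiveCartier.exists_blowupPresentation (hJ : IsEffectiveCartier J)
    (I : P.IdealSheafData) (hJI : J ≤ I) (U : P.affineOpens) :
    ∃ (ι : Type) (_ : Fintype ι), Nonempty (BlowupPresentation (K := ComplSections J U)
      (BlowupSections I J hJI U) (I.ideal U) (J.ideal U) ι) := by
  obtain ⟨ι, _, j, s, hs, e⟩ := hJ.exists_inverse U
  obtain ⟨p, -⟩ := ParamDeformation.exists_blowupPresentation (I.ideal U) (J.ideal U)
    (algebraMap_complSections_injective I J hJI U) (algebraMap_injective_complSections hJ U)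
    (mem_range_algebraMap_complSections_iff I J hJI U) j s hs e
  exact ⟨ι, _, ⟨p⟩⟩

end Sections

end ParamDeformation

/-! ### The affine blow-up and its points -/

namespace ParamDeformation

section AffineBlowup

open Scheme.AffineZariskiSite in
/-- The affine blow-up is glued from the spectra of the affine blow-up algebras: the preimage of an
affine open `U` is the spectrum of the affine blow-up algebra over `U`. -/
theorem exists_isOpenImmersion_affineBlowup {P : Scheme.{u}} (I J : P.IdealSheafData) (hJI : J ≤ I)
    (hJ : IsEffectiveCartier J) (U : P.affineOpens) :
    ∃ (ι : Spec (.of (BlowupSections I J hJI U)) ⟶ affineBlowup I J hJI hJ)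
      (_ : IsOpenImmersion ι), affineBlowupMap I J hJI hJ ⁻¹ᵁ U.1 = ι.opensRange ∧
      ι ≫ affineBlowupMap I J hJI hJ =
        Spec.map (CommRingCat.ofHom (toBlowupSections I J hJI U)) ≫ U.2.fromSpec := by
  let d := Scheme.AffineZariskiSite.relativeGluingData
    (coequifibered_blowupPresheafMap I J hJI hJ)
  have : Quiver.IsThin (Scheme.AffineZariskiSite.directedCover P).I₀ :=
    inferInstanceAs (Quiver.IsThin P.AffineZariskiSite)
  have : Small.{u} (Scheme.AffineZariskiSite.directedCover P).I₀ :=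
    inferInstanceAs (Small.{u} P.AffineZariskiSite)
  let i : (Scheme.AffineZariskiSite.directedCover P).I₀ := U
  have h1 := d.ι_toBase i
  have h2 := d.toBase_preimage_eq_opensRange_ι i
  have : IsOpenImmersion (d.cover.f i) := d.cover.map_prop i
  refine ⟨d.cover.f i, this, ?_, h1.trans ?_⟩
  · refine Eq.trans ?_ h2
    congr 1
    exact U.1.opensRange_ι.symm
  · exact (Category.assoc _ _ _)

theorem fromSpec_appLE_self {P : Scheme.{u}} {U : P.Opens} (hU : IsAffineOpen U)
    (h : ⊤ ≤ hU.fromSpec ⁻¹ᵁ U) :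
    hU.fromSpec.appLE U ⊤ h = (Scheme.ΓSpecIso Γ(P, U)).inv := by
  rw [Scheme.Hom.appLE, hU.fromSpec_app_self, Category.assoc, ← Functor.map_comp]
  exact (congrArg _ ((Spec Γ(P, U)).presheaf.map_id _)).trans (Category.comp_id _)

/-- If the preimage of an affine open `U` under `b : S ⟶ P` is the image of an open immersion
`Spec R ⟶ S` over `U`, then `R` is the ring of functions on this preimage. -/
theorem exists_ringEquiv_of_isOpenImmersion {P S : Scheme.{u}} {R : CommRingCat.{u}}
    (b : S ⟶ P) (ι : Spec R ⟶ S) [IsOpenImmersion ι] (U : P.Opens) (hU' : IsAffineOpen U)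
    (hU : b ⁻¹ᵁ U = ι.opensRange) (α : Γ(P, U) ⟶ R) (h : ι ≫ b = Spec.map α ≫ hU'.fromSpec) :
    ∃ θ : R ≃+* Γ(S, b ⁻¹ᵁ U), ∀ a, θ (α.hom a) = (b.app U).hom a := by
  have h1 : ι ⁻¹ᵁ b ⁻¹ᵁ U = ⊤ := by rw [hU]; exact ι.preimage_opensRange
  have hi : IsIso (ι.app (b ⁻¹ᵁ U)) := ι.isIso_app _ hU.le
  have hj : IsIso (ι.appLE (b ⁻¹ᵁ U) ⊤ h1.ge) := by
    rw [Scheme.Hom.appLE]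
    have : IsIso (homOfLE h1.ge) := homOfLE_isIso_of_eq _ h1.symm
    infer_instance
  let e := asIso (ι.appLE (b ⁻¹ᵁ U) ⊤ h1.ge) ≪≫ Scheme.ΓSpecIso R
  have key : b.app U ≫ e.hom = α := by
    simp only [e, Iso.trans_hom, asIso_hom]
    rw [← Category.assoc, ← Iso.eq_comp_inv, ← Scheme.Hom.appLE_eq_app,
      Scheme.Hom.appLE_comp_appLE]
    simp only [h]
    rw [← Scheme.Hom.appLE_comp_appLE (Spec.map α) hU'.fromSpec U ⊤ ⊤
      (by rw [hU'.fromSpec_preimage_self]) (by simp), fromSpec_appLE_self,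
      Scheme.ΓSpecIso_inv_naturality, Scheme.Hom.appTop, ← Scheme.Hom.appLE_eq_app]
    rfl
  refine ⟨e.symm.commRingCatIsoToRingEquiv, fun a ↦ ?_⟩
  change e.inv.hom _ = _
  rw [← key]
  simp

variable {P : Scheme.{u}} {I J : P.IdealSheafData} {hJI : J ≤ I} (hJ : IsEffectiveCartier J)

instance : IsAffineHom (affineBlowupMap I J hJI hJ) where
  isAffine_preimage U hU := by
    obtain ⟨ι, _, h, -⟩ := exists_isOpenImmersion_affineBlowup I J hJI hJ ⟨U, hU⟩
    exact h ▸ isAffineOpen_opensRange ι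

/-- The affine blow-up algebra consists of the functions on the affine blow-up. -/
noncomputable def sectionsEquiv (U : P.affineOpens) :
    BlowupSections I J hJI U ≃+* Γ(affineBlowup I J hJI hJ, affineBlowupMap I J hJI hJ ⁻¹ᵁ U.1) :=
  have h := exists_isOpenImmersion_affineBlowup I J hJI hJ U
  have := h.choose_spec.choose
  (exists_ringEquiv_of_isOpenImmersion (affineBlowupMap I J hJI hJ) h.choose U.1 U.2
    h.choose_spec.choose_spec.1 (CommRingCat.ofHom (toBlowupSections I J hJI U))
    h.choose_spec.choose_spec.2).choose

theorem sectionsEquiv_algebraMap (U : P.affineOpens) (a : Γ(P, U.1)) :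
    sectionsEquiv (hJI := hJI) hJ U (algebraMap Γ(P, U.1) _ a) =
      ((affineBlowupMap I J hJI hJ).app U.1).hom a :=
  have h := exists_isOpenImmersion_affineBlowup I J hJI hJ U
  have := h.choose_spec.choose
  (exists_ringEquiv_of_isOpenImmersion (affineBlowupMap I J hJI hJ) h.choose U.1 U.2
    h.choose_spec.choose_spec.1 (CommRingCat.ofHom (toBlowupSections I J hJI U))
    h.choose_spec.choose_spec.2).choose_spec a

theorem isIso_morphismRestrict_of_isIso_app {X Y : Scheme.{u}} (f : X ⟶ Y) [IsAffineHom f]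
    {U : Y.Opens} (hU : IsAffineOpen U) (h : IsIso (f.app U)) : IsIso (f ∣_ U) := by
  have : IsAffine U := hU
  have : IsAffine (f ⁻¹ᵁ U) := hU.preimage f
  have h3 : U = U.ι ''ᵁ ⊤ := by simp
  have : IsIso (f.app (U.ι ''ᵁ ⊤)) := h3 ▸ h
  have : IsIso (f ∣_ U).appTop := by
    rw [morphismRestrict_appTop]
    have h4 {V W : X.Opens} (e : V = W) : IsIso (X.presheaf.map (eqToHom e).op) := by
      subst e; infer_instance
    exact IsIso.comp_isIso' this (h4 _)
  exact (MorphismProperty.arrow_mk_iso_iff (.isomorphisms Scheme)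
    (arrowIsoSpecΓOfIsAffine (f ∣_ U))).mpr (inferInstanceAs (IsIso (Spec.map (f ∣_ U).appTop)))

/-- The affine blow-up is an isomorphism over the complement of the divisor. -/
theorem isIso_affineBlowupMap_complement :
    IsIso (affineBlowupMap I J hJI hJ ∣_ complement J) := by
  have key : ∀ x ∈ complement J, ∃ U : P.affineOpens, x ∈ U.1 ∧ U.1 ≤ complement J ∧
      IsIso (affineBlowupMap I J hJI hJ ∣_ U.1) := by
    intro x hx
    obtain ⟨V, hxV, g, hg, hgJ⟩ := hJ x
    obtain ⟨U, hU⟩ : ∃ U : P.affineOpens, U.1 = P.basicOpen g := ⟨P.affineBasicOpen g, rfl⟩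
    have e := inf_complement_eq_basicOpen V g hgJ
    have hle : U.1 ≤ V.1 := hU.le.trans (P.basicOpen_le g)
    have hJU : J.ideal U = Ideal.span {1} := by
      rw [← J.map_ideal (U := U) (V := V) hle, hgJ, Ideal.map_span, Set.image_singleton,
        Ideal.span_singleton_one]
      refine Ideal.span_singleton_eq_top.mpr ?_
      have := P.toRingedSpace.isUnit_res_basicOpen g
      have h2 : (P.presheaf.map (homOfLE hle).op).hom g =
        (P.presheaf.map (homOfLE hU.le).op).hom
          ((P.presheaf.map (homOfLE (P.basicOpen_le g)).op).hom g) := by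
        rw [← RingHom.comp_apply, ← CommRingCat.hom_comp, ← Functor.map_comp]
        rfl
      exact h2 ▸ this.map (P.presheaf.map (homOfLE hU.le).op).hom
    refine ⟨U, hU ▸ e ▸ ⟨hxV, hx⟩, (hU.trans e.symm).le.trans inf_le_right, ?_⟩
    have := isLocalization_complSections U 1 hJU
    have hsurj : Function.Surjective (algebraMap Γ(P, U.1) (ComplSections J U)) := fun s ↦
      ⟨_, (IsLocalization.atUnit _ (ComplSections J U) (1 : Γ(P, U.1))
        isUnit_one).apply_symm_apply s⟩
    have hbij : Function.Bijective (toBlowupSections I J hJI U) := by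
      refine ⟨fun a b h ↦ resCompl_injective hJ U (congrArg Subtype.val h), fun z ↦ ?_⟩
      obtain ⟨a, ha⟩ := hsurj (algebraMap _ _ z)
      exact ⟨a, algebraMap_complSections_injective I J hJI U ha⟩
    have hbij' : Function.Bijective ((affineBlowupMap I J hJI hJ).app U.1).hom := by
      have : ⇑((affineBlowupMap I J hJI hJ).app U.1).hom =
          sectionsEquiv (hJI := hJI) hJ U ∘ toBlowupSections I J hJI U :=
        funext fun a ↦ (sectionsEquiv_algebraMap hJ U a).symm
      rw [this]
      exact (sectionsEquiv hJ U).bijective.comp hbij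
    exact isIso_morphismRestrict_of_isIso_app _ U.2
      ((ConcreteCategory.isIso_iff_bijective _).mpr hbij')
  choose U hxU hU hiso using key
  rw [← MorphismProperty.isomorphisms.iff]
  refine IsZariskiLocalAtTarget.of_iSup_eq_top
    (fun x : complement J ↦ (complement J).ι ⁻¹ᵁ (U x.1 x.2).1) ?_ fun x ↦ ?_
  · exact top_le_iff.mp fun x _ ↦ Opens.mem_iSup.mpr ⟨x, hxU x.1 x.2⟩
  · have h := hiso x.1 x.2
    rw [← MorphismProperty.isomorphisms.iff] at h
    refine (MorphismProperty.arrow_mk_iso_iff _ (morphismRestrictRestrict _ _ _ ≪≫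
      morphismRestrictEq _ ?_)).mpr h
    rw [Scheme.Hom.image_preimage_eq_opensRange_inf, Scheme.Opens.opensRange_ι]
    exact inf_eq_right.mpr (hU x.1 x.2)

include hJ in
/-- Elements of the affine blow-up algebra that are annihilated by a power of `J` vanish. -/
theorem eq_zero_of_pow_mul {U : P.affineOpens} {n : ℕ} (z : BlowupSections I J hJI U)
    (h : ∀ a ∈ J.ideal U ^ n, algebraMap Γ(P, U.1) _ a * z = 0) : z = 0 := by
  obtain ⟨ι, _, ⟨p⟩⟩ := hJ.exists_blowupPresentation I hJI U
  induction n with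
  | zero => simpa using h 1 (by simp)
  | succ n ih =>
    refine ih fun a ha ↦ ?_
    rw [← p.sum_smul_mulS_smul (algebraMap Γ(P, U.1) _ a * z)]
    refine Finset.sum_eq_zero fun k _ ↦ p.injective ?_
    have h1 := congrArg (algebraMap _ (ComplSections J U))
      (h (a * p.j k) (pow_succ (J.ideal U) n ▸ Ideal.mul_mem_mul ha (p.j k).2))
    rw [map_zero, map_mul, ← IsScalarTower.algebraMap_apply, map_mul] at h1
    rw [Algebra.smul_def, map_mul, ← IsScalarTower.algebraMap_apply, p.algebraMap_mulS, map_mul,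
      ← IsScalarTower.algebraMap_apply, map_zero]
    linear_combination p.s k * h1

/-- Restriction in the affine blow-up algebra. -/
noncomputable def blowupRes (I J : P.IdealSheafData) (hJI : J ≤ I) {U V : P.affineOpens}
    (h : V.1 ≤ U.1) : BlowupSections I J hJI U →+* BlowupSections I J hJI V :=
  (P.presheaf.map (homOfLE (inf_le_inf_right (complement J) h)).op).hom.restrict _ _
    (blowupAlgebra_restrict I J hJI h)

theorem blowupRes_algebraMap {U V : P.affineOpens} (h : V.1 ≤ U.1) (a : Γ(P, U.1)) :
    blowupRes I J hJI h (algebraMap _ _ a) =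
      algebraMap Γ(P, V.1) _ ((P.presheaf.map (homOfLE h).op).hom a) :=
  Subtype.ext (resCompl_res h a).symm

/-- The identification of the affine blow-up algebras with functions on the affine blow-up is
compatible with restriction: a power of `J` multiplies every element of the affine blow-up algebra
into the functions on `U`, for which this is clear, and `J` is invertible. -/
theorem sectionsEquiv_blowupRes {U V : P.affineOpens} (h : V.1 ≤ U.1)
    (z : BlowupSections I J hJI U) :
    sectionsEquiv hJ V (blowupRes I J hJI h z) =
      ((affineBlowup I J hJI hJ).presheaf.map (homOfLE ((affineBlowupMap I J hJI hJ).preimage_mono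
        h)).op).hom (sectionsEquiv hJ U z) := by
  obtain ⟨n, hn⟩ := z.2
  let d := (sectionsEquiv (hJI := hJI) hJ V).symm (((affineBlowup I J hJI hJ).presheaf.map
    (homOfLE ((affineBlowupMap I J hJI hJ).preimage_mono h)).op).hom (sectionsEquiv hJ U z))
  have hd : blowupRes I J hJI h z - d = 0 := by
    refine eq_zero_of_pow_mul hJ (n := n) _ fun a ha ↦ ?_
    rw [← J.map_ideal (U := V) (V := U) h, ← Ideal.map_pow] at ha
    induction ha using Submodule.span_induction with
    | mem a ha =>
      obtain ⟨a, ha, rfl⟩ := ha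
      obtain ⟨c, -, e⟩ := hn a ha
      have e : algebraMap Γ(P, U.1) _ a * z = algebraMap _ _ c := Subtype.ext e
      have hb (a : Γ(P, U.1)) : ((affineBlowup I J hJI hJ).presheaf.map
          (homOfLE ((affineBlowupMap I J hJI hJ).preimage_mono h)).op).hom
            (((affineBlowupMap I J hJI hJ).app U.1).hom a) =
          ((affineBlowupMap I J hJI hJ).app V.1).hom ((P.presheaf.map (homOfLE h).op).hom a) := by
        rw [← RingHom.comp_apply, ← RingHom.comp_apply, ← CommRingCat.hom_comp,
          ← CommRingCat.hom_comp, Scheme.Hom.naturality]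
        rfl
      rw [mul_sub, sub_eq_zero]
      have h1 := congrArg (blowupRes I J hJI h) e
      rw [map_mul, blowupRes_algebraMap, blowupRes_algebraMap] at h1
      refine h1.trans ((sectionsEquiv hJ V).injective ?_)
      rw [map_mul, sectionsEquiv_algebraMap, sectionsEquiv_algebraMap, RingEquiv.apply_symm_apply]
      have h2 := congrArg (((affineBlowup I J hJI hJ).presheaf.map
        (homOfLE ((affineBlowupMap I J hJI hJ).preimage_mono h)).op).hom ∘ sectionsEquiv hJ U) e
      simp only [Function.comp_apply, map_mul, sectionsEquiv_algebraMap] at h2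
      exact (hb c).symm.trans (h2.symm.trans (congrArg (· * _) (hb a)))
    | zero => simp
    | add x y _ _ hx hy => rw [map_add, add_mul, hx, hy, add_zero]
    | smul c x _ hx => rw [smul_eq_mul, map_mul, mul_assoc, hx, mul_zero]
  rw [sub_eq_zero.mp hd]
  exact RingEquiv.apply_symm_apply _ _

/-- A morphism from `T` that factors through an affine open `U` is determined by the pullback of
functions on `U`. -/
theorem eq_of_appLE_eq {T S : Scheme.{u}} {U : S.Opens} (hU : IsAffineOpen U) {v v' : T ⟶ S}
    (h : ⊤ ≤ v ⁻¹ᵁ U) (h' : ⊤ ≤ v' ⁻¹ᵁ U) (e : v.appLE U ⊤ h = v'.appLE U ⊤ h') : v = v' := by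
  have : IsAffine U.toScheme := hU
  have hr (v : T ⟶ S) (h : ⊤ ≤ v ⁻¹ᵁ U) : Set.range v ⊆ Set.range U.ι := by
    rw [Scheme.Opens.range_ι]
    rintro _ ⟨x, rfl⟩
    exact h (Set.mem_univ x)
  have key : IsOpenImmersion.lift U.ι v (hr v h) = IsOpenImmersion.lift U.ι v' (hr v' h') := by
    refine ext_of_isAffine ?_
    have hl (v : T ⟶ S) (h : ⊤ ≤ v ⁻¹ᵁ U) :
        v.appLE U ⊤ h = U.topIso.inv ≫ (IsOpenImmersion.lift U.ι v (hr v h)).appTop := by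
      have h1 := IsOpenImmersion.lift_fac U.ι v (hr v h)
      have h2 : v.appLE U ⊤ h = (IsOpenImmersion.lift U.ι v (hr v h) ≫ U.ι).appLE U ⊤
          (by rw [h1]; exact h) := by simp only [h1]
      rw [h2, ← Scheme.Hom.appLE_comp_appLE _ U.ι U ⊤ ⊤ (by simp) (by simp)]
      congr 1
      · rw [Scheme.Opens.ι_appLE]
        rfl
      · rw [Scheme.Hom.appTop, ← Scheme.Hom.appLE_eq_app]
        rfl
    rw [hl v h, hl v' h'] at e
    exact (cancel_epi _).mp e
  rw [← IsOpenImmersion.lift_fac U.ι v (hr v h), key, IsOpenImmersion.lift_fac]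

/-- Morphisms into an affine open exist for all ring homomorphisms. -/
theorem exists_appLE_eq {T S : Scheme.{u}} {U : S.Opens} (hU : IsAffineOpen U)
    (φ : Γ(S, U) ⟶ Γ(T, ⊤)) : ∃ (v : T ⟶ S) (h : ⊤ ≤ v ⁻¹ᵁ U), v.appLE U ⊤ h = φ := by
  refine ⟨T.toSpecΓ ≫ Spec.map φ ≫ hU.fromSpec, ?_, ?_⟩
  · rw [Scheme.Hom.comp_preimage, Scheme.Hom.comp_preimage, hU.fromSpec_preimage_self]
    simp
  · rw [← Scheme.Hom.appLE_comp_appLE T.toSpecΓ (Spec.map φ ≫ hU.fromSpec) U ⊤ ⊤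
      (by rw [Scheme.Hom.comp_preimage, hU.fromSpec_preimage_self]; simp) (by simp),
      ← Scheme.Hom.appLE_comp_appLE (Spec.map φ) hU.fromSpec U ⊤ ⊤
      (by rw [hU.fromSpec_preimage_self]) (by simp), fromSpec_appLE_self]
    have h1 : (Spec.map φ).appLE ⊤ ⊤ (by simp) = (Spec.map φ).appTop := by
      rw [Scheme.Hom.appTop, ← Scheme.Hom.appLE_eq_app]; rfl
    have h2 : T.toSpecΓ.appLE ⊤ ⊤ (by simp) = T.toSpecΓ.appTop := by
      rw [Scheme.Hom.appTop, ← Scheme.Hom.appLE_eq_app]; rfl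
    rw [h1, h2, Scheme.toSpecΓ_appTop, Category.assoc, ← Scheme.ΓSpecIso_inv_naturality_assoc]
    simp

section Eval

variable {T : Scheme.{u}} (v : T ⟶ affineBlowup I J hJI hJ) {q : T ⟶ P}
  (hq : v ≫ affineBlowupMap I J hJI hJ = q) (U : P.affineOpens) (h : ⊤ ≤ q ⁻¹ᵁ U.1)

/-- The evaluation of elements of the affine blow-up algebra at a point of the affine blow-up with
values in `T`. -/
noncomputable def evalHom : BlowupSections I J hJI U →ₐ[Γ(P, U.1)] SectionsOver q U h where
  __ := (v.appLE (affineBlowupMap I J hJI hJ ⁻¹ᵁ U.1) ⊤ (by subst hq; exact h)).hom.comp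
    (sectionsEquiv (hJI := hJI) hJ U).toRingHom
  commutes' a := by
    change (v.appLE _ _ _).hom (sectionsEquiv (hJI := hJI) hJ U _) = (q.appLE U.1 ⊤ h).hom a
    rw [sectionsEquiv_algebraMap, ← RingHom.comp_apply, ← CommRingCat.hom_comp]
    subst hq
    rw [← Scheme.Hom.appLE_eq_app, Scheme.Hom.appLE_comp_appLE]

theorem evalHom_apply (z : BlowupSections I J hJI U) :
    evalHom hJ v hq U h z =
      (v.appLE (affineBlowupMap I J hJI hJ ⁻¹ᵁ U.1) ⊤ (by subst hq; exact h)).hom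
        (sectionsEquiv hJ U z) := rfl

/-- A point of the affine blow-up over `U` is determined by its evaluation map. -/
theorem evalHom_injective {v v' : T ⟶ affineBlowup I J hJI hJ}
    (hq : v ≫ affineBlowupMap I J hJI hJ = q) (hq' : v' ≫ affineBlowupMap I J hJI hJ = q)
    (e : evalHom hJ v hq U h = evalHom hJ v' hq' U h) : v = v' := by
  refine eq_of_appLE_eq (U.2.preimage (affineBlowupMap I J hJI hJ)) (by subst hq; exact h)
    (by subst hq'; exact h) ?_
  ext z
  obtain ⟨z, rfl⟩ := (sectionsEquiv hJ U).surjective z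
  exact DFunLike.congr_fun e z

/-- Every algebra map from the affine blow-up algebra is the evaluation map of a point. -/
theorem evalHom_surjective (φ : BlowupSections I J hJI U →ₐ[Γ(P, U.1)] SectionsOver q U h) :
    ∃ (v : T ⟶ affineBlowup I J hJI hJ) (hq : v ≫ affineBlowupMap I J hJI hJ = q),
      evalHom hJ v hq U h = φ := by
  let ψ : Γ(affineBlowup I J hJI hJ, affineBlowupMap I J hJI hJ ⁻¹ᵁ U.1) →+* Γ(T, ⊤) :=
    φ.toRingHom.comp (sectionsEquiv hJ U).symm.toRingHom
  obtain ⟨v, hv, e⟩ := exists_appLE_eq (U.2.preimage (affineBlowupMap I J hJI hJ))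
    (CommRingCat.ofHom ψ)
  refine ⟨v, eq_of_appLE_eq U.2 hv h ?_, AlgHom.ext fun z ↦ ?_⟩
  · rw [← Scheme.Hom.appLE_comp_appLE v (affineBlowupMap I J hJI hJ) U.1
      (affineBlowupMap I J hJI hJ ⁻¹ᵁ U.1) ⊤ le_rfl hv, e, Scheme.Hom.appLE_eq_app]
    ext a
    change φ ((sectionsEquiv hJ U).symm (((affineBlowupMap I J hJI hJ).app U.1).hom a)) = _
    rw [← sectionsEquiv_algebraMap, RingEquiv.symm_apply_apply]
    exact φ.commutes a
  · rw [evalHom_apply, e]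
    exact congrArg φ ((sectionsEquiv hJ U).symm_apply_apply z)

/-- Evaluation maps are compatible with base change and with restriction to smaller opens. -/
theorem evalHom_blowupRes {T' : Scheme.{u}} (k : T' ⟶ T) {q' : T' ⟶ P}
    (hq' : (k ≫ v) ≫ affineBlowupMap I J hJI hJ = q') {V : P.affineOpens} (hVU : V.1 ≤ U.1)
    (h' : ⊤ ≤ q' ⁻¹ᵁ V.1) (z : BlowupSections I J hJI U) :
    evalHom hJ (k ≫ v) hq' V h' (blowupRes I J hJI hVU z) =
      k.appTop.hom (evalHom hJ v hq U h z) := by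
  rw [evalHom_apply, evalHom_apply, sectionsEquiv_blowupRes, ← RingHom.comp_apply,
    ← CommRingCat.hom_comp, Scheme.Hom.map_appLE]
  subst hq hq'
  rw [← Scheme.Hom.appLE_comp_appLE k v (affineBlowupMap I J hJI hJ ⁻¹ᵁ U.1) ⊤ ⊤ h
    (by simp), Scheme.Hom.appTop, ← Scheme.Hom.appLE_eq_app]
  rfl

end Eval

end AffineBlowup

end ParamDeformation

/-! ### Adapted coordinates on the product over the base -/

namespace ParamDeformation

theorem mem_basicOpen_iff_notMem_primeIdealOf {P : Scheme.{u}} {U : P.Opens} (hU : IsAffineOpen U)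
    (x : U) (a : Γ(P, U)) : x.1 ∈ P.basicOpen a ↔ a ∉ (hU.primeIdealOf x).asIdeal := by
  rw [← PrimeSpectrum.mem_basicOpen, ← hU.fromSpec_preimage_basicOpen]
  change x.1 ∈ _ ↔ hU.fromSpec (hU.primeIdealOf x) ∈ P.basicOpen a
  rw [hU.fromSpec_primeIdealOf]

namespace DeformationDatum

variable {B : Scheme.{u}} (S : DeformationDatum B)

/-- An affine open of `Y ×_B W` on which adapted coordinates exist: it lies over an affine open of
`W` on which `Z` is defined by a nonzerodivisor `g`, and `X` is defined in it by `g` and part of a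
coordinate system relative to `W`. -/
structure AdaptedOpen (V : (pullback S.y S.w).affineOpens) where
  /-- The affine open of `W`. -/
  base : S.W.affineOpens
  le : V.1 ≤ pullback.snd S.y S.w ⁻¹ᵁ base.1
  /-- The equation of `Z`. -/
  g : Γ(S.W, base.1)
  g_mem : g ∈ nonZeroDivisors Γ(S.W, base.1)
  ideal_eq : S.i.ker.ideal base = Ideal.span {g}
  /-- The coordinates. -/
  coords : letI := ((pullback.snd S.y S.w).appLE base.1 V.1 le).hom.toAlgebra
    AdaptedCoordinates Γ(S.W, base.1) Γ(pullback S.y S.w, V.1) (S.centerIdeal.ideal V) g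

/-- Adapted opens exist around all points of the center, and can be chosen as basic opens of a given
affine open. -/
theorem exists_adaptedOpen (hZ : IsEffectiveCartier S.i.ker) (U : (pullback S.y S.w).affineOpens)
    (x : S.X) (hx : S.f x ∈ U.1) :
    ∃ (r : Γ(pullback S.y S.w, U.1)) (V : (pullback S.y S.w).affineOpens),
      V.1 = (pullback S.y S.w).basicOpen r ∧ S.f x ∈ V.1 ∧ Nonempty (S.AdaptedOpen V) := by
  obtain ⟨U₀, hxU₀, g, hg, hgZ⟩ := hZ (S.i (S.ψ x))
  have hcomm (x : S.X) : pullback.snd S.y S.w (S.f x) = S.i (S.ψ x) := by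
    rw [← Scheme.Hom.comp_apply, ← Scheme.Hom.comp_apply, S.comm]
  obtain ⟨r₀, hr₀, hxr₀⟩ := U.2.exists_basicOpen_le
    (V := pullback.snd S.y S.w ⁻¹ᵁ U₀.1) ⟨S.f x, by
      change pullback.snd S.y S.w (S.f x) ∈ U₀.1
      rwa [hcomm]⟩ hx
  let U₁ := (pullback S.y S.w).affineBasicOpen r₀
  have h₁ : U₁.1 ≤ pullback.snd S.y S.w ⁻¹ᵁ U₀.1 := hr₀
  have h₂ : S.f ⁻¹ᵁ U₁.1 ≤ S.ψ ⁻¹ᵁ S.i ⁻¹ᵁ U₀.1 := by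
    rw [← Scheme.Hom.comp_preimage, ← S.comm, Scheme.Hom.comp_preimage]
    exact S.f.preimage_mono h₁
  have h₃ : S.f ⁻¹ᵁ U₁.1 ≤ (S.ψ ≫ S.i) ⁻¹ᵁ U₀.1 := h₂
  let algCA := ((pullback.snd S.y S.w).appLE U₀.1 U₁.1 h₁).hom.toAlgebra
  let algCC' := (S.i.app U₀.1).hom.toAlgebra
  let algAE := (S.f.app U₁.1).hom.toAlgebra
  let algC'E := (S.ψ.appLE (S.i ⁻¹ᵁ U₀.1) (S.f ⁻¹ᵁ U₁.1) h₂).hom.toAlgebra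
  let algCE := ((S.ψ ≫ S.i).appLE U₀.1 (S.f ⁻¹ᵁ U₁.1) h₃).hom.toAlgebra
  have t₁ : IsScalarTower Γ(S.W, U₀.1) Γ(pullback S.y S.w, U₁.1) Γ(S.X, S.f ⁻¹ᵁ U₁.1) := by
    refine .of_algebraMap_eq' ?_
    change ((S.ψ ≫ S.i).appLE U₀.1 (S.f ⁻¹ᵁ U₁.1) h₃).hom = RingHom.comp (S.f.app U₁.1).hom
      ((pullback.snd S.y S.w).appLE U₀.1 U₁.1 h₁).hom
    rw [← CommRingCat.hom_comp, ← Scheme.Hom.appLE_eq_app, Scheme.Hom.appLE_comp_appLE]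
    simp only [S.comm]
  have t₂ : IsScalarTower Γ(S.W, U₀.1) Γ(S.Z, S.i ⁻¹ᵁ U₀.1) Γ(S.X, S.f ⁻¹ᵁ U₁.1) := by
    refine .of_algebraMap_eq' ?_
    change ((S.ψ ≫ S.i).appLE U₀.1 (S.f ⁻¹ᵁ U₁.1) h₃).hom =
      RingHom.comp (S.ψ.appLE (S.i ⁻¹ᵁ U₀.1) (S.f ⁻¹ᵁ U₁.1) h₂).hom (S.i.app U₀.1).hom
    rw [← CommRingCat.hom_comp, ← Scheme.Hom.appLE_eq_app, Scheme.Hom.appLE_comp_appLE]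
  have s₁ : Algebra.Smooth Γ(S.W, U₀.1) Γ(pullback S.y S.w, U₁.1) :=
    (pullback.snd S.y S.w).smooth_appLE U₀.2 U₁.2 h₁
  have s₂ : Algebra.Smooth Γ(S.Z, S.i ⁻¹ᵁ U₀.1) Γ(S.X, S.f ⁻¹ᵁ U₁.1) :=
    S.ψ.smooth_appLE (U₀.2.preimage S.i) (U₁.2.preimage S.f) h₂
  let p := (U₁.2.primeIdealOf ⟨S.f x, hxr₀⟩).asIdeal
  have hIp : S.centerIdeal.ideal U₁ ≤ p := by
    intro a ha
    by_contra h
    replace h := (mem_basicOpen_iff_notMem_primeIdealOf U₁.2 ⟨S.f x, hxr₀⟩ a).mpr h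
    have ha' : (S.f.app U₁.1).hom a = 0 := by
      rwa [centerIdeal, Scheme.Hom.ker_apply, RingHom.mem_ker] at ha
    have h' : x ∈ S.f ⁻¹ᵁ (pullback S.y S.w).basicOpen a := h
    rw [Scheme.Hom.preimage_basicOpen] at h'
    erw [ha', Scheme.basicOpen_zero] at h'
    exact h'
  obtain ⟨r, hrp, hr⟩ := exists_adaptedCoordinates (C := Γ(S.W, U₀.1))
    (A := Γ(pullback S.y S.w, U₁.1)) (C' := Γ(S.Z, S.i ⁻¹ᵁ U₀.1)) (E := Γ(S.X, S.f ⁻¹ᵁ U₁.1))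
    (S.i.app_surjective _ U₀.2) (S.f.app_surjective _ U₁.2) (S.centerIdeal.ideal U₁)
    (S.f.ker_apply U₁).symm g ((S.i.ker_apply U₀).symm.trans hgZ) p hIp
  replace hrp := (mem_basicOpen_iff_notMem_primeIdealOf U₁.2 ⟨S.f x, hxr₀⟩ r).mpr hrp
  obtain ⟨r', hr'⟩ := U.2.basicOpen_basicOpen_is_basicOpen r₀ r
  obtain ⟨V, hV⟩ : ∃ V : (pullback S.y S.w).affineOpens, V.1 = (pullback S.y S.w).basicOpen r :=
    ⟨(pullback S.y S.w).affineBasicOpen (U := U₁) r, rfl⟩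
  have hle : V.1 ≤ U₁.1 := hV.le.trans ((pullback S.y S.w).basicOpen_le r)
  refine ⟨r', V, hV.trans hr'.symm, hV ▸ hrp, ?_⟩
  let algAAr := ((pullback S.y S.w).presheaf.map (homOfLE hle).op).hom.toAlgebra
  let algCAr := ((pullback.snd S.y S.w).appLE U₀.1 V.1 (hle.trans h₁)).hom.toAlgebra
  have t₃ : IsScalarTower Γ(S.W, U₀.1) Γ(pullback S.y S.w, U₁.1) Γ(pullback S.y S.w, V.1) := by
    refine .of_algebraMap_eq' ?_
    change ((pullback.snd S.y S.w).appLE U₀.1 V.1 (hle.trans h₁)).hom =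
      RingHom.comp ((pullback S.y S.w).presheaf.map (homOfLE hle).op).hom
        ((pullback.snd S.y S.w).appLE U₀.1 U₁.1 h₁).hom
    rw [← CommRingCat.hom_comp, Scheme.Hom.appLE_map]
  have : IsLocalization.Away r Γ(pullback S.y S.w, V.1) :=
    U₁.2.isLocalization_of_eq_basicOpen r _ hV
  obtain ⟨a⟩ := hr Γ(pullback S.y S.w, V.1)
  have e : (S.centerIdeal.ideal U₁).map (algebraMap Γ(pullback S.y S.w, U₁.1)
      Γ(pullback S.y S.w, V.1)) = S.centerIdeal.ideal V := S.centerIdeal.map_ideal hle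
  exact ⟨⟨U₀, hle.trans h₁, g, hg, hgZ, e ▸ a⟩⟩

namespace AdaptedOpen

variable {S} {V : (pullback S.y S.w).affineOpens} (a : S.AdaptedOpen V)

/-- The equation of the divisor. -/
noncomputable def eqn : Γ(pullback S.y S.w, V.1) :=
  ((pullback.snd S.y S.w).appLE a.base.1 V.1 a.le).hom a.g

theorem divisorIdeal_eq_span : S.divisorIdeal.ideal V = Ideal.span {a.eqn} := by
  rw [divisorIdeal_eq, comap_ideal_eq_map _ _ _ _ a.le, a.ideal_eq, Ideal.map_span,
    Set.image_singleton, eqn]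

include a

theorem exists_linearEquiv_conormal : ∃ n : ℕ, Nonempty (
    S.conormal.obj V ≃ₗ[Γ(pullback S.y S.w, V.1)]
    (Fin n → Γ(pullback S.y S.w, V.1) ⧸ S.centerIdeal.ideal V)) := by
  let := ((pullback.snd S.y S.w).appLE a.base.1 V.1 a.le).hom.toAlgebra
  exact ⟨_, a.coords.nonempty_linearEquiv_conormal _ a.divisorIdeal_eq_span⟩

/-- The affine blow-up algebra is smooth over `W`. Moreover, the center is defined by the equation
of the divisor and functions `x i` such that algebra maps from the affine blow-up algebra to
algebras killed by the ideal of the center take arbitrary values on the quotients `t i` of `x i` by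
the equation of the divisor. -/
theorem smooth_and_exists_lift :
    ((toBlowupSections S.centerIdeal S.divisorIdeal S.divisorIdeal_le V).comp
      ((pullback.snd S.y S.w).appLE a.base.1 V.1 a.le).hom).Smooth ∧
    ∃ (n : ℕ) (x : Fin n → Γ(pullback S.y S.w, V.1))
      (t : Fin n → BlowupSections S.centerIdeal S.divisorIdeal S.divisorIdeal_le V),
      S.centerIdeal.ideal V = Ideal.span {a.eqn} ⊔ Ideal.span (Set.range x) ∧
      (∀ i, algebraMap _ _ a.eqn * t i = algebraMap _ _ (x i)) ∧
      ∀ (O : Type u) [CommRing O] [Algebra Γ(pullback S.y S.w, V.1) O],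
        (∀ b ∈ S.centerIdeal.ideal V, algebraMap _ O b = 0) → ∀ o : Fin n → O,
          ∃ φ : BlowupSections S.centerIdeal S.divisorIdeal S.divisorIdeal_le V
            →ₐ[Γ(pullback S.y S.w, V.1)] O, ∀ i, φ (t i) = o i := by
  let algCA := ((pullback.snd S.y S.w).appLE a.base.1 V.1 a.le).hom.toAlgebra
  let algCBl : Algebra Γ(S.W, a.base.1)
      (BlowupSections S.centerIdeal S.divisorIdeal S.divisorIdeal_le V) :=
    ((toBlowupSections S.centerIdeal S.divisorIdeal S.divisorIdeal_le V).comp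
      ((pullback.snd S.y S.w).appLE a.base.1 V.1 a.le).hom).toAlgebra
  have : IsScalarTower Γ(S.W, a.base.1) Γ(pullback S.y S.w, V.1)
      (BlowupSections S.centerIdeal S.divisorIdeal S.divisorIdeal_le V) :=
    .of_algebraMap_eq' rfl
  have : Algebra.Smooth Γ(S.W, a.base.1) Γ(pullback S.y S.w, V.1) :=
    (pullback.snd S.y S.w).smooth_appLE a.base.2 V.2 a.le
  have : IsLocalization.Away (algebraMap Γ(S.W, a.base.1) Γ(pullback S.y S.w, V.1) a.g)
      (ComplSections S.divisorIdeal V) := isLocalization_complSections V _ a.divisorIdeal_eq_span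
  obtain ⟨h1, t, h2, h3⟩ := a.coords.smooth_and_exists_lift a.g_mem (ComplSections S.divisorIdeal V)
    (BlowupSections S.centerIdeal S.divisorIdeal S.divisorIdeal_le V)
    (algebraMap_complSections_injective _ _ _ V) (fun s ↦ by
      refine Iff.trans ?_ (mem_blowupAlgebra_iff S.centerIdeal S.divisorIdeal S.divisorIdeal_le V
        a.eqn a.divisorIdeal_eq_span s)
      exact ⟨by rintro ⟨z, rfl⟩; exact z.2, fun h ↦ ⟨⟨s, h⟩, rfl⟩⟩)
  exact ⟨h1, _, a.coords.x, t, a.coords.span_eq, h2, h3⟩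

end AdaptedOpen

theorem isLocallyFree_conormal (hZ : IsEffectiveCartier S.i.ker) :
    S.conormal.IsLocallyFree S.f := by
  intro x
  obtain ⟨_, ⟨U, hU, rfl⟩, hxU, -⟩ :=
    (pullback S.y S.w).isBasis_affineOpens.exists_subset_of_mem_open
      (Set.mem_univ (S.f x)) isOpen_univ
  obtain ⟨r, V, -, hxV, ⟨a⟩⟩ := S.exists_adaptedOpen hZ ⟨U, hU⟩ x hxU
  exact ⟨V, hxV, a.exists_linearEquiv_conormal⟩

end DeformationDatum

end ParamDeformation

/-! ### Complement, fibre, smoothness and regularity of the deformation -/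

namespace ParamDeformation

theorem BlowupPresentation.sum_smul_divS_eq_algebraMap {A K Bl ι : Type*} [CommRing A] [CommRing K]
    [Algebra A K] [CommRing Bl] [Algebra A Bl] [Algebra Bl K] [IsScalarTower A Bl K] {I J : Ideal A}
    [Fintype ι] (P : BlowupPresentation (K := K) Bl I J ι) (x : I) :
    ∑ k, (P.j k : A) • P.divS k x = algebraMap A Bl x := by
  have h := congrArg (algebraMap A K) P.sum_mulS
  simp only [map_sum, map_one, P.algebraMap_mulS] at h
  refine P.injective ?_
  rw [map_sum, ← IsScalarTower.algebraMap_apply A Bl K, ← mul_one (algebraMap A K x), ← h,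
    Finset.mul_sum]
  refine Finset.sum_congr rfl fun k _ ↦ ?_
  rw [Algebra.smul_def, map_mul, ← IsScalarTower.algebraMap_apply A Bl K, P.algebraMap_divS]
  ring

/-- A point of the affine blow-up lying over the divisor lies over the center, scheme-theoretically:
the ideal of the center is generated by the equation of the divisor on the affine blow-up. -/
theorem centerIdeal_le_ker_comp {P T : Scheme.{u}} {I J : P.IdealSheafData} {hJI : J ≤ I}
    (hJ : IsEffectiveCartier J) (v : T ⟶ affineBlowup I J hJI hJ)
    [QuasiCompact (v ≫ affineBlowupMap I J hJI hJ)]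
    (h : J ≤ (v ≫ affineBlowupMap I J hJI hJ).ker) : I ≤ (v ≫ affineBlowupMap I J hJI hJ).ker := by
  intro U x hx
  obtain ⟨ι, _, ⟨E⟩⟩ := hJ.exists_blowupPresentation I hJI U
  have key (a : Γ(P, U.1)) : ((v ≫ affineBlowupMap I J hJI hJ).app U.1).hom a =
      (v.app _).hom (sectionsEquiv hJ U (algebraMap _ _ a)) := by
    rw [sectionsEquiv_algebraMap, Scheme.Hom.comp_app]
    rfl
  have h0 (a) (ha : a ∈ J.ideal U) :
      (v.app _).hom (sectionsEquiv hJ U (algebraMap _ (BlowupSections I J hJI U) a)) = 0 := by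
    rw [← key]
    have := h U ha
    rwa [Scheme.Hom.ker_apply, RingHom.mem_ker] at this
  rw [Scheme.Hom.ker_apply, RingHom.mem_ker, key, ← E.sum_smul_divS_eq_algebraMap ⟨x, hx⟩, map_sum,
    map_sum]
  refine Finset.sum_eq_zero fun k _ ↦ ?_
  rw [Algebra.smul_def, map_mul, map_mul, h0 _ (E.j k).2]
  exact zero_mul _

namespace DeformationDatum

variable {B : Scheme.{u}} (S : DeformationDatum B) (hZ : IsEffectiveCartier S.i.ker)

theorem complement_divisorIdeal : complement S.divisorIdeal = pullback.snd S.y S.w ⁻¹ᵁ S.offZ := by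
  ext x
  change ¬ x ∈ (S.divisorIdeal.support : Set _) ↔ ¬ pullback.snd S.y S.w x ∈ Set.range S.i
  have h : (S.i.ker.support : Set S.W) = Set.range S.i := by
    rw [Scheme.Hom.support_ker, S.i.isClosedEmbedding.isClosed_range.closure_eq]
  rw [divisorIdeal_eq, Scheme.IdealSheafData.support_comap, ← h]
  rfl

/-- The blow-down is an isomorphism over the complement of the divisor. -/
theorem isIso_blowdown_restrict :
    IsIso (S.blowdown hZ ∣_ (pullback.snd S.y S.w ⁻¹ᵁ S.offZ)) := by
  rw [← complement_divisorIdeal]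
  exact isIso_affineBlowupMap_complement (isEffectiveCartier_divisorIdeal hZ)

/-- Over `W ∖ Z` the deformation is the projection from `Y ×_B (W ∖ Z)`, because the blow-down is an
isomorphism there. -/
theorem exists_iso_offZ :
    ∃ e : (S.π hZ ⁻¹ᵁ S.offZ).toScheme ≅ pullback S.y (S.offZ.ι ≫ S.w),
      e.hom ≫ pullback.snd S.y (S.offZ.ι ≫ S.w) = S.π hZ ∣_ S.offZ ∧
      e.hom ≫ pullback.fst S.y (S.offZ.ι ≫ S.w) =
        (S.π hZ ⁻¹ᵁ S.offZ).ι ≫ S.blowdown hZ ≫ pullback.fst S.y S.w := by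
  have hiso := S.isIso_blowdown_restrict hZ
  have pb := (isPullback_morphismRestrict (pullback.snd S.y S.w) S.offZ).flip.paste_horiz
    (IsPullback.of_hasPullback S.y S.w)
  refine ⟨@asIso _ _ _ _ _ hiso ≪≫ pb.isoPullback, ?_, ?_⟩
  · rw [Iso.trans_hom, Category.assoc, pb.isoPullback_hom_snd]
    exact (morphismRestrict_comp (S.blowdown hZ) (pullback.snd S.y S.w) S.offZ).symm
  · rw [Iso.trans_hom, Category.assoc, pb.isoPullback_hom_fst]
    exact morphismRestrict_ι_assoc (S.blowdown hZ) _ _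

theorem quasiCompact_fiber :
    QuasiCompact (pullback.fst (S.π hZ) S.i ≫ S.blowdown hZ) := by
  have : IsAffineHom (S.blowdown hZ) := inferInstanceAs (IsAffineHom (affineBlowupMap ..))
  infer_instance

theorem centerIdeal_le_ker_fiber :
    S.f.ker ≤ (pullback.fst (S.π hZ) S.i ≫ S.blowdown hZ).ker := by
  refine @centerIdeal_le_ker_comp _ _ _ _ _ (isEffectiveCartier_divisorIdeal hZ)
    (pullback.fst (S.π hZ) S.i) (S.quasiCompact_fiber hZ) ?_
  change S.divisorIdeal ≤ (pullback.fst (S.π hZ) S.i ≫ S.blowdown hZ).ker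
  rw [divisorIdeal_eq, ← Scheme.IdealSheafData.le_map_iff_comap_le, ← Scheme.Hom.ker_comp,
    Category.assoc]
  change _ ≤ (pullback.fst (S.π hZ) S.i ≫ S.π hZ).ker
  rw [pullback.condition]
  exact Scheme.Hom.le_ker_comp _ _

/-- The morphism `π⁻¹(Z) ⟶ X` induced by the blow-down. -/
noncomputable def fiberMap : pullback (S.π hZ) S.i ⟶ S.X :=
  IsClosedImmersion.lift S.f (pullback.fst (S.π hZ) S.i ≫ S.blowdown hZ)
    (S.centerIdeal_le_ker_fiber hZ)

theorem fiberMap_f :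
    S.fiberMap hZ ≫ S.f = pullback.fst (S.π hZ) S.i ≫ S.blowdown hZ :=
  IsClosedImmersion.lift_fac _ _ _

theorem fiberMap_ψ : S.fiberMap hZ ≫ S.ψ = pullback.snd (S.π hZ) S.i := by
  rw [← cancel_mono S.i, Category.assoc, ← S.comm, ← Category.assoc, fiberMap_f, Category.assoc,
    ← pullback.condition]
  rfl

variable {S} in
/-- The deformation is smooth over `W` on the preimage of an adapted open, where it is the spectrum
of the affine blow-up algebra. -/
theorem AdaptedOpen.smooth_comp_π {V : (pullback S.y S.w).affineOpens} (a : S.AdaptedOpen V) :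
    Smooth ((S.blowdown hZ ⁻¹ᵁ V.1).ι ≫ S.π hZ) := by
  obtain ⟨ι, hι, h1, h2⟩ : ∃ (ι : Spec (.of (BlowupSections S.centerIdeal S.divisorIdeal
      S.divisorIdeal_le V)) ⟶ S.space hZ) (_ : IsOpenImmersion ι),
      S.blowdown hZ ⁻¹ᵁ V.1 = ι.opensRange ∧ ι ≫ S.blowdown hZ = Spec.map (CommRingCat.ofHom
        (toBlowupSections S.centerIdeal S.divisorIdeal S.divisorIdeal_le V)) ≫ V.2.fromSpec :=
    exists_isOpenImmersion_affineBlowup S.centerIdeal S.divisorIdeal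
    S.divisorIdeal_le (isEffectiveCartier_divisorIdeal hZ) V
  rw [h1, ← Scheme.Hom.isoOpensRange_inv_comp ι, Category.assoc]
  have hb : IsAffineOpen a.base.1 := a.base.2
  have e : ι ≫ S.π hZ = Spec.map (CommRingCat.ofHom ((toBlowupSections S.centerIdeal
      S.divisorIdeal S.divisorIdeal_le V).comp
      ((pullback.snd S.y S.w).appLE a.base.1 V.1 a.le).hom)) ≫ hb.fromSpec := by
    have e1 : ι ≫ S.π hZ = _ ≫ pullback.snd S.y S.w :=
      (Category.assoc _ _ _).symm.trans (congrArg (· ≫ pullback.snd S.y S.w) h2)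
    rw [e1, CommRingCat.ofHom_comp, Spec.map_comp, Category.assoc, Category.assoc]
    congr 1
    exact (IsAffineOpen.SpecMap_appLE_fromSpec _ hb V.2 a.le).symm
  have : Smooth (Spec.map (CommRingCat.ofHom ((toBlowupSections S.centerIdeal
      S.divisorIdeal S.divisorIdeal_le V).comp
      ((pullback.snd S.y S.w).appLE a.base.1 V.1 a.le).hom))) :=
    (HasRingHomProperty.Spec_iff (P := @Smooth.{u})).mpr a.smooth_and_exists_lift.1
  have : Smooth hb.fromSpec := inferInstance
  have : Smooth (ι ≫ S.π hZ) := e ▸ smooth_comp _ _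
  infer_instance

/-- The deformation is smooth over `W`: away from `Z` it is a base change of `Y`, and the points
over `Z` lie over the center, where adapted coordinates exist. -/
theorem smooth_π : Smooth (S.π hZ) := by
  have : IsZariskiLocalAtSource @Smooth.{u} :=
    HasRingHomProperty.instIsZariskiLocalAtSource (Q := RingHom.Smooth)
  refine (IsZariskiLocalAtSource.iff_of_iSup_eq_top (P := @Smooth.{u})
    (fun O : {O : (S.space hZ).Opens // Smooth (O.ι ≫ S.π hZ)} ↦ O.1) ?_).mpr fun O ↦ O.2
  rw [eq_top_iff]
  rintro s -
  rw [Opens.mem_iSup]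
  by_cases hs : S.π hZ s ∈ S.offZ
  · refine ⟨⟨S.blowdown hZ ⁻¹ᵁ (pullback.snd S.y S.w ⁻¹ᵁ S.offZ), ?_⟩, hs⟩
    have := S.isIso_blowdown_restrict hZ
    rw [π, ← morphismRestrict_ι_assoc]
    infer_instance
  · have hs' : s ∈ S.π hZ ⁻¹' Set.range S.i := not_not.mp hs
    rw [← Scheme.Pullback.range_fst] at hs'
    obtain ⟨τ, rfl⟩ := hs'
    have hx : S.f (S.fiberMap hZ τ) = S.blowdown hZ (pullback.fst (S.π hZ) S.i τ) := by
      rw [← Scheme.Hom.comp_apply, fiberMap_f, Scheme.Hom.comp_apply]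
    obtain ⟨_, ⟨U, hU, rfl⟩, hxU, -⟩ :=
      (pullback S.y S.w).isBasis_affineOpens.exists_subset_of_mem_open
        (Set.mem_univ (S.f (S.fiberMap hZ τ))) isOpen_univ
    obtain ⟨r, V, -, hxV, ⟨a⟩⟩ := S.exists_adaptedOpen hZ ⟨U, hU⟩ _ hxU
    refine ⟨⟨S.blowdown hZ ⁻¹ᵁ V.1, a.smooth_comp_π hZ⟩, ?_⟩
    rw [hx] at hxV
    exact hxV

theorem isFinitelyPresented_π (hy : IsFinitelyPresented S.y) : IsFinitelyPresented (S.π hZ) := by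
  have := S.smooth_π hZ
  have : IsAffineHom (S.blowdown hZ) := inferInstanceAs (IsAffineHom (affineBlowupMap ..))
  obtain ⟨_, _, _⟩ := hy
  refine ⟨inferInstance, ?_, ?_⟩
  · rw [π]; infer_instance
  · rw [π]; infer_instance

instance : IsClosedImmersion S.divisorι :=
  MorphismProperty.of_isPullback S.isPullback_divisorι.flip inferInstance

instance : IsClosedImmersion S.toDivisor := by
  have : IsClosedImmersion (S.toDivisor ≫ S.divisorι) := by
    rw [toDivisor_divisorι]; infer_instance
  exact IsClosedImmersion.of_comp _ S.divisorι

/-- The closed immersion of `X` into the divisor is always regular, as both are smooth over `Z`: in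
adapted coordinates, the ideal is generated by the coordinates `x`, which form a regular sequence
modulo the equation of the divisor. -/
theorem isRegularImmersion_toDivisor (hZ : IsEffectiveCartier S.i.ker) :
    IsRegularImmersion S.toDivisor := by
  refine ⟨inferInstance, fun x ↦ ?_⟩
  obtain ⟨_, ⟨U, hU, rfl⟩, hxU, -⟩ :=
    (pullback S.y S.w).isBasis_affineOpens.exists_subset_of_mem_open
      (Set.mem_univ (S.f x)) isOpen_univ
  obtain ⟨r, V, -, hxV, ⟨a⟩⟩ := S.exists_adaptedOpen hZ ⟨U, hU⟩ x hxU
  let V' : (pullback S.y (S.i ≫ S.w)).affineOpens := ⟨S.divisorι ⁻¹ᵁ V.1, V.2.preimage S.divisorι⟩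
  have hxV' : S.toDivisor x ∈ V'.1 := by
    change S.divisorι (S.toDivisor x) ∈ V.1
    rwa [← Scheme.Hom.comp_apply, toDivisor_divisorι]
  let ρ : Γ(pullback S.y S.w, V.1) →+* Γ(pullback S.y (S.i ≫ S.w), V'.1) := (S.divisorι.app V.1).hom
  have hρ : Function.Surjective ρ := S.divisorι.app_surjective _ V.2
  have hker : RingHom.ker ρ = Ideal.span {a.eqn} := by
    rw [← a.divisorIdeal_eq_span, divisorIdeal, Scheme.Hom.ker_apply]
  let algCA := ((pullback.snd S.y S.w).appLE a.base.1 V.1 a.le).hom.toAlgebra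
  have : Algebra.Smooth Γ(S.W, a.base.1) Γ(pullback S.y S.w, V.1) :=
    (pullback.snd S.y S.w).smooth_appLE a.base.2 V.2 a.le
  have hreg := isWeaklyRegular_map_of_cons ρ hρ a.eqn _ hker (a.coords.isWeaklyRegular a.g_mem)
  have hI : S.toDivisor.ker.ideal V' = Ideal.ofList ((List.ofFn a.coords.x).map ρ) := by
    have h1 : (S.toDivisor.ker.ideal V').comap ρ = S.centerIdeal.ideal V := by
      rw [centerIdeal, ← S.toDivisor_divisorι, Scheme.Hom.ker_apply, Scheme.Hom.ker_apply,
        RingHom.comap_ker, Scheme.Hom.comp_app]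
      rfl
    have h0 : ρ a.eqn = 0 := by
      rw [← RingHom.mem_ker, hker]
      exact Ideal.mem_span_singleton_self _
    rw [← Ideal.map_comap_of_surjective ρ hρ (S.toDivisor.ker.ideal V'), h1]
    refine (congrArg (Ideal.map ρ) a.coords.span_eq).trans ?_
    rw [Ideal.map_sup, Ideal.map_span, Ideal.map_span, Set.image_singleton]
    erw [h0]
    rw [Ideal.span_singleton_zero, bot_sup_eq, Ideal.ofList]
    congr 1
    ext z
    simp
  refine ⟨V', hxV', _, ⟨hreg, fun h ↦ ?_⟩, hI⟩
  rw [smul_eq_mul, Ideal.mul_top, ← hI, Scheme.Hom.ker_apply] at h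
  have h1 : (1 : Γ(pullback S.y (S.i ≫ S.w), V'.1)) ∈ RingHom.ker (S.toDivisor.app V'.1).hom :=
    h ▸ Submodule.mem_top
  rw [RingHom.mem_ker, map_one] at h1
  have : Nonempty (S.toDivisor ⁻¹ᵁ V'.1) := ⟨⟨x, hxV'⟩⟩
  exact one_ne_zero h1

end DeformationDatum
end ParamDeformation

/-! ### Restriction to smaller affine opens -/

namespace ParamDeformation

open scoped TensorProduct

theorem isUnit_algebraMap_end {R N : Type*} (R' : Type*) [CommRing R] [CommRing R'] [Algebra R R']
    (r : R) [IsLocalization.Away r R'] [AddCommGroup N]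
    [Module R N] [Module R' N] [IsScalarTower R R' N]
    (x : Submonoid.powers r) : IsUnit (algebraMap R (Module.End R N) x) := by
  rw [Module.End.isUnit_iff]
  have := (Module.End.isUnit_iff _).mp
    ((IsLocalization.map_units R' x).map (algebraMap R' (Module.End R' N)))
  convert this using 1
  funext n
  exact (algebraMap_smul R' (x : R) n).symm

/-- A semilinear map over a localisation `R ⟶ R'` extends to a linear map on the localised module.
-/
theorem exists_linearMap_of_localization {R R' M M' N' : Type*} [CommRing R] [CommRing R']
    [AddCommGroup M] [Module R M] [AddCommGroup M'] [Module R' M'] [AddCommGroup N'] [Module R' N']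
    {ρ : R →+* R'} (r : R) (hr : letI := ρ.toAlgebra; IsLocalization.Away r R')
    (res : M →ₛₗ[ρ] M') (hsurj : ∀ c : M', ∃ (m : ℕ) (y : M), res y = ρ r ^ m • c)
    (hinj : ∀ y : M, res y = 0 → ∃ m : ℕ, r ^ m • y = 0) (δ : M →ₛₗ[ρ] N') :
    ∃ δ' : M' →ₗ[R'] N', ∀ y, δ' (res y) = δ y := by
  let := ρ.toAlgebra
  let : Module R M' := Module.compHom M' ρ
  let : Module R N' := Module.compHom N' ρ
  have : IsScalarTower R R' M' := .of_algebraMap_smul fun _ _ ↦ rfl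
  have : IsScalarTower R R' N' := .of_algebraMap_smul fun _ _ ↦ rfl
  let ι : M →ₗ[R] M' := ⟨⟨res, res.map_add⟩, fun a x ↦ res.map_smulₛₗ a x⟩
  let d : M →ₗ[R] N' := ⟨⟨δ, δ.map_add⟩, fun a x ↦ δ.map_smulₛₗ a x⟩
  have hι : IsLocalizedModule (.powers r) ι :=
    { map_units := isUnit_algebraMap_end R' r
      surj := fun c ↦ by
        obtain ⟨m, y, e⟩ := hsurj c
        refine ⟨⟨y, ⟨_, m, rfl⟩⟩, ?_⟩
        refine Eq.trans ?_ e.symm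
        rw [← map_pow]
        rfl
      exists_of_eq := fun {x₁ x₂} e ↦ by
        obtain ⟨m, hm⟩ := hinj (x₁ - x₂) ((map_sub res _ _).trans (sub_eq_zero.mpr e))
        exact ⟨⟨_, m, rfl⟩, sub_eq_zero.mp ((smul_sub (r ^ m) x₁ x₂).symm.trans hm)⟩ }
  refine ⟨(IsLocalizedModule.lift (.powers r) ι d
    (isUnit_algebraMap_end R' r)).extendScalarsOfIsLocalization (.powers r) R', fun y ↦ ?_⟩
  exact IsLocalizedModule.lift_apply (.powers r) ι d (isUnit_algebraMap_end R' r) y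

section Restriction

variable {P : Scheme.{u}} {I J : P.IdealSheafData} {hJI : J ≤ I}

/-- The restriction of sections of an ideal sheaf to a smaller affine open. -/
noncomputable def idealRes (J : P.IdealSheafData) {U V : P.affineOpens} (h : V.1 ≤ U.1) :
    J.ideal U →ₛₗ[(P.presheaf.map (homOfLE h).op).hom] J.ideal V :=
  (idealModule J).res h

/-- The restriction of sections of `I / (I ^ 2 + J)` to a smaller affine open. -/
noncomputable def conormalRes (I J : P.IdealSheafData) {U V : P.affineOpens} (h : V.1 ≤ U.1) :
    (I.ideal U ⧸ conormalKernel (I.ideal U) (J.ideal U))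
      →ₛₗ[(P.presheaf.map (homOfLE h).op).hom]
        (I.ideal V ⧸ conormalKernel (I.ideal V) (J.ideal V)) :=
  (conormalModule I J).res h

theorem conormalRes_mk (I J : P.IdealSheafData) {U V : P.affineOpens} (h : V.1 ≤ U.1)
    (x : I.ideal U) : conormalRes I J h (Submodule.Quotient.mk x) =
      Submodule.Quotient.mk (idealRes I h x) := rfl

/-- The ideal sheaf on a smaller affine open `V` is generated by restrictions of sections over `U`.
-/
theorem idealRes_induction (J : P.IdealSheafData) {U V : P.affineOpens} (h : V.1 ≤ U.1)
    {p : J.ideal V → Prop} (hres : ∀ a, p (idealRes J h a)) (zero : p 0)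
    (add : ∀ x y, p x → p y → p (x + y)) (smul : ∀ (c : Γ(P, V.1)) x, p x → p (c • x))
    (a : J.ideal V) : p a := by
  obtain ⟨a, ha⟩ := a
  have e := J.map_ideal (U := V) (V := U) h
  have ha' : a ∈ (J.ideal U).map (P.presheaf.map (homOfLE h).op).hom := e ▸ ha
  induction ha' using Submodule.span_induction with
  | mem a h1 =>
    obtain ⟨a, ha₀, rfl⟩ := h1
    exact hres ⟨a, ha₀⟩
  | zero => exact zero
  | add x y hx hy h1 h2 => exact add ⟨x, e ▸ hx⟩ ⟨y, e ▸ hy⟩ (h1 _) (h2 _)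
  | smul c x hx h1 => exact smul c ⟨x, e ▸ hx⟩ (h1 _)

/-- The restriction of a presentation of the affine blow-up algebra to a smaller affine open. -/
theorem BlowupPresentation.exists_restrict (hJ : IsEffectiveCartier J) {U V : P.affineOpens}
    (h : V.1 ≤ U.1) {ι : Type*} [Fintype ι] (E : BlowupPresentation (K := ComplSections J U)
      (BlowupSections I J hJI U) (I.ideal U) (J.ideal U) ι) :
    ∃ E' : BlowupPresentation (K := ComplSections J V)
      (BlowupSections I J hJI V) (I.ideal V) (J.ideal V) ι,
      (∀ k a, E'.mulS k (idealRes J h a) =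
        (P.presheaf.map (homOfLE h).op).hom (E.mulS k a)) ∧
      ∀ k x, E'.divS k (idealRes I h x) = blowupRes I J hJI h (E.divS k x) := by
  let κ : ComplSections J U →+* ComplSections J V :=
    (P.presheaf.map (homOfLE (inf_le_inf_right (complement J) h)).op).hom
  have hκ (a : Γ(P, U.1)) : κ (algebraMap _ _ a) =
      algebraMap Γ(P, V.1) _ ((P.presheaf.map (homOfLE h).op).hom a) := (resCompl_res h a).symm
  have hκ' (z : BlowupSections I J hJI U) : κ (algebraMap _ _ z) =
      algebraMap _ _ (blowupRes I J hJI h z) := rfl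
  have hmul (k : ι) (a : J.ideal U) : algebraMap Γ(P, V.1) (ComplSections J V)
      (idealRes J h a).1 * κ (E.s k) =
      algebraMap _ _ ((P.presheaf.map (homOfLE h).op).hom (E.mulS k a)) := by
    rw [← hκ, E.algebraMap_mulS, map_mul, hκ]
    rfl
  have hs (k : ι) (a) (ha : a ∈ J.ideal V) : ∃ b, algebraMap Γ(P, V.1) (ComplSections J V) b =
      algebraMap _ _ a * κ (E.s k) := by
    refine idealRes_induction J h (p := fun a ↦ ∃ b, algebraMap Γ(P, V.1) (ComplSections J V) b =
      algebraMap _ _ a.1 * κ (E.s k)) (fun a ↦ ⟨_, (hmul k a).symm⟩) ⟨0, by simp⟩ ?_ ?_ ⟨a, ha⟩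
    · rintro x y ⟨b, hb⟩ ⟨c, hc⟩
      exact ⟨b + c, by rw [map_add, hb, hc, Submodule.coe_add, map_add, add_mul]⟩
    · rintro c x ⟨b, hb⟩
      exact ⟨c * b, by rw [map_mul, hb, Submodule.coe_smul, smul_eq_mul, map_mul, mul_assoc]⟩
  obtain ⟨E', hj, hs'⟩ := ParamDeformation.exists_blowupPresentation (I.ideal V) (J.ideal V)
    (algebraMap_complSections_injective I J hJI V) (algebraMap_injective_complSections hJ V)
    (mem_range_algebraMap_complSections_iff I J hJI V)
    (fun k ↦ idealRes J h (E.j k)) (fun k ↦ κ (E.s k)) hs (by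
      simp only [hmul, ← map_sum, E.sum_mulS, map_one])
  refine ⟨E', fun k a ↦ E'.injective' ?_, fun k x ↦ E'.injective ?_⟩
  · rw [E'.algebraMap_mulS, hs']
    exact hmul k a
  · rw [E'.algebraMap_divS, hs', ← hκ', E.algebraMap_divS, map_mul, hκ]
    rfl

/-- Contraction commutes with base change. -/
theorem BlowupPresentation.contract_map {T T' : Scheme.{u}} {q : T ⟶ P} {q' : T' ⟶ P} (k : T' ⟶ T)
    (hk : k ≫ q = q') {U V : P.affineOpens} (hVU : V.1 ≤ U.1) (h : ⊤ ≤ q ⁻¹ᵁ U.1)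
    (h' : ⊤ ≤ q' ⁻¹ᵁ V.1) {ι : Type*} [Fintype ι] (E : BlowupPresentation (K := ComplSections J U)
      (BlowupSections I J hJI U) (I.ideal U) (J.ideal U) ι)
    (E' : BlowupPresentation (K := ComplSections J V)
      (BlowupSections I J hJI V) (I.ideal V) (J.ideal V) ι) (l : ι)
    (hE : ∀ a, E'.mulS l (idealRes J hVU a) =
        (P.presheaf.map (homOfLE hVU).op).hom (E.mulS l a))
    (w : SectionsOver q U h ⊗[Γ(P, U.1)] J.ideal U) :
    E'.contract (SectionsOver q' V h') l
      (TensorProduct.map (SectionsOver.map k hk hVU h h') (idealRes J hVU) w) =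
      SectionsOver.map k hk hVU h h' (E.contract (SectionsOver q U h) l w) := by
  induction w using TensorProduct.induction_on with
  | zero => simp only [map_zero]
  | add w w' h1 h2 => simp only [map_add, h1, h2]
  | tmul w a =>
    rw [TensorProduct.map_tmul, E.contract_tmul, E'.contract_tmul, hE, LinearMap.map_smulₛₗ]

end Restriction

end ParamDeformation

/-! ### Lifting and base change of differences -/

namespace ParamDeformation

open scoped TensorProduct

section Lifting

variable {A K Bl ι : Type*} [CommRing A] [CommRing K] [CommRing Bl] [Algebra A K] [Algebra A Bl]
  [Algebra Bl K] [IsScalarTower A Bl K] [Fintype ι] {O : Type*} [CommRing O] [Algebra A O]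
  {I J : Ideal A}

theorem exists_eq_tmul_of_eq_span {g : A} (hg : J = Ideal.span {g}) (hgJ : g ∈ J) (w : O ⊗[A] J) :
    ∃ o : O, o ⊗ₜ[A] (⟨g, hgJ⟩ : J) = w := by
  induction w using TensorProduct.induction_on with
  | zero => exact ⟨0, TensorProduct.zero_tmul _ _⟩
  | add w w' h h' =>
    obtain ⟨o, rfl⟩ := h
    obtain ⟨o', rfl⟩ := h'
    exact ⟨o + o', TensorProduct.add_tmul _ _ _⟩
  | tmul o a =>
    obtain ⟨c, hc⟩ := Ideal.mem_span_singleton'.mp (hg.le a.2)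
    refine ⟨c • o, ?_⟩
    rw [TensorProduct.smul_tmul]
    exact congrArg _ (Subtype.ext hc)

/-- If algebra maps from the affine blow-up algebra take arbitrary values on the quotients `t i` of
the generators `x i` of `I` by the generator `g` of `J`, then every homomorphism is a difference. -/
theorem BlowupPresentation.exists_isDifference_of_lift
    (P : BlowupPresentation Bl (K := K) I J ι) (hO : ∀ x ∈ I, algebraMap A O x = 0) (hJI : J ≤ I)
    {g : A} (hg : J = Ideal.span {g}) {n : ℕ} (x : Fin n → A) (t : Fin n → Bl)
    (hI : I = Ideal.span {g} ⊔ Ideal.span (Set.range x))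
    (ht : ∀ i, algebraMap A Bl g * t i = algebraMap A Bl (x i))
    (hlift : ∀ o : Fin n → O, ∃ φ : Bl →ₐ[A] O, ∀ i, φ (t i) = o i) (φ : Bl →ₐ[A] O)
    (δ : (I ⧸ conormalKernel I J) →ₗ[A] O ⊗[A] J) : ∃ φ' : Bl →ₐ[A] O, IsDifference φ φ' δ := by
  have hgJ : g ∈ J := hg ▸ Ideal.mem_span_singleton_self g
  have hx (i) : x i ∈ I := hI ▸ Ideal.mem_sup_right (Ideal.subset_span ⟨i, rfl⟩)
  choose o ho using fun i ↦ exists_eq_tmul_of_eq_span hg hgJ (δ (Submodule.Quotient.mk ⟨x i, hx i⟩))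
  obtain ⟨φ', hφ'⟩ := hlift fun i ↦ φ (t i) + o i
  obtain ⟨δ', hδ'⟩ := P.exists_isDifference hO hJI φ φ'
  suffices δ' = δ from ⟨φ', this ▸ hδ'⟩
  ext ⟨z, hz⟩
  change δ' (Submodule.Quotient.mk _) = δ (Submodule.Quotient.mk _)
  have hz' := hz
  rw [hI, ← Ideal.span_union] at hz'
  have hle : Ideal.span ({g} ∪ Set.range x) ≤ I := by rw [Ideal.span_union, ← hI]
  induction hz' using Submodule.span_induction with
  | mem z h =>
    obtain rfl | ⟨i, rfl⟩ := h
    · have h0 : (Submodule.Quotient.mk ⟨z, hz⟩ : I ⧸ conormalKernel I J) = 0 :=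
        (Submodule.Quotient.mk_eq_zero _).mpr (Ideal.mem_sup_right hgJ)
      rw [h0, map_zero, map_zero]
    · rw [← hδ' (t i) ⟨g, hgJ⟩ ⟨x i, hz⟩ (ht i), hφ', add_sub_cancel_left, ho]
  | zero =>
    have h0 : (Submodule.Quotient.mk ⟨0, hz⟩ : I ⧸ conormalKernel I J) = 0 :=
      (Submodule.Quotient.mk_eq_zero _).mpr (zero_mem _)
    rw [h0, map_zero, map_zero]
  | add a b ha hb h1 h2 =>
    have h0 : (Submodule.Quotient.mk ⟨a + b, hz⟩ : I ⧸ conormalKernel I J) =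
      Submodule.Quotient.mk ⟨a, hle ha⟩ + Submodule.Quotient.mk ⟨b, hle hb⟩ := rfl
    rw [h0, map_add, map_add, h1, h2]
  | smul c a ha h1 =>
    have h0 : (Submodule.Quotient.mk ⟨c • a, hz⟩ : I ⧸ conormalKernel I J) =
      c • Submodule.Quotient.mk ⟨a, hle ha⟩ := rfl
    rw [h0, map_smul, map_smul, h1]

end Lifting

section Differences

variable {P : Scheme.{u}} {I J : P.IdealSheafData} {hJI : J ≤ I}

/-- To check that a homomorphism is a difference over `V ⊆ U`, sections over `U` suffice. -/
theorem isDifference_iff_idealRes {U V : P.affineOpens} (hVU : V.1 ≤ U.1) {ι : Type*} [Fintype ι]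
    (E : BlowupPresentation (K := ComplSections J U)
      (BlowupSections I J hJI U) (I.ideal U) (J.ideal U) ι)
    (E' : BlowupPresentation (K := ComplSections J V)
      (BlowupSections I J hJI V) (I.ideal V) (J.ideal V) ι)
    (hE : ∀ k x, E'.divS k (idealRes I hVU x) = blowupRes I J hJI hVU (E.divS k x))
    {O : Type*} [CommRing O] [Algebra Γ(P, V.1) O] (φ φ' : BlowupSections I J hJI V →ₐ[Γ(P, V.1)] O)
    (δ : (I.ideal V ⧸ conormalKernel (I.ideal V) (J.ideal V)) →ₗ[Γ(P, V.1)]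
      O ⊗[Γ(P, V.1)] J.ideal V) :
    IsDifference φ φ' δ ↔ ∀ k x, φ' (blowupRes I J hJI hVU (E.divS k x)) =
      φ (blowupRes I J hJI hVU (E.divS k x)) +
        E'.contract O k (δ (Submodule.Quotient.mk (idealRes I hVU x))) := by
  rw [E'.isDifference_iff]
  refine forall_congr' fun k ↦ ⟨fun h x ↦ by rw [← hE, h], fun h x ↦ ?_⟩
  have hadd (x y : I.ideal V) : (Submodule.Quotient.mk (x + y) :
    I.ideal V ⧸ conormalKernel (I.ideal V) (J.ideal V)) =
      Submodule.Quotient.mk x + Submodule.Quotient.mk y := rfl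
  have hsmul (c : Γ(P, V.1)) (x : I.ideal V) : (Submodule.Quotient.mk (c • x) :
    I.ideal V ⧸ conormalKernel (I.ideal V) (J.ideal V)) = c • Submodule.Quotient.mk x := rfl
  induction x using idealRes_induction I hVU with
  | hres x => rw [hE, h]
  | zero => simp
  | add x y h1 h2 => simp only [map_add, hadd, h1, h2]; ring
  | smul c x h1 => simp only [map_smul, hsmul, h1, smul_add]

/-- Base change of differences. -/
theorem IsDifference.restrict (hJ : IsEffectiveCartier J) {T T' : Scheme.{u}} {q : T ⟶ P}
    {q' : T' ⟶ P} (k : T' ⟶ T) (hk : k ≫ q = q') {U V : P.affineOpens} (hVU : V.1 ≤ U.1)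
    (h : ⊤ ≤ q ⁻¹ᵁ U.1) (h' : ⊤ ≤ q' ⁻¹ᵁ V.1) {v v' : T ⟶ affineBlowup I J hJI hJ}
    {hv : v ≫ affineBlowupMap I J hJI hJ = q} {hv' : v' ≫ affineBlowupMap I J hJI hJ = q}
    {δ : (I.ideal U ⧸ conormalKernel (I.ideal U) (J.ideal U)) →ₗ[Γ(P, U.1)]
      SectionsOver q U h ⊗[Γ(P, U.1)] J.ideal U}
    {δ' : (I.ideal V ⧸ conormalKernel (I.ideal V) (J.ideal V)) →ₗ[Γ(P, V.1)]
      SectionsOver q' V h' ⊗[Γ(P, V.1)] J.ideal V}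
    (hδ : IsDifference (evalHom hJ v hv U h) (evalHom hJ v' hv' U h) δ)
    (hδ' : ∀ x, δ' (conormalRes I J hVU x) =
      TensorProduct.map (SectionsOver.map k hk hVU h h') (idealRes J hVU) (δ x))
    (e : (k ≫ v) ≫ affineBlowupMap I J hJI hJ = q')
    (e' : (k ≫ v') ≫ affineBlowupMap I J hJI hJ = q') :
    IsDifference (evalHom hJ (k ≫ v) e V h') (evalHom hJ (k ≫ v') e' V h') δ' := by
  obtain ⟨ι, _, ⟨E⟩⟩ := hJ.exists_blowupPresentation I hJI U
  obtain ⟨E', h1, h2⟩ := E.exists_restrict hJ hVU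
  rw [isDifference_iff_idealRes hVU E E' h2]
  intro l x
  rw [evalHom_blowupRes hJ v hv U h k e hVU h', evalHom_blowupRes hJ v' hv' U h k e' hVU h',
    ← conormalRes_mk, hδ', E.contract_map k hk hVU h h' E' l (h1 l), (E.isDifference_iff.mp hδ) l x]
  exact map_add k.appTop.hom _ _

/-- Homomorphisms from the conormal module over `U` extend to smaller basic opens. -/
theorem exists_linearMap_conormalRes (hJ : IsEffectiveCartier J) {U V : P.affineOpens}
    (r : Γ(P, U.1)) (hV : V.1 = P.basicOpen r) (hVU : V.1 ≤ U.1) {N : Type*} [AddCommGroup N]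
    [Module Γ(P, V.1) N] (δ : (I.ideal U ⧸ conormalKernel (I.ideal U) (J.ideal U))
      →ₛₗ[(P.presheaf.map (homOfLE hVU).op).hom] N) :
    ∃ δ' : (I.ideal V ⧸ conormalKernel (I.ideal V) (J.ideal V)) →ₗ[Γ(P, V.1)] N,
      ∀ x, δ' (conormalRes I J hVU x) = δ x := by
  let ρ := (P.presheaf.map (homOfLE hVU).op).hom
  have hr : letI := ρ.toAlgebra; IsLocalization.Away r Γ(P, V.1) :=
    U.2.isLocalization_of_eq_basicOpen r _ hV
  have hloc := (localization_of_eq_basicOpen hJ r hV hVU).1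
  refine exists_linearMap_of_localization r hr (conormalRes I J hVU) (fun c ↦ ?_) (fun y hy ↦ ?_) δ
  · obtain ⟨⟨x, hx⟩, rfl⟩ := Submodule.Quotient.mk_surjective _ c
    obtain ⟨m, y, hy, e⟩ := hloc (I.ideal U) x ((I.map_ideal (U := V) (V := U) hVU).ge hx)
    refine ⟨m, Submodule.Quotient.mk ⟨y, hy⟩, ?_⟩
    rw [conormalRes_mk, ← Submodule.Quotient.mk_smul]
    exact congrArg _ (Subtype.ext e)
  · obtain ⟨⟨x, hx⟩, rfl⟩ := Submodule.Quotient.mk_surjective _ y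
    rw [conormalRes_mk, Submodule.Quotient.mk_eq_zero] at hy
    have hy' : ρ x ∈ (I.ideal U ^ 2 ⊔ J.ideal U).map ρ := by
      rw [Ideal.map_sup, Ideal.map_pow]
      erw [I.map_ideal (U := V) (V := U) hVU, J.map_ideal (U := V) (V := U) hVU]
      exact hy
    obtain ⟨m, c, hc, e⟩ := hloc _ _ hy'
    let := ρ.toAlgebra
    obtain ⟨⟨_, l, rfl⟩, e'⟩ := (IsLocalization.eq_iff_exists (.powers r) Γ(P, V.1)).mp
      (e.trans (by rw [← map_pow]; exact (map_mul ρ _ _).symm) :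
        algebraMap Γ(P, U.1) _ c = algebraMap _ _ (r ^ m * x))
    refine ⟨l + m, ?_⟩
    rw [← Submodule.Quotient.mk_smul, Submodule.Quotient.mk_eq_zero]
    change r ^ (l + m) * x ∈ I.ideal U ^ 2 ⊔ J.ideal U
    rw [pow_add, mul_assoc, ← e']
    exact Ideal.mul_mem_left _ _ hc

end Differences

end ParamDeformation

/-! ### The torsor structure on the fibre over the center -/

namespace ParamDeformation

open scoped TensorProduct

variable {X P : Scheme.{u}} {f : X ⟶ P} {J : P.IdealSheafData} {hJI : J ≤ f.ker}

/-- Locally around the points of the center, and on basic opens of any given affine open, the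
divisor is defined by a function `g` and the center by `g` and further functions `x i`, such that
algebra maps from the affine blow-up algebra to algebras killed by the ideal of the center take
arbitrary values on the quotients `t i` of `x i` by `g`. -/
def HasLocalLifts (f : X ⟶ P) (J : P.IdealSheafData) (hJI : J ≤ f.ker) : Prop :=
  ∀ (U : P.affineOpens) (z : X), f z ∈ U.1 → ∃ (r : Γ(P, U.1)) (V : P.affineOpens),
    V.1 = P.basicOpen r ∧ f z ∈ V.1 ∧
    ∃ (g : Γ(P, V.1)) (n : ℕ) (x : Fin n → Γ(P, V.1)) (t : Fin n → BlowupSections f.ker J hJI V),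
      J.ideal V = Ideal.span {g} ∧ f.ker.ideal V = Ideal.span {g} ⊔ Ideal.span (Set.range x) ∧
      (∀ i, algebraMap _ _ g * t i = algebraMap _ _ (x i)) ∧
      ∀ (O : Type u) [CommRing O] [Algebra Γ(P, V.1) O],
        (∀ b ∈ f.ker.ideal V, algebraMap _ O b = 0) → ∀ o : Fin n → O,
          ∃ φ : BlowupSections f.ker J hJI V →ₐ[Γ(P, V.1)] O, ∀ i, φ (t i) = o i

theorem algebraMap_sectionsOver_eq_zero [QuasiCompact f] {T : Scheme.{u}} (t : T ⟶ X)
    (U : P.affineOpens) (h : ⊤ ≤ (t ≫ f) ⁻¹ᵁ U.1) (a : Γ(P, U.1)) (ha : a ∈ f.ker.ideal U) :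
    algebraMap Γ(P, U.1) (SectionsOver (t ≫ f) U h) a = 0 := by
  rw [Scheme.Hom.ker_apply, RingHom.mem_ker] at ha
  change ((t ≫ f).appLE U.1 ⊤ h).hom a = 0
  rw [← Scheme.Hom.appLE_comp_appLE t f U.1 (f ⁻¹ᵁ U.1) ⊤ le_rfl h, CommRingCat.hom_comp,
    RingHom.comp_apply, Scheme.Hom.appLE_eq_app, ha, map_zero]

theorem SectionsOver.map_algebraMap {T T' : Scheme.{u}} {q : T ⟶ P} {q' : T' ⟶ P} (k : T' ⟶ T)
    (hk : k ≫ q = q') {U V : P.affineOpens} (hVU : V.1 ≤ U.1) (h : ⊤ ≤ q ⁻¹ᵁ U.1)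
    (h' : ⊤ ≤ q' ⁻¹ᵁ V.1) (a : Γ(P, U.1)) :
    SectionsOver.map k hk hVU h h' (algebraMap _ _ a) =
      algebraMap _ _ ((P.presheaf.map (homOfLE hVU).op).hom a) := by
  have e := (SectionsOver.map k hk hVU h h').map_smulₛₗ a 1
  have h1 : SectionsOver.map k hk hVU h h' 1 = 1 := map_one k.appTop.hom
  rwa [h1, Algebra.smul_def, mul_one, Algebra.smul_def, mul_one] at e

/-- Every homomorphism is the difference of a given point of the affine blow-up over the center and
another one. Prescribing the second point on the generators of the affine blow-up algebra is
consistent, because this may be checked locally, where coordinates are available. -/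
theorem exists_isDifference_evalHom [QuasiCompact f] (hJ : IsEffectiveCartier J)
    (hf : HasLocalLifts f J hJI) {T : Scheme.{u}} [IsAffine T] (t : T ⟶ X) (U : P.affineOpens)
    (h : ⊤ ≤ (t ≫ f) ⁻¹ᵁ U.1) (v : T ⟶ affineBlowup f.ker J hJI hJ)
    (hv : v ≫ affineBlowupMap f.ker J hJI hJ = t ≫ f)
    (δ : (f.ker.ideal U ⧸ conormalKernel (f.ker.ideal U) (J.ideal U)) →ₗ[Γ(P, U.1)]
      SectionsOver (t ≫ f) U h ⊗[Γ(P, U.1)] J.ideal U) :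
    ∃ (v' : T ⟶ affineBlowup f.ker J hJI hJ)
      (hv' : v' ≫ affineBlowupMap f.ker J hJI hJ = t ≫ f),
      IsDifference (evalHom hJ v hv U h) (evalHom hJ v' hv' U h) δ := by
  obtain ⟨ι, _, ⟨E⟩⟩ := hJ.exists_blowupPresentation f.ker hJI U
  let φ := evalHom hJ v hv U h
  let F : MvPolynomial (ι × f.ker.ideal U) Γ(P, U.1) →ₐ[Γ(P, U.1)] SectionsOver (t ≫ f) U h :=
    MvPolynomial.aeval fun z ↦ φ (E.divS z.1 z.2) +
      E.contract _ z.1 (δ (Submodule.Quotient.mk z.2))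
  let G : MvPolynomial (ι × f.ker.ideal U) Γ(P, U.1) →ₐ[Γ(P, U.1)] BlowupSections f.ker J hJI U :=
    MvPolynomial.aeval fun z ↦ E.divS z.1 z.2
  have hG : Function.Surjective G := by
    rw [← AlgHom.range_eq_top, ← Algebra.adjoin_range_eq_range_aeval]
    exact E.adjoin_eq_top
  -- near every point of `T`, the map `F` factors over the algebra map `ψ` given by coordinates
  have hker : RingHom.ker G.toRingHom ≤ RingHom.ker F.toRingHom := by
    intro z hz
    replace hz : G z = 0 := hz
    change F z = 0
    refine eq_zero_of_basicOpen (P := T) ⊤ (F z) fun τ _ ↦ ?_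
    have hτ : f (t τ) ∈ U.1 := by
      rw [← Scheme.Hom.comp_apply]
      exact h (Opens.mem_top τ)
    obtain ⟨r, V, hV, hτV, g, n, x, s, hg, hI, hs, hlift⟩ := hf U (t τ) hτ
    have hVU : V.1 ≤ U.1 := hV.le.trans (P.basicOpen_le r)
    rw [← Scheme.Hom.comp_apply] at hτV
    obtain ⟨T', hT', hτT', hT'V⟩ : ∃ T' : T.Opens, IsAffineOpen T' ∧ τ ∈ T' ∧
        T' ≤ (t ≫ f) ⁻¹ᵁ V.1 := by
      obtain ⟨_, ⟨T', hT', rfl⟩, hτT', hT'V⟩ :=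
        T.isBasis_affineOpens.exists_subset_of_mem_open (a := τ) (u := (t ≫ f) ⁻¹ᵁ V.1) hτV
          ((t ≫ f) ⁻¹ᵁ V.1).2
      exact ⟨T', hT', hτT', hT'V⟩
    have : IsAffine T' := hT'
    have h' : ⊤ ≤ ((T'.ι ≫ t) ≫ f) ⁻¹ᵁ V.1 := by
      rintro y -
      rw [Category.assoc]
      exact hT'V y.2
    have hk : T'.ι ≫ t ≫ f = (T'.ι ≫ t) ≫ f := (Category.assoc _ _ _).symm
    have hkv : (T'.ι ≫ v) ≫ affineBlowupMap f.ker J hJI hJ = (T'.ι ≫ t) ≫ f := by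
      rw [Category.assoc, hv, hk]
    obtain ⟨E', h1, h2⟩ := E.exists_restrict hJ hVU
    have hO := algebraMap_sectionsOver_eq_zero (T'.ι ≫ t) V h'
    obtain ⟨δ', hδ'⟩ := exists_linearMap_conormalRes (I := f.ker) hJ r hV hVU
      ((TensorProduct.map (SectionsOver.map T'.ι hk hVU h h') (idealRes J hVU)).comp δ)
    obtain ⟨ψ, hψ⟩ := E'.exists_isDifference_of_lift hO (hJI V) hg x s hI hs (hlift _ hO)
      (evalHom hJ (T'.ι ≫ v) hkv V h') δ'
    rw [isDifference_iff_idealRes hVU E E' h2] at hψ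
    let σ : SectionsOver (t ≫ f) U h →+* SectionsOver ((T'.ι ≫ t) ≫ f) V h' := T'.ι.appTop.hom
    have key : σ.comp F.toRingHom =
        (ψ.toRingHom.comp (blowupRes f.ker J hJI hVU)).comp G.toRingHom := by
      refine MvPolynomial.ringHom_ext (fun a ↦ ?_) fun ⟨l, y⟩ ↦ ?_
      · change σ (F (algebraMap _ _ a)) = ψ (blowupRes _ _ _ hVU (G (algebraMap _ _ a)))
        rw [F.commutes, G.commutes, blowupRes_algebraMap, ψ.commutes]
        exact SectionsOver.map_algebraMap T'.ι hk hVU h h' a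
      · change σ (F (.X _)) = ψ (blowupRes _ _ _ hVU (G (.X _)))
        rw [MvPolynomial.aeval_X, MvPolynomial.aeval_X, hψ, ← conormalRes_mk, hδ',
          LinearMap.comp_apply, E.contract_map T'.ι hk hVU h h' E' l (h1 l),
          evalHom_blowupRes hJ v hv U h T'.ι hkv hVU h', map_add]
        rfl
    refine ⟨T'.ι ''ᵁ ⊤, le_top, ⟨⟨τ, hτT'⟩, trivial, rfl⟩, ?_⟩
    have e : σ (F z) = ψ (blowupRes _ _ _ hVU (G z)) := RingHom.congr_fun key z
    rw [hz, map_zero, map_zero] at e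
    refine Eq.trans ?_ e
    change _ = T'.ι.appTop.hom (F z)
    rw [Scheme.Opens.ι_appTop]
    rfl
  obtain ⟨v', hv', e⟩ := evalHom_surjective hJ U h (AlgHom.liftOfSurjective G hG F hker)
  refine ⟨v', hv', E.isDifference_iff.mpr fun l y ↦ ?_⟩
  have h1 : G (.X (l, y)) = E.divS l y := MvPolynomial.aeval_X _ _
  have h2 : F (.X (l, y)) = _ := MvPolynomial.aeval_X _ _
  rw [e, ← h1, AlgHom.liftOfSurjective_apply, h2, h1]

section Torsor

variable {hJ : IsEffectiveCartier J} {V : Scheme.{u}} {m : V ⟶ affineBlowup f.ker J hJI hJ}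
  {p : V ⟶ X}

theorem comp_affineBlowupMap_of_lift (pb : IsPullback m p (affineBlowupMap f.ker J hJI hJ) f)
    {T : Scheme.{u}} (t : T ⟶ X) (v : LiftsOf p t) :
    (v.1 ≫ m) ≫ affineBlowupMap f.ker J hJI hJ = t ≫ f := by
  rw [Category.assoc, pb.w, ← Category.assoc, v.2]

/-- The point `w` of the fibre of the affine blow-up over the center is the translate of the point
`v` by `δ`. -/
def IsTranslate (pb : IsPullback m p (affineBlowupMap f.ker J hJI hJ) f)
    {T : Scheme.{u}} (t : T ⟶ X) (U : P.affineOpens) (h : ⊤ ≤ (t ≫ f) ⁻¹ᵁ U.1)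
    (δ : HomPoints (conormalModule f.ker J) (idealModule J) (t ≫ f) U h)
    (v w : LiftsOf p t) : Prop :=
  IsDifference (evalHom hJ (v.1 ≫ m) (comp_affineBlowupMap_of_lift pb t v) U h)
    (evalHom hJ (w.1 ≫ m) (comp_affineBlowupMap_of_lift pb t w) U h) δ

/-- The action is well defined: every point has exactly one translate by `δ`. -/
theorem existsUnique_isTranslate [QuasiCompact f] (hf : HasLocalLifts f J hJI)
    (pb : IsPullback m p (affineBlowupMap f.ker J hJI hJ) f)
    {T : Scheme.{u}} [IsAffine T] (t : T ⟶ X) (U : P.affineOpens) (h : ⊤ ≤ (t ≫ f) ⁻¹ᵁ U.1)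
    (δ : HomPoints (conormalModule f.ker J) (idealModule J) (t ≫ f) U h) (v : LiftsOf p t) :
    ∃! w, IsTranslate pb t U h δ v w := by
  obtain ⟨w, hw, H⟩ := exists_isDifference_evalHom hJ hf t U h _
    (comp_affineBlowupMap_of_lift pb t v) δ
  have e : pb.lift w t hw ≫ m = w := pb.lift_fst _ _ _
  refine ⟨⟨pb.lift w t hw, pb.lift_snd _ _ _⟩, ?_, fun w' hw' ↦ ?_⟩
  · simp only [IsTranslate, e]
    exact H
  · obtain ⟨ι, _, ⟨E⟩⟩ := hJ.exists_blowupPresentation f.ker hJI U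
    have := E.eq_of_isDifference H hw'
    refine Subtype.ext (pb.hom_ext ?_ ?_)
    · dsimp only
      rw [e]
      exact (evalHom_injective hJ U h _ _ this).symm
    · dsimp only
      rw [pb.lift_snd, w'.2]

/-- The action is simply transitive: two points over the same point of the center are translates by
exactly one homomorphism. -/
theorem existsUnique_isTranslate_of_liftsOf [QuasiCompact f]
    (pb : IsPullback m p (affineBlowupMap f.ker J hJI hJ) f)
    {T : Scheme.{u}} (t : T ⟶ X) (U : P.affineOpens) (h : ⊤ ≤ (t ≫ f) ⁻¹ᵁ U.1)
    (v w : LiftsOf p t) : ∃! δ, IsTranslate pb t U h δ v w := by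
  obtain ⟨ι, _, ⟨E⟩⟩ := hJ.exists_blowupPresentation f.ker hJI U
  obtain ⟨δ, hδ⟩ := E.exists_isDifference (algebraMap_sectionsOver_eq_zero t U h) (hJI U)
    (evalHom hJ (v.1 ≫ m) (comp_affineBlowupMap_of_lift pb t v) U h)
    (evalHom hJ (w.1 ≫ m) (comp_affineBlowupMap_of_lift pb t w) U h)
  exact ⟨δ, hδ, fun δ' hδ' ↦ E.isDifference_unique hδ' hδ⟩

/-- The torsor is locally trivial for the Zariski topology: local coordinates give sections. -/
theorem exists_section_of_hasLocalLifts [IsClosedImmersion f] (hf : HasLocalLifts f J hJI)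
    (pb : IsPullback m p (affineBlowupMap f.ker J hJI hJ) f) (x : X) :
    ∃ U : X.Opens, x ∈ U ∧ ∃ s : U.toScheme ⟶ V, s ≫ p = U.ι := by
  obtain ⟨_, ⟨U, hU, rfl⟩, hxU, -⟩ := P.isBasis_affineOpens.exists_subset_of_mem_open
    (Set.mem_univ (f x)) isOpen_univ
  obtain ⟨r, V, -, hx, g, n, a, s, -, -, -, hlift⟩ := hf ⟨U, hU⟩ x hxU
  have h : ⊤ ≤ ((f ⁻¹ᵁ V.1).ι ≫ f) ⁻¹ᵁ V.1 := fun y _ ↦ y.2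
  obtain ⟨φ, -⟩ := hlift _ (algebraMap_sectionsOver_eq_zero (f ⁻¹ᵁ V.1).ι V h) 0
  have : IsAffine (f ⁻¹ᵁ V.1) := V.2.preimage f
  obtain ⟨v, hv, -⟩ := evalHom_surjective hJ V h φ
  exact ⟨_, hx, pb.lift v _ hv, pb.lift_snd _ _ _⟩

/-- The fibre over the center of the affine blow-up is a torsor under the vector bundle of
homomorphisms from the conormal sheaf to the ideal sheaf of the divisor. -/
noncomputable def homTorsorOfIsPullback [IsClosedImmersion f] (hf : HasLocalLifts f J hJI)
    (pb : IsPullback m p (affineBlowupMap f.ker J hJI hJ) f) :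
    HomTorsor f (conormalModule f.ker J) (idealModule J) p where
  act t U h δ v := (existsUnique_isTranslate hf pb t U h δ v).choose
  zero_act t U h v := ((existsUnique_isTranslate hf pb t U h 0 v).choose_spec.2 v
    (IsDifference.refl _)).symm
  add_act t U h δ ε v := ((existsUnique_isTranslate hf pb t U h (δ + ε) v).choose_spec.2 _
    (IsDifference.add (existsUnique_isTranslate hf pb t U h ε v).choose_spec.1
      (existsUnique_isTranslate hf pb t U h δ _).choose_spec.1)).symm
  existsUnique_act t U h v w := by
    obtain ⟨δ, hδ, hu⟩ := existsUnique_isTranslate_of_liftsOf pb t U h v w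
    refine ⟨δ, ((existsUnique_isTranslate hf pb t U h δ v).choose_spec.2 _ hδ).symm, ?_⟩
    rintro δ' rfl
    exact hu _ (existsUnique_isTranslate hf pb t U h δ' v).choose_spec.1
  act_restrict {T T'} _ _ t k U V hVU h h' δ δ' H v := by
    let w := (existsUnique_isTranslate hf pb t U h δ v).choose
    have hw : IsTranslate pb t U h δ v w := (existsUnique_isTranslate hf pb t U h δ v).choose_spec.1
    have e (v : LiftsOf p t) : (k ≫ v.1 ≫ m) ≫ affineBlowupMap f.ker J hJI hJ = (k ≫ t) ≫ f := by
      rw [Category.assoc, comp_affineBlowupMap_of_lift pb, Category.assoc]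
    have hw' : IsTranslate pb (k ≫ t) V h' δ' ⟨k ≫ v.1, by rw [Category.assoc, v.2]⟩
        ⟨k ≫ w.1, by rw [Category.assoc, w.2]⟩ := by
      have := IsDifference.restrict hJ k (Category.assoc k t f).symm hVU h h' hw H (e v) (e w)
      simpa only [IsTranslate, Category.assoc] using this
    exact congrArg Subtype.val
      ((existsUnique_isTranslate hf pb (k ≫ t) V h' δ' _).choose_spec.2 _ hw').symm
  exists_section x := exists_section_of_hasLocalLifts hf pb x

end Torsor

end ParamDeformation

/-! ### Trivialization of the twist, and the torsor of the deformation -/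

namespace ParamDeformation

open scoped TensorProduct

theorem SectionsOver.map_congr_apply {P T T' : Scheme.{u}} {L L' : AffineModule P}
    (e : ∀ U : P.affineOpens, L.obj U ≃ₗ[Γ(P, U.1)] L'.obj U)
    (he : ∀ {U V : P.affineOpens} (h : V.1 ≤ U.1) (x : L.obj U), e V (L.res h x) = L'.res h (e U x))
    {q : T ⟶ P} {q' : T' ⟶ P} (k : T' ⟶ T)
    (hk : k ≫ q = q') {U V : P.affineOpens} (hVU : V.1 ≤ U.1) (h : ⊤ ≤ q ⁻¹ᵁ U.1)
    (h' : ⊤ ≤ q' ⁻¹ᵁ V.1) (w : SectionsOver q U h ⊗[Γ(P, U.1)] L.obj U) :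
    TensorProduct.map (SectionsOver.map k hk hVU h h') (L'.res hVU)
        ((e U).toLinearMap.lTensor _ w) =
      (e V).toLinearMap.lTensor _
        (TensorProduct.map (SectionsOver.map k hk hVU h h') (L.res hVU) w) := by
  induction w using TensorProduct.induction_on with
  | zero => simp only [map_zero]
  | add w w' h1 h2 => simp only [map_add, h1, h2]
  | tmul w a =>
    simp only [LinearMap.lTensor_tmul, TensorProduct.map_tmul, LinearEquiv.coe_coe, he]

/-- Transport of a torsor along an isomorphism of the twisting modules. -/
noncomputable def HomTorsor.congr {X P V : Scheme.{u}} {f : X ⟶ P} {C L L' : AffineModule P}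
    {p : V ⟶ X} (H : HomTorsor f C L' p) (e : ∀ U : P.affineOpens, L.obj U ≃ₗ[Γ(P, U.1)] L'.obj U)
    (he : ∀ {U V : P.affineOpens} (h : V.1 ≤ U.1) (x : L.obj U),
      e V (L.res h x) = L'.res h (e U x)) : HomTorsor f C L p where
  act t U h δ v := H.act t U h ((e U).toLinearMap.lTensor _ ∘ₗ δ) v
  zero_act t U h v := by rw [LinearMap.comp_zero, H.zero_act]
  add_act t U h δ ε v := by rw [LinearMap.comp_add, H.add_act]
  existsUnique_act t U h v w := by
    obtain ⟨δ, hδ, hu⟩ := H.existsUnique_act t U h v w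
    have h1 : Function.Injective ((e U).toLinearMap.lTensor (SectionsOver (t ≫ f) U h)) :=
      ((e U).lTensor _).injective
    refine ⟨((e U).symm.toLinearMap.lTensor _) ∘ₗ δ, ?_, fun δ' hδ' ↦ ?_⟩
    · dsimp only
      rw [← LinearMap.comp_assoc, ← LinearMap.lTensor_comp, LinearEquiv.comp_coe,
        LinearEquiv.symm_trans_self, LinearEquiv.refl_toLinearMap, LinearMap.lTensor_id,
        LinearMap.id_comp, hδ]
    · rw [← hu _ hδ', ← LinearMap.comp_assoc, ← LinearMap.lTensor_comp, LinearEquiv.comp_coe,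
        LinearEquiv.self_trans_symm, LinearEquiv.refl_toLinearMap, LinearMap.lTensor_id,
        LinearMap.id_comp]
  act_restrict t k U V hVU h h' δ δ' hδ v := by
    refine H.act_restrict t k U V hVU h h' _ _ (fun x ↦ ?_) v
    rw [LinearMap.comp_apply, LinearMap.comp_apply, hδ, SectionsOver.map_congr_apply e he]
  exists_section := H.exists_section

/-- An ideal sheaf that is generated by a global function on a basis of affine opens is generated
by it on all affine opens. -/
theorem ideal_eq_span_of_locally {P : Scheme.{u}} (J : P.IdealSheafData) (G : Γ(P, ⊤))
    (hG : ∀ x : P, ∀ O : P.Opens, x ∈ O → ∃ V : P.affineOpens, x ∈ V.1 ∧ V.1 ≤ O ∧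
      J.ideal V = Ideal.span {P.presheaf.map (homOfLE le_top).op G}) (U : P.affineOpens) :
    J.ideal U = Ideal.span {P.presheaf.map (homOfLE le_top).op G} := by
  rw [U.2.ideal_ext_iff]
  intro x hx
  obtain ⟨V, hxV, hVU, e⟩ := hG x U.1 hx
  have h1 : P.presheaf.germ U.1 x hx =
      P.presheaf.map (homOfLE hVU).op ≫ P.presheaf.germ V.1 x hxV := by
    rw [TopCat.Presheaf.germ_res]
  rw [h1, CommRingCat.hom_comp, ← Ideal.map_map, ← Ideal.map_map]
  congr 1
  erw [J.map_ideal (U := V) (V := U) hVU]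
  rw [e, Ideal.map_span, Set.image_singleton]
  congr 2
  rw [← RingHom.comp_apply, ← CommRingCat.hom_comp, ← Functor.map_comp]
  rfl

/-- An effective Cartier divisor defined by a global function has a trivial ideal sheaf: the
function is a nonzerodivisor, because it is invertible off the divisor, and functions are
determined there. -/
theorem exists_linearEquiv_structureModule {P : Scheme.{u}} {J : P.IdealSheafData}
    (hJ : IsEffectiveCartier J) (G : Γ(P, ⊤))
    (hG : ∀ U : P.affineOpens, J.ideal U = Ideal.span {P.presheaf.map (homOfLE le_top).op G}) :
    ∃ e : ∀ U : P.affineOpens, (structureModule P).obj U ≃ₗ[Γ(P, U.1)] (idealModule J).obj U,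
      ∀ {U V : P.affineOpens} (h : V.1 ≤ U.1) (x : (structureModule P).obj U),
        e V ((structureModule P).res h x) = (idealModule J).res h (e U x) := by
  have hmem (U : P.affineOpens) : (P.presheaf.map (homOfLE le_top).op).hom G ∈ J.ideal U :=
    hG U ▸ Ideal.mem_span_singleton_self _
  have hbij (U : P.affineOpens) : Function.Bijective (LinearMap.toSpanSingleton Γ(P, U.1)
      (J.ideal U) ⟨_, hmem U⟩) := by
    constructor
    · rw [← LinearMap.ker_eq_bot, LinearMap.ker_eq_bot']
      intro a ha
      replace ha : a * (P.presheaf.map (homOfLE le_top).op).hom G = 0 := congrArg Subtype.val ha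
      have hloc := isLocalization_complSections U _ (hG U)
      refine algebraMap_injective_complSections hJ U ?_
      rw [map_zero]
      refine (IsLocalization.Away.algebraMap_isUnit (S := ComplSections J U)
        (P.presheaf.map (homOfLE (le_top : U.1 ≤ ⊤)).op G)).mul_left_eq_zero.mp ?_
      exact (map_mul _ _ _).symm.trans ((congrArg _ ha).trans (map_zero _))
    · rintro ⟨a, ha⟩
      obtain ⟨c, hc⟩ := Ideal.mem_span_singleton'.mp ((hG U).le ha)
      exact ⟨c, Subtype.ext hc⟩
  refine ⟨fun U ↦ LinearEquiv.ofBijective _ (hbij U), fun {U V} h x ↦ Subtype.ext ?_⟩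
  suffices key : ∀ x : Γ(P, U.1), (P.presheaf.map (homOfLE h).op).hom x *
      (P.presheaf.map (homOfLE le_top).op).hom G = (P.presheaf.map (homOfLE h).op).hom
        (x * (P.presheaf.map (homOfLE le_top).op).hom G) from key x
  intro x
  rw [map_mul]
  congr 1
  rw [← RingHom.comp_apply, ← CommRingCat.hom_comp, ← Functor.map_comp]
  rfl

namespace DeformationDatum

variable {B : Scheme.{u}} (S : DeformationDatum B) (hZ : IsEffectiveCartier S.i.ker)

/-- The fibre of the deformation over `Z` is the fibre of the blow-down over `X`. -/
theorem isPullback_fiberMap :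
    IsPullback (pullback.fst (S.π hZ) S.i) (S.fiberMap hZ) (S.blowdown hZ) S.f := by
  refine ⟨⟨(S.fiberMap_f hZ).symm⟩, ⟨PullbackCone.IsLimit.mk _
    (fun s ↦ pullback.lift s.fst (s.snd ≫ S.ψ) ?_) (fun s ↦ pullback.lift_fst _ _ _)
    (fun s ↦ ?_) (fun s m h1 h2 ↦ ?_)⟩⟩
  · rw [π, ← Category.assoc, s.condition, Category.assoc, Category.assoc, S.comm]
  · rw [← cancel_mono S.f, Category.assoc, fiberMap_f, pullback.lift_fst_assoc, s.condition]
  · rw [← cancel_mono (pullback.fst (S.π hZ) S.i), h1, pullback.lift_fst]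

/-- Adapted coordinates provide local coordinates of the affine blow-up along the center. -/
theorem hasLocalLifts (hZ : IsEffectiveCartier S.i.ker) :
    HasLocalLifts S.f S.divisorIdeal S.divisorIdeal_le := by
  intro U z hz
  obtain ⟨r, V, hV, hzV, ⟨a⟩⟩ := S.exists_adaptedOpen hZ U z hz
  obtain ⟨-, n, x, t, h1, h2, h3⟩ := a.smooth_and_exists_lift
  exact ⟨r, V, hV, hzV, a.eqn, n, x, t, a.divisorIdeal_eq_span, h1, h2, h3⟩

/-- The fibre of the deformation over `Z` is a torsor under the twisted normal bundle. -/
noncomputable def homTorsor :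
    HomTorsor S.f S.conormal (idealModule S.divisorIdeal) (S.fiberMap hZ) :=
  homTorsorOfIsPullback (hJ := isEffectiveCartier_divisorIdeal hZ) (S.hasLocalLifts hZ)
    (S.isPullback_fiberMap hZ)

/-- If `Z` is defined by a global function `g` on `W`, then the divisor is defined by the pullback
of `g`. -/
theorem divisorIdeal_eq_span_of_global (g : Γ(S.W, ⊤)) (hg : ∀ U : S.W.affineOpens,
      S.i.ker.ideal U = Ideal.span {S.W.presheaf.map (homOfLE le_top).op g})
    (V : (pullback S.y S.w).affineOpens) : S.divisorIdeal.ideal V =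
      Ideal.span {(pullback S.y S.w).presheaf.map (homOfLE le_top).op
        ((pullback.snd S.y S.w).appTop.hom g)} := by
  refine ideal_eq_span_of_locally _ _ (fun x O hx ↦ ?_) V
  obtain ⟨_, ⟨U, hU, rfl⟩, hxU, -⟩ := S.W.isBasis_affineOpens.exists_subset_of_mem_open
    (Set.mem_univ (pullback.snd S.y S.w x)) isOpen_univ
  obtain ⟨_, ⟨V, hV, rfl⟩, hxV, hVU⟩ :=
    (pullback S.y S.w).isBasis_affineOpens.exists_subset_of_mem_open (a := x)
      (u := (O ⊓ pullback.snd S.y S.w ⁻¹ᵁ U : (pullback S.y S.w).Opens)) ⟨hx, hxU⟩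
      (O ⊓ pullback.snd S.y S.w ⁻¹ᵁ U).2
  replace hVU : V ≤ O ⊓ pullback.snd S.y S.w ⁻¹ᵁ U := hVU
  refine ⟨⟨V, hV⟩, hxV, hVU.trans inf_le_left, ?_⟩
  rw [divisorIdeal_eq, comap_ideal_eq_map _ _ ⟨U, hU⟩ ⟨V, hV⟩ (hVU.trans inf_le_right), hg,
    Ideal.map_span, Set.image_singleton]
  congr 2
  rw [← RingHom.comp_apply, ← CommRingCat.hom_comp, Scheme.Hom.map_appLE]
  rfl

end DeformationDatum

end ParamDeformation

theorem mainTheorem10 {B : Scheme.{u}} (S : DeformationDatum B)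
    (hZ : IsEffectiveCartier S.i.ker) :
    -- over `W ∖ Z`, the morphism `π` is the projection from `Y ×_B (W ∖ Z)`
    (∃ e : (S.π hZ ⁻¹ᵁ S.offZ).toScheme ≅ pullback S.y (S.offZ.ι ≫ S.w),
      e.hom ≫ pullback.snd S.y (S.offZ.ι ≫ S.w) = S.π hZ ∣_ S.offZ ∧
      e.hom ≫ pullback.fst S.y (S.offZ.ι ≫ S.w) =
        (S.π hZ ⁻¹ᵁ S.offZ).ι ≫ S.blowdown hZ ≫ pullback.fst S.y S.w) ∧
    -- regularity of `X ⟶ Y ×_B W` implies regularity of `X ⟶ Y ×_B Z`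
    (IsRegularImmersion S.f → IsRegularImmersion S.toDivisor) ∧
    -- over `Z`, the morphism `π` is a torsor under a twist of the normal bundle, followed by `ψ`
    (IsRegularImmersion S.toDivisor →
      S.conormal.IsLocallyFree S.f ∧
      ∃ p : pullback (S.π hZ) S.i ⟶ S.X,
        p ≫ S.ψ = pullback.snd (S.π hZ) S.i ∧
        p ≫ S.f = pullback.fst (S.π hZ) S.i ≫ S.blowdown hZ ∧
        Nonempty (HomTorsor S.f S.conormal (idealModule S.divisorIdeal) p) ∧
        -- the twist disappears if `Z` is defined by a global function on `W`
        ((∃ g : Γ(S.W, ⊤), ∀ U : S.W.affineOpens,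
            S.i.ker.ideal U = Ideal.span {S.W.presheaf.map (homOfLE le_top).op g}) →
          Nonempty (HomTorsor S.f S.conormal (structureModule (pullback S.y S.w)) p))) ∧
    -- smoothness and finite presentation
    (IsRegularImmersion S.i → IsRegularImmersion S.toDivisor →
      Smooth (S.π hZ) ∧ (IsFinitelyPresented S.y → IsFinitelyPresented (S.π hZ))) := by
  refine ⟨S.exists_iso_offZ hZ, fun _ ↦ S.isRegularImmersion_toDivisor hZ,
    fun _ ↦ ⟨S.isLocallyFree_conormal hZ, S.fiberMap hZ, S.fiberMap_ψ hZ, S.fiberMap_f hZ,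
      ⟨S.homTorsor hZ⟩, ?_⟩,
    fun _ _ ↦ ⟨S.smooth_π hZ, S.isFinitelyPresented_π hZ⟩⟩
  rintro ⟨g, hg⟩
  obtain ⟨e, he⟩ := exists_linearEquiv_structureModule
    (DeformationDatum.isEffectiveCartier_divisorIdeal hZ) _ (S.divisorIdeal_eq_span_of_global g hg)
  exact ⟨(S.homTorsor hZ).congr e he⟩
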